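/- Let $\kappa$ be an algebraically closed field and let $X_0$ be a proper, reduced, connected, at worst nodal curve over $\kappa$ with smooth irreducible components $Z_v$ and dual graph $G$ (choose a direction on $G$). Let $P_e^v\in Z_v$ be the point over the node of an edge $e$ incident on $v$. Let $\overline G$ be obtained from $G$ by replacing all edges between two adjacent vertices by a single edge, and assume that $X_0$ is of pseudocompact type, i.e. that $\overline G$ is a tree. Let $\boldsymbol n\colon E(G)\to\mathbb Z_{>0}$ be a chain structure, $\Gamma$ the metric graph with underlying graph $G$ and edge lengths $\boldsymbol n(e)$, and $\mathfrak C=\mathfrak C_{X_0,\boldsymbol n}$ the metrized complex with underlying metric graph $\Gamma$, curves $Z_v$ and marked points $P_e^v$. Let $r\ge 0$. *Multidegrees.* An admissible multidegree $w=(w_G,\mu)$ consists of $w_G\colon V(G)\to\mathbb Z$ and $\mu(e)\in\mathbb Z/\boldsymbol n(e)$ for $e\in E(G)$; its degree is $\sum_v w_G(v)+\#\{e:\mu(e)\ne0\}$. The divisor $D_w$ on $\Gamma$ has coefficient $w_G(v)$ at $v$ and, for each $e$ with $\mu(e)\neq 0$, one chip in the interior of $e$ at distance $\mu(e)$ from the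 tail. With $\sigma(e,v)=1$ if $v$ is the tail of $e$ and $-1$ otherwise, the twist of $w$ at $v$ does the following for every edge $e$ incident on $v$, with other vertex $v'$: increase $w_G(v')$ by $1$ if $\mu(e)+\sigma(e,v)=0$, decrease $w_G(v)$ by $1$ if $\mu(e)=0$, and add $\sigma(e,v)$ to $\mu(e)$. For an edge $e$ of $\overline G$ at $v$, the twist at $(e,v)$ does this only for the edges over $e$. Fix an admissible multidegree $w_0$, of degree $d$, and let $G(w_0)$ be the set of multidegrees obtained from $w_0$ by sequences of twists. A tuple $(w_v)_{v\in V(G)}$ in $G(w_0)$ is tight if each $w_v$ is concentrated on $v$ (there is an ordering of $V(G)$ starting with $v$ such that, for each later vertex $v'$, the multidegree obtained from $w_v$ by inverting the twists at all vertices preceding $v'$ is negative at $v'$), and for each edge $e$ of $\overline G$ with endpoints $v,v'$, $w_v$ is obtained from $w_{v'}$ by twisting $b_{v,v'}\geq0$ times at $(e,v')$. *Pre-limit linear series.* For such a tuple and an edge $e$ of $\overline G$ with endpoints $v,v'$, let $D^{e,v}_0=0$ and $D^{e,v}_{i+1}-D^{e,v}_i=\sum P^v_{e'}$ over the edges $e'$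 of $G$ over $e$ with $\sigma(e',v)\mu_v(e')\equiv -i \pmod{\boldsymbol n(e')}$; $j$ is critical if $D^{e,v}_{j+1}\ne D^{e,v}_j$. A pre-limit linear series of rank $r$ with respect to $(w_v)_v$ is (up to isomorphism) a tuple $(\mathscr L_v,V_v)_v$ of line bundles $\mathscr L_v$ on $Z_v$, of degree equal to the coefficient of $D_{w_v}$ at $v$, and $(r+1)$-dimensional $V_v\subset H^0(Z_v,\mathscr L_v)$, such that the following holds for adjacent $v,v'$. Let $a^{e,v}_0\le\dots\le a^{e,v}_r$ be the sequence in which $\deg D^{e,v}_i$, $i$ critical, occurs $\dim V_v(-D_i^{e,v})/V_v(-D^{e,v}_{i+1})$ times. If $a_l^{e,v}=\deg D_j^{e,v}$ with $j$ critical, then $a_{r-l}^{e,v'}\ge\deg D^{e,v'}_{b_{v,v'}-j}$. *Limit linear series on $\mathfrak C$.* A nonzero rational function $\mathfrak f$ on $\mathfrak C$ consists of a continuous piecewise linear function $\mathfrak f_\Gamma$ with integral slopes on $\Gamma$ and of $0\ne\mathfrak f_v\in K(Z_v)$. Its divisor has at interior points of edges, and on $\Gamma$ in general, the sum of the outgoing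 slopes of $\mathfrak f_\Gamma$ as coefficient, and the coefficient $\mathrm{ord}_P(\mathfrak f_v)$ at $P\in Z_v$, to which the outgoing slope $\mathrm{slp}_{e,v}(\mathfrak f_\Gamma)$ is added if $P=P_e^v$. A limit linear series of degree $d$ and rank $r$ on $\mathfrak C$ is an equivalence class of pairs $(\mathcal D,\mathcal H)$ of a divisor $\mathcal D$ on $\mathfrak C$ of degree $d$ and $(r+1)$-dimensional subspaces $H_v\subset K(Z_v)$ such that $r$ is the largest integer $k\ge 0$ with the property that for each effective divisor $\mathcal E$ on $\mathfrak C$ of degree $k$ there is an $\mathfrak f$ with $\mathfrak f_v\in H_v$ for all $v$ and $\mathcal D+\mathrm{div}(\mathfrak f)-\mathcal E\ge0$. Here $(\mathcal D,\mathcal H)\sim(\mathcal D',\mathcal H')$ if $\mathcal D'=\mathcal D+\mathrm{div}(\mathfrak f)$ and $H_v=H'_v\mathfrak f_v$ for some $\mathfrak f$. It is of multidegree $w$ if some representative has $\Gamma$-part $D_w$, where the $\Gamma$-part has coefficient $\deg(\mathcal D|_{Z_v})$ at $v$. **Theorem.** For each $v\in V(G)$ there is a unique $w_v^{\mathrm{red}}\in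 G(w_0)$ such that $D_{w_v^{\mathrm{red}}}$ is $v$-reduced (as a divisor on the graph $\widetilde G$ obtained by subdividing each $e$ into $\boldsymbol n(e)$ edges: it is effective away from $v$, and every nonempty $S\subset V(\widetilde G)\setminus\{v\}$ contains a vertex $x$ whose coefficient is smaller than the number of edges from $x$ to $V(\widetilde G)\setminus S$), and the tuple $(w_v^{\mathrm{red}})_v$ is tight if $D_{w_v^{\mathrm{red}}}$ has nonnegative coefficient at $v$ for all $v$. There is a well-defined map $\mathfrak F$ from the set of pre-limit linear series of rank $r$ with respect to $(w_v^{\mathrm{red}})_v$ to the set of limit linear series of degree $d$, rank $r$ and multidegree $w_0$ on $\mathfrak C_{X_0,\boldsymbol n}$ which sends $(\mathscr L_v,V_v)_v$ to the class of $(\mathcal D,\mathcal H)$, where, for any choice of nonzero $s_v\in V_v$ and of $w\in G(w_0)$, $\mathcal D$ is of multidegree $w$ with $Z_v$-part $\mathrm{div}^0(s_v)-\sum_{e\ni v}\mathrm{slp}_{e,v}(f_v)P_e^v$, $f_v$ being a rational function on $\Gamma$ with $D_{w_v^{\mathrm{red}}}=D_w+\mathrm{div}(f_v)$, and $H_v=\{s/s_v: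 s\in V_v\}$. The map $\mathfrak F$ is a bijection. (If some $D_{w_v^{\mathrm{red}}}$ has negative coefficient at $v$, both sets are empty, whatever the values of $b_{v,v'}$.) -/

import Mathlib

universe u

namespace LimitLinear

open AlgebraicGeometry CategoryTheory Filter Topology

noncomputable section

/-! ## Curves over a field -/

section AuxiliaryFacts

theorem isPrincipal_maximalIdeal_of_etale {k A : Type*} [Field k] [CommRing A]
    (g : MvPolynomial (Fin 1) k →+* A) (hg : g.Etale) (q : Ideal A) [q.IsPrime] :
    (IsLocalRing.maximalIdeal (Localization.AtPrime q)).IsPrincipal := by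
  algebraize [g]
  have hP : IsPrincipalIdealRing (MvPolynomial (Fin 1) k) :=
    IsPrincipalIdealRing.of_surjective
      (MvPolynomial.uniqueAlgEquiv k (Fin 1)).symm.toRingEquiv.toRingHom
      (RingEquiv.surjective _)
  let p := q.under (MvPolynomial (Fin 1) k)
  let := Localization.AtPrime.algebraOfLiesOver p q
  have hu := (Algebra.isUnramifiedAt_iff_map_eq (MvPolynomial (Fin 1) k) p q).mp inferInstance
  rw [← hu.2]
  obtain ⟨a, ha⟩ := hP.principal p
  rw [ha]
  refine ⟨algebraMap _ _ a, ?_⟩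
  rw [Ideal.submodule_span_eq, Ideal.map_span, Set.image_singleton, Ideal.submodule_span_eq]

theorem isField_sections (κ : Type u) [Field κ] (U : (Spec (.of κ)).Opens) [Nonempty U] :
    IsField Γ(Spec (.of κ), U) := by
  have : U = ⊤ := by
    have ⟨x, hx⟩ : Nonempty U := inferInstance
    ext y
    have : y = x := Subsingleton.elim (α := PrimeSpectrum κ) y x
    simpa [this] using hx
  subst this
  exact (Scheme.ΓSpecIso (.of κ)).commRingCatIsoToRingEquiv.toMulEquiv.isField (Field.toIsField κ)

theorem stalk_isPrincipal {κ : Type u} [Field κ] {Z : Scheme.{u}} (f : Z ⟶ Spec (.of κ))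
    [SmoothOfRelativeDimension 1 f] (x : Z) :
    (IsLocalRing.maximalIdeal (Z.presheaf.stalk x)).IsPrincipal := by
  obtain ⟨U, hU, V, hV, hx, e, h⟩ :=
    SmoothOfRelativeDimension.exists_isStandardSmoothOfRelativeDimension (n := 1) (f := f) x
  have : Nonempty U := ⟨⟨f x, e hx⟩⟩
  let : Field Γ(Spec (.of κ), U) := (isField_sections κ U).toField
  obtain ⟨g, -, hg⟩ := h.exists_etale_mvPolynomial
  algebraize [(Z.presheaf.germ V x hx).hom]
  have hloc : IsLocalization.AtPrime (Z.presheaf.stalk x) (hV.primeIdealOf ⟨x, hx⟩).asIdeal :=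
    hV.isLocalization_stalk ⟨x, hx⟩
  set q := (hV.primeIdealOf ⟨x, hx⟩).asIdeal
  have hq := isPrincipal_maximalIdeal_of_etale g hg q
  let φ : Localization.AtPrime q ≃+* Z.presheaf.stalk x :=
    (IsLocalization.algEquiv q.primeCompl (Localization.AtPrime q) (Z.presheaf.stalk x)).toRingEquiv
  have hm := IsLocalRing.map_ringEquiv_maximalIdeal φ
  obtain ⟨a, ha⟩ := hq
  rw [← hm, ha]
  refine ⟨φ a, ?_⟩
  rw [Ideal.submodule_span_eq, Ideal.map_span, Set.image_singleton, Ideal.submodule_span_eq]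

theorem min_ord_le_ord_add {κ : Type u} [Field κ] {Z : Scheme.{u}} (f : Z ⟶ Spec (.of κ))
    [SmoothOfRelativeDimension 1 f] [AlgebraicGeometry.IsIntegral Z] [IsLocallyNoetherian Z] (x : Z)
    (a b : Z.functionField) (hab : a + b ≠ 0) :
    min (Scheme.ord a x) (Scheme.ord b x) ≤ Scheme.ord (a + b) x := by
  by_cases hx : Order.coheight x = 1
  · have hnf : ¬ IsField (Z.presheaf.stalk x) := by
      intro hf
      have h1 := ringKrullDim_stalk_eq_coheight x
      rw [hx, ringKrullDim_eq_zero_of_isField hf] at h1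
      simp at h1
    have : IsDiscreteValuationRing (Z.presheaf.stalk x) :=
      ((IsDiscreteValuationRing.TFAE (Z.presheaf.stalk x) hnf).out 4 0).mp (stalk_isPrincipal f x)
    exact Scheme.ord_add hab
  · simp [Scheme.ord_eq_zero_of_coheight_neq_one hx]

theorem isReduced_image {X Y : Scheme.{u}} (f : X ⟶ Y) [QuasiCompact f]
    [AlgebraicGeometry.IsReduced X] : AlgebraicGeometry.IsReduced f.image := by
  refine ⟨fun U ↦ ?_⟩
  have h := TopCat.Presheaf.app_injective_of_stalkFunctor_map_injective (F := f.image.sheaf)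
    f.toImage.c U (fun x _ ↦ f.stalkFunctor_toImage_injective x)
  have : _root_.IsReduced Γ(X, f.toImage ⁻¹ᵁ U) := inferInstance
  exact isReduced_of_injective (S := Γ(X, f.toImage ⁻¹ᵁ U)) (f.toImage.app U).hom h

theorem isIntegral_irreducibleComponent (X : Scheme.{u}) [IsNoetherian X]
    [AlgebraicGeometry.IsReduced X] (Z : Set X) (hZ : Z ∈ irreducibleComponents X) :
    AlgebraicGeometry.IsIntegral (X.irreducibleComponent Z hZ) := by
  have : AlgebraicGeometry.IsReduced (X.irreducibleComponent Z hZ) := by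
    unfold Scheme.irreducibleComponent
    rw [Scheme.irreducibleComponentIdeal_def]
    exact isReduced_image _
  exact isIntegral_of_irreducibleSpace_of_isReduced _

theorem isNoetherian_of_isProper {κ : Type u} [Field κ] {Z : Scheme.{u}} (f : Z ⟶ Spec (.of κ))
    [IsProper f] : IsNoetherian Z :=
  have : CompactSpace Z := QuasiCompact.compactSpace_of_compactSpace f
  { __ := LocallyOfFiniteType.isLocallyNoetherian f }

theorem finite_of_forall_isClosed_singleton {T : Type*} [TopologicalSpace T]
    [TopologicalSpace.NoetherianSpace T] [QuasiSober T] {S : Set T} (hS : IsClosed S)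
    (h : ∀ x ∈ S, IsClosed {x}) : S.Finite := by
  obtain ⟨F, hF, hcl, hirr, rfl⟩ :=
    TopologicalSpace.NoetherianSpace.exists_finite_set_isClosed_irreducible hS
  refine hF.sUnion fun t ht ↦ ?_
  obtain ⟨x, hx⟩ := QuasiSober.sober (hirr t ht) (hcl t ht)
  have hxt : x ∈ t := hx.mem
  have : t = {x} := by rw [← hx.def, (h x ⟨t, ht, hxt⟩).closure_eq]
  rw [this]
  exact Set.finite_singleton x

end AuxiliaryFacts

/-- A smooth proper (geometrically) connected curve over `κ`. -/
structure SmoothCurve (κ : Type u) [Field κ] where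
  Z : Scheme.{u}
  str : Z ⟶ Spec (.of κ)
  isIntegral : AlgebraicGeometry.IsIntegral Z
  isProper : IsProper str
  smooth : SmoothOfRelativeDimension 1 str

namespace SmoothCurve

variable {κ : Type u} [Field κ] (C : SmoothCurve κ)

instance : AlgebraicGeometry.IsIntegral C.Z := C.isIntegral
instance : IsProper C.str := C.isProper
instance : SmoothOfRelativeDimension 1 C.str := C.smooth
instance : IsNoetherian C.Z := isNoetherian_of_isProper C.str

/-- The (closed) points of the curve. -/
abbrev Point : Type u := closedPoints C.Z

/-- The field `K(C)` of rational functions. -/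
abbrev RatFn : Type u := C.Z.functionField

instance : Algebra κ C.RatFn :=
  ((Scheme.ΓSpecIso (.of κ)).inv ≫ C.str.appTop ≫
    C.Z.presheaf.germ ⊤ (genericPoint C.Z) trivial).hom.toAlgebra

/-- The order of vanishing of a nonzero rational function at a point (junk value `0` at `f = 0`). -/
def ord (f : C.RatFn) (P : C.Point) : ℤ := Scheme.ord f P.1

/-- Divisors on the curve. -/
abbrev Divisor : Type u := C.Point →₀ ℤ

theorem ord_algebraMap_mul (c : κ) (f : C.RatFn) (h : algebraMap κ C.RatFn c * f ≠ 0)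
    (P : C.Point) : C.ord (algebraMap κ C.RatFn c * f) P = C.ord f P := by
  have hc : c ≠ 0 := fun h0 ↦ h (by simp [h0])
  have : Nonempty (⊤ : C.Z.Opens) := ⟨⟨genericPoint C.Z, trivial⟩⟩
  have hu : IsUnit (((Scheme.ΓSpecIso (.of κ)).inv ≫ C.str.appTop).hom c) :=
    (isUnit_iff_ne_zero.mpr hc).map _
  have h0 : Scheme.ord (algebraMap κ C.RatFn c) P.1 = 0 := Scheme.ord_of_isUnit hu trivial
  unfold ord
  rw [Scheme.ord_mul (left_ne_zero_of_mul h) (right_ne_zero_of_mul h), h0, zero_add]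

/-- The space `H⁰(C, 𝒪(D))`, as a space of rational functions: the functions `f` that are zero or
satisfy `div f + D ≥ 0`. -/
def sections (D : C.Divisor) : Submodule κ C.RatFn where
  carrier := {f | f = 0 ∨ ∀ P, 0 ≤ C.ord f P + D P}
  zero_mem' := Or.inl rfl
  add_mem' := by
    intro a b ha hb
    by_cases ha0 : a = 0
    · simpa [ha0] using hb
    by_cases hb0 : b = 0
    · simpa [hb0] using ha
    by_cases hab : a + b = 0
    · exact Or.inl hab
    refine Or.inr fun P ↦ ?_
    have h1 := (ha.resolve_left ha0) P
    have h2 := (hb.resolve_left hb0) P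
    have h3 := min_ord_le_ord_add C.str P.1 a b hab
    unfold ord at *
    omega
  smul_mem' := by
    intro c f hf
    rw [Algebra.smul_def]
    by_cases h : algebraMap κ C.RatFn c * f = 0
    · exact Or.inl h
    · refine Or.inr fun P ↦ ?_
      rw [C.ord_algebraMap_mul c f h P]
      exact hf.resolve_left (right_ne_zero_of_mul h) P

end SmoothCurve

/-! ## Nodal curves and their dual graphs -/

/-- `x` is an ordinary double point of the reduced curve `X` at which exactly two irreducible
components meet, transversally: the local ring at the closed point `x` has exactly two minimal
primes, and their sum is the maximal ideal. When the components are smooth this says that the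
completed local ring is `κ⟦s, t⟧/(st)`. -/
def IsNode (X : Scheme.{u}) (x : X) : Prop :=
  IsClosed {x} ∧ ∃ p q : Ideal (X.presheaf.stalk x), p ≠ q ∧
    minimalPrimes (X.presheaf.stalk x) = {p, q} ∧
    p ⊔ q = IsLocalRing.maximalIdeal (X.presheaf.stalk x)

/-- A proper, reduced, connected, at worst nodal curve over `κ` all of whose irreducible components
are smooth. -/
structure NodalCurve (κ : Type u) [Field κ] where
  X : Scheme.{u}
  str : X ⟶ Spec (.of κ)
  isProper : IsProper str
  isReduced : AlgebraicGeometry.IsReduced X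
  connected : ConnectedSpace X
  smooth_component : ∀ (Z : Set X) (hZ : Z ∈ irreducibleComponents X),
    haveI : IsNoetherian X := isNoetherian_of_isProper str
    SmoothOfRelativeDimension 1 (X.irreducibleComponentι Z hZ ≫ str)
  nodal : ∀ Z ∈ irreducibleComponents X, ∀ Z' ∈ irreducibleComponents X, Z ≠ Z' →
    ∀ x ∈ Z ∩ Z', IsNode X x

namespace NodalCurve

variable {κ : Type u} [Field κ] (X₀ : NodalCurve κ)

instance : IsProper X₀.str := X₀.isProper
instance : AlgebraicGeometry.IsReduced X₀.X := X₀.isReduced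
instance : IsNoetherian X₀.X := isNoetherian_of_isProper X₀.str

/-- The set of irreducible components of `X₀`, which is the vertex set of the dual graph. -/
abbrev Component : Type u := irreducibleComponents X₀.X

/-- The irreducible component `Z_v`, as a smooth curve. -/
abbrev component (v : X₀.Component) : SmoothCurve κ where
  Z := X₀.X.irreducibleComponent v.1 v.2
  str := X₀.X.irreducibleComponentι v.1 v.2 ≫ X₀.str
  isIntegral := isIntegral_irreducibleComponent X₀.X v.1 v.2
  isProper := inferInstance
  smooth := X₀.smooth_component v.1 v.2

/-- The points of `X₀` that lie on two different irreducible components. -/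
def nodeSet : Set X₀.X :=
  {x | ∃ Z ∈ irreducibleComponents X₀.X, ∃ Z' ∈ irreducibleComponents X₀.X, Z ≠ Z' ∧ x ∈ Z ∩ Z'}

/-- The set of nodes of `X₀`, which is the edge set of the dual graph. -/
abbrev Node : Type u := X₀.nodeSet

theorem isClosed_node (x : X₀.Node) : IsClosed {x.1} := by
  obtain ⟨x, Z, hZ, Z', hZ', hne, hx⟩ := x
  exact (X₀.nodal Z hZ Z' hZ' hne x hx).1

instance : Finite X₀.Component :=
  TopologicalSpace.NoetherianSpace.finite_irreducibleComponents.to_subtype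

instance : Finite X₀.Node := by
  classical
  have hfin : (irreducibleComponents X₀.X).Finite :=
    TopologicalSpace.NoetherianSpace.finite_irreducibleComponents
  refine Set.Finite.to_subtype (((hfin.prod hfin).biUnion (t := fun p ↦
    if p.1 ∈ irreducibleComponents X₀.X ∧ p.2 ∈ irreducibleComponents X₀.X ∧ p.1 ≠ p.2 then
      p.1 ∩ p.2 else ∅) fun p _ ↦ ?_).subset ?_)
  · split_ifs with hp
    · exact finite_of_forall_isClosed_singleton
        ((isClosed_of_mem_irreducibleComponents _ hp.1).inter
          (isClosed_of_mem_irreducibleComponents _ hp.2.1))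
        fun x hx ↦ (X₀.nodal _ hp.1 _ hp.2.1 hp.2.2 x hx).1
    · exact Set.finite_empty
  · rintro x ⟨Z, hZ, Z', hZ', hne, hx⟩
    refine Set.mem_biUnion (x := (Z, Z')) ⟨hZ, hZ'⟩ ?_
    rw [if_pos ⟨hZ, hZ', hne⟩]
    exact hx

/-- A direction on the dual graph: a labelling, for each node, of the two components through it as
the tail and the head of the corresponding edge. -/
structure Orientation where
  tail : X₀.Node → X₀.Component
  head : X₀.Node → X₀.Component
  tail_ne_head : ∀ e, tail e ≠ head e
  mem_tail : ∀ e, e.1 ∈ (tail e).1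
  mem_head : ∀ e, e.1 ∈ (head e).1

/-- The point of the component `Z_v` lying over a node on it. -/
def nodePoint (v : X₀.Component) (x : X₀.Node) (hx : x.1 ∈ v.1) : (X₀.component v).Point :=
  ⟨(⟨x.1, hx⟩ : v.1), by
    have h := (X₀.isClosed_node x).preimage (X₀.X.irreducibleComponentι v.1 v.2).continuous
    refine (congrArg IsClosed (Set.ext fun y ↦ ?_)).mp h
    exact (Subtype.ext_iff (a1 := (y : v.1)) (a2 := ⟨x.1, hx⟩)).symm⟩

end NodalCurve

/-! ## Directed multigraphs, chain structures and admissible multidegrees -/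

/-- A finite directed multigraph without loops. -/
structure MGraph where
  V : Type u
  E : Type u
  finite_V : Finite V
  finite_E : Finite E
  tail : E → V
  head : E → V
  tail_ne_head : ∀ e, tail e ≠ head e

namespace MGraph

variable (G : MGraph.{u})

instance : Finite G.V := G.finite_V
instance : Finite G.E := G.finite_E

/-- `e` is incident on `v`. -/
def Inc (e : G.E) (v : G.V) : Prop := G.tail e = v ∨ G.head e = v

/-- `v` and `v'` are the two endpoints of `e`. -/
def Joins (e : G.E) (v v' : G.V) : Prop :=
  (G.tail e = v ∧ G.head e = v') ∨ (G.tail e = v' ∧ G.head e = v)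

/-- The simple graph obtained by replacing all edges between two adjacent vertices by one edge. The
edges of `G` over an edge `{v, v'}` of it are the edges joining `v` and `v'`. -/
def bar : SimpleGraph G.V where
  Adj v v' := ∃ e, G.Joins e v v'
  symm := ⟨fun _ _ ⟨e, h⟩ ↦ ⟨e, h.symm⟩⟩
  loopless := ⟨fun _ ⟨e, h⟩ ↦ h.elim (fun h ↦ G.tail_ne_head e (h.1.trans h.2.symm))
    (fun h ↦ G.tail_ne_head e (h.1.trans h.2.symm))⟩

/-- `G` is a multitree. -/
def IsMultitree : Prop := G.bar.IsTree

/-- A chain structure: a positive integer for every edge. -/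
abbrev ChainStructure : Type u := G.E → ℕ+

variable {G}

open Classical in
/-- The sign `σ(e, v)`: `1` if `v` is the tail of `e`, and `-1` otherwise. -/
def sign (e : G.E) (v : G.V) : ℤ := if G.tail e = v then 1 else -1

open Classical in
/-- The divisor `D` on the graph `G` is `v₀`-reduced. -/
def IsReduced (v₀ : G.V) (D : G.V → ℤ) : Prop :=
  (∀ v, v ≠ v₀ → 0 ≤ D v) ∧
  ∀ S : Set G.V, S.Nonempty → v₀ ∉ S →
    ∃ v ∈ S, D v < ({e : G.E | ∃ u, u ∉ S ∧ G.Joins e v u}.ncard : ℤ)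

/-- An admissible multidegree `(w_G, μ)` on `(G, n)`. -/
@[ext]
structure Multidegree (G : MGraph.{u}) (n : G.ChainStructure) where
  /-- the function `w_G` -/
  vert : G.V → ℤ
  /-- the tuple `μ` -/
  edge : ∀ e, ZMod (n e)

/-- The vertex of the subdivided graph at distance `k` from the tail of `e`, for `0 ≤ k ≤ n e`. -/
def chainVertex (n : G.ChainStructure) (e : G.E) (k : ℕ) : G.V ⊕ (Σ e : G.E, Fin (n e - 1)) :=
  if k = 0 then .inl (G.tail e)
  else if h : k - 1 < n e - 1 then .inr ⟨e, ⟨k - 1, h⟩⟩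
  else .inl (G.head e)

/-- The graph obtained from `G` by inserting `n e - 1` vertices in each edge `e`; the vertex
`.inr ⟨e, i⟩` is at distance `i + 1` from the tail of `e`. -/
def subdivision (G : MGraph.{u}) (n : G.ChainStructure) : MGraph.{u} where
  V := G.V ⊕ (Σ e : G.E, Fin (n e - 1))
  E := Σ e : G.E, Fin (n e)
  finite_V := inferInstance
  finite_E := inferInstance
  tail x := chainVertex n x.1 x.2
  head x := chainVertex n x.1 (x.2 + 1)
  tail_ne_head := by
    rintro ⟨e, i, hi⟩
    have h := G.tail_ne_head e
    unfold chainVertex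
    split_ifs <;> simp_all <;> omega

namespace Multidegree

variable {n : G.ChainStructure} (w : Multidegree G n)

/-- The total degree. -/
def degree : ℤ := ∑ᶠ v, w.vert v + ({e | w.edge e ≠ 0}.ncard : ℤ)

/-- The divisor `D_w`, as a divisor on the subdivided graph. -/
def divisor : (G.subdivision n).V → ℤ
  | .inl v => w.vert v
  | .inr ⟨e, i⟩ => if (w.edge e).val = (i : ℕ) + 1 then 1 else 0

open Classical in
/-- The twisting operation at `v`, carried out only for the edges in `F` that are incident on `v`:
along each such edge one chip moves away from `v` by distance one. -/
def twistAlong (F : Set G.E) (v : G.V) : Multidegree G n where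
  vert u :=
    (if u = v then w.vert v - ({e ∈ F | G.Inc e v ∧ w.edge e = 0}.ncard : ℤ) else w.vert u) +
      ({e ∈ F | G.Joins e v u ∧ w.edge e + (sign e v : ZMod (n e)) = 0}.ncard : ℤ)
  edge e := if e ∈ F ∧ G.Inc e v then w.edge e + (sign e v : ZMod (n e)) else w.edge e

/-- The twist of `w` at `v`. -/
def twist (v : G.V) : Multidegree G n := w.twistAlong Set.univ v

/-- The twist of `w` at `(e, v)`, where `e` is the edge of `G.bar` with endpoints `v` and `v'`. -/
def edgeTwist (v v' : G.V) : Multidegree G n := w.twistAlong {e | G.Joins e v v'} v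

/-- `w'` is obtained from `w` by a sequence of twists, i.e. `w'` is a vertex of `G(w)`. -/
def Reaches (w w' : Multidegree G n) : Prop :=
  Relation.ReflTransGen (fun a b ↦ ∃ v, b = a.twist v) w w'

/-- `w` is concentrated on `v`: there is an ordering `l` of the vertices starting at `v` such that
for each later vertex `x`, the composition `u` of the negative twists of `w` at all vertices before
`x` (i.e. the `u` whose twist at these vertices is `w`) is negative at `x`. -/
def IsConcentrated (v : G.V) : Prop :=
  ∃ l : List G.V, l.Nodup ∧ (∀ x, x ∈ l) ∧ l.head? = some v ∧
    ∀ p x s, l = p ++ x :: s → p ≠ [] →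
      ∃ u : Multidegree G n, p.foldl (fun a y ↦ a.twist y) u = w ∧ u.vert x < 0

/-- `b` is a number of times one has to twist `w₂` at `(e, v₂)` in order to obtain `w₁`, where `e` is
the edge of `G.bar` with endpoints `v₁` and `v₂`. -/
def IsTwistCount (w₁ w₂ : Multidegree G n) (v₁ v₂ : G.V) (b : ℕ) : Prop :=
  w₁ = (fun w ↦ edgeTwist w v₂ v₁)^[b] w₂

/-- The tuple `(w_v)_v` is tight. -/
def IsTight (w : G.V → Multidegree G n) : Prop :=
  (∀ v, (w v).IsConcentrated v) ∧
    ∀ v₁ v₂, G.bar.Adj v₁ v₂ → ∃ b, IsTwistCount (w v₁) (w v₂) v₁ v₂ b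

/-- The number `b_{v₁,v₂}` such that `w_{v₁}` is obtained from `w_{v₂}` by twisting `b_{v₁,v₂}` times
at `(e, v₂)`. -/
def twistCount (w : G.V → Multidegree G n) (v₁ v₂ : G.V) : ℕ :=
  sInf {b | IsTwistCount (w v₁) (w v₂) v₁ v₂ b}

/-- `(w_v)_v` is the tuple of reduced multidegrees: `w_v` is a vertex of `G(w₀)` and `D_{w_v}` is
`v`-reduced. -/
def IsReducedTuple (w₀ : Multidegree G n) (w : G.V → Multidegree G n) : Prop :=
  ∀ v, Reaches w₀ (w v) ∧
    MGraph.IsReduced (G := G.subdivision n) (.inl v) (w v).divisor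

end Multidegree

/-! ### Rational functions on the metric graph -/

/-- A rational function on the metric graph `Γ` with underlying graph `G` and edge lengths `n`: a
continuous piecewise linear function with integral slopes. The edge `e` is identified with
`[0, n e]`, the tail being `0`. Piecewise linearity is expressed by the existence of an integral
outgoing slope in each tangent direction at each point. Values of `onEdge e` outside `[0, n e]` play
no role. -/
structure RatFn (G : MGraph.{u}) (n : G.ChainStructure) where
  onVertex : G.V → ℝ
  onEdge : G.E → ℝ → ℝ
  onEdge_tail : ∀ e, onEdge e 0 = onVertex (G.tail e)
  onEdge_head : ∀ e, onEdge e (n e) = onVertex (G.head e)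
  exists_slope_right : ∀ e, ∀ t ∈ Set.Ico (0 : ℝ) (n e), ∃ m : ℤ,
    ∀ᶠ s in 𝓝[>] t, onEdge e s = onEdge e t + m * (s - t)
  exists_slope_left : ∀ e, ∀ t ∈ Set.Ioc (0 : ℝ) (n e), ∃ m : ℤ,
    ∀ᶠ s in 𝓝[<] t, onEdge e s = onEdge e t + m * (t - s)

namespace RatFn

variable {n : G.ChainStructure} (f : RatFn G n)

open Classical in
/-- The outgoing slope at the point `t` of `e` in the direction of the head. -/
def slopeRight (e : G.E) (t : ℝ) : ℤ :=
  if h : t ∈ Set.Ico (0 : ℝ) (n e) then (f.exists_slope_right e t h).choose else 0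

open Classical in
/-- The outgoing slope at the point `t` of `e` in the direction of the tail. -/
def slopeLeft (e : G.E) (t : ℝ) : ℤ :=
  if h : t ∈ Set.Ioc (0 : ℝ) (n e) then (f.exists_slope_left e t h).choose else 0

open Classical in
/-- The outgoing slope at the endpoint `v` of `e`, along `e`. -/
def slope (e : G.E) (v : G.V) : ℤ :=
  if G.tail e = v then f.slopeRight e 0 else f.slopeLeft e (n e)

/-- The coefficient of `div f` at the vertex `v`. -/
def ordVertex (v : G.V) : ℤ := ∑ᶠ e ∈ {e | G.Inc e v}, f.slope e v

/-- The coefficient of `div f` at the interior point `t` of `e`. -/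
def ordEdge (e : G.E) (t : ℝ) : ℤ := f.slopeRight e t + f.slopeLeft e t

end RatFn

open Classical in
/-- The coefficient of the divisor `D_w` on `Γ` at the interior point `t` of `e`. -/
def Multidegree.coeffEdge {n : G.ChainStructure} (w : Multidegree G n) (e : G.E) (t : ℝ) : ℤ :=
  if ((w.edge e).val : ℝ) = t then 1 else 0

/-- `D_{w'} = D_w + div f` on `Γ`. -/
def Multidegree.IsEquivVia {n : G.ChainStructure} (w w' : Multidegree G n) (f : RatFn G n) : Prop :=
  (∀ v, w'.vert v = w.vert v + f.ordVertex v) ∧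
  ∀ e, ∀ t ∈ Set.Ioo (0 : ℝ) (n e), w'.coeffEdge e t = w.coeffEdge e t + f.ordEdge e t

end MGraph

open MGraph

/-! ## Metrized complexes and their limit linear series -/

/-- A metrized complex of curves over `κ`, with integral edge lengths. -/
structure MetrizedComplex (κ : Type u) [Field κ] where
  graph : MGraph.{u}
  len : graph.ChainStructure
  curve : graph.V → SmoothCurve κ
  /-- the point `x_e^v` of `C_v`, for an edge `e` incident on `v` -/
  mark : ∀ e v, graph.Inc e v → (curve v).Point
  mark_injective : ∀ e e' v (h : graph.Inc e v) (h' : graph.Inc e' v),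
    mark e v h = mark e' v h' → e = e'

/-- The dual graph of a nodal curve, with a chosen direction. -/
abbrev NodalCurve.dualGraph {κ : Type u} [Field κ] (X₀ : NodalCurve κ) (o : X₀.Orientation) :
    MGraph.{u} where
  V := X₀.Component
  E := X₀.Node
  finite_V := inferInstance
  finite_E := inferInstance
  tail := o.tail
  head := o.head
  tail_ne_head := o.tail_ne_head

/-- The metrized complex `ℭ_{X₀,n}`. -/
abbrev NodalCurve.metrizedComplex {κ : Type u} [Field κ] (X₀ : NodalCurve κ) (o : X₀.Orientation)
    (n : (X₀.dualGraph o).ChainStructure) : MetrizedComplex κ where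
  graph := X₀.dualGraph o
  len := n
  curve v := X₀.component v
  mark e v h := X₀.nodePoint v e
    (h.elim (fun h ↦ h ▸ o.mem_tail e) (fun h ↦ h ▸ o.mem_head e))
  mark_injective e e' v h h' hm := by
    have h1 := congrArg (fun P : (X₀.component v).Point ↦
      X₀.X.irreducibleComponentι v.1 v.2 P.1) hm
    exact Subtype.ext h1

namespace MetrizedComplex

variable {κ : Type u} [Field κ] (𝔠 : MetrizedComplex κ)

/-- The points of the geometric realization: the points of the curves `C_v`, and the interior points
of the edges of `Γ` (the endpoints of the edges are identified with the marked points). -/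
abbrev Realization : Type u :=
  (Σ v : 𝔠.graph.V, (𝔠.curve v).Point) ⊕ (Σ e : 𝔠.graph.E, Set.Ioo (0 : ℝ) (𝔠.len e))

/-- Divisors on the metrized complex. -/
abbrev Divisor : Type u := 𝔠.Realization →₀ ℤ

variable {𝔠}

/-- The degree of a divisor on the metrized complex. -/
def Divisor.degree (D : 𝔠.Divisor) : ℤ := D.sum fun _ a ↦ a

/-- The divisor `D` is of multidegree `w`: its `Γ`-part is `D_w`. -/
def Divisor.IsOfMultidegree (D : 𝔠.Divisor) (w : Multidegree 𝔠.graph 𝔠.len) : Prop :=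
  (∀ v, ∑ᶠ P, D (.inl ⟨v, P⟩) = w.vert v) ∧
  ∀ e t, D (.inr ⟨e, t⟩) = w.coeffEdge e t

open Classical in
/-- The coefficient at `P` of the divisor `∑ slp_{e,v}(f) x_e^v` on `C_v`, the sum being over all edges
incident on `v`. -/
def slopeAt (f : RatFn 𝔠.graph 𝔠.len) (v : 𝔠.graph.V) (P : (𝔠.curve v).Point) : ℤ :=
  ∑ᶠ e ∈ {e | ∃ h : 𝔠.graph.Inc e v, 𝔠.mark e v h = P}, f.slope e v

variable (𝔠) in
/-- A nonzero rational function on the metrized complex. -/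
structure RatFn where
  onGraph : MGraph.RatFn 𝔠.graph 𝔠.len
  onCurve : ∀ v, (𝔠.curve v).RatFn
  onCurve_ne_zero : ∀ v, onCurve v ≠ 0

/-- The coefficients of the divisor of a nonzero rational function. -/
def RatFn.ord (f : 𝔠.RatFn) : 𝔠.Realization → ℤ
  | .inl ⟨v, P⟩ => (𝔠.curve v).ord (f.onCurve v) P + slopeAt f.onGraph v P
  | .inr ⟨e, t⟩ => f.onGraph.ordEdge e t

/-- The restricted rank of `D` with respect to the collection of spaces `H` equals `r`. -/
def HasRestrictedRank (D : 𝔠.Divisor) (H : ∀ v, Submodule κ (𝔠.curve v).RatFn) (r : ℕ) : Prop :=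
  IsGreatest {k : ℕ | ∀ A : 𝔠.Divisor, 0 ≤ A → A.degree = k →
    ∃ f : 𝔠.RatFn, (∀ v, f.onCurve v ∈ H v) ∧ ∀ x, 0 ≤ D x + f.ord x - A x} r

variable (𝔠) in
/-- A pair `(D, H)` representing a limit linear series of degree `d` and rank `r`. -/
structure LimitPair (d : ℤ) (r : ℕ) where
  D : 𝔠.Divisor
  H : ∀ v, Submodule κ (𝔠.curve v).RatFn
  degree_eq : D.degree = d
  finrank_eq : ∀ v, Module.finrank κ (H v) = r + 1
  rank_eq : HasRestrictedRank D H r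

/-- Equivalence of pairs: `D' = D + div f` and `H_v = H'_v · f_v` for some rational function `f`. -/
def LimitPair.Equivalent {d : ℤ} {r : ℕ} (x x' : 𝔠.LimitPair d r) : Prop :=
  ∃ f : 𝔠.RatFn, (∀ p, x'.D p = x.D p + f.ord p) ∧
    ∀ v, x.H v = (x'.H v).map (LinearMap.mulRight κ (f.onCurve v))

variable (𝔠) in
/-- Limit linear series of degree `d` and rank `r`: equivalence classes of pairs. -/
abbrev LimitSeries (d : ℤ) (r : ℕ) := Quot (LimitPair.Equivalent (𝔠 := 𝔠) (d := d) (r := r))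

variable (𝔠) in
/-- The set of limit linear series of rank `r` and multidegree `w₀`. -/
abbrev LimitSeriesOf (w₀ : Multidegree 𝔠.graph 𝔠.len) (r : ℕ) :=
  {q : 𝔠.LimitSeries w₀.degree r //
    ∃ x : 𝔠.LimitPair w₀.degree r, Quot.mk _ x = q ∧ x.D.IsOfMultidegree w₀}

/-! ## Pre-limit linear series

The data of `(X₀, n)` enter here only through the dual graph, `n`, the components `Z_v` and the
points of `Z_v` over the nodes, which are all parts of the metrized complex of `(X₀, n)`. -/

open Classical in
/-- The twisting divisor `D_i^{e,v}` on `Z_v` associated with `w = w_v`, where `e` is the edge of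
`bar` with endpoints `v` and `v'`. -/
def twistingDivisor (w : Multidegree 𝔠.graph 𝔠.len) (v v' : 𝔠.graph.V) (i : ℕ) :
    (𝔠.curve v).Divisor :=
  ∑ k ∈ Finset.range i, ∑ᶠ e : {e : 𝔠.graph.E // 𝔠.graph.Joins e v v' ∧
      (sign e v : ZMod (𝔠.len e)) * w.edge e = -(k : ZMod (𝔠.len e))},
    Finsupp.single (𝔠.mark e.1 v (e.2.1.elim (fun h ↦ .inl h.1) (fun h ↦ .inr h.2))) 1

end MetrizedComplex

namespace SmoothCurve

variable {κ : Type u} [Field κ] {C : SmoothCurve κ}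

/-- The degree of a divisor on a curve over an algebraically closed field. -/
def Divisor.degree (D : C.Divisor) : ℤ := D.sum fun _ a ↦ a

/-- For a space `V` of sections of `𝒪(A)`, the subspace `V(-D)` of sections vanishing along `D`. -/
def vanishing (V : Submodule κ C.RatFn) (A D : C.Divisor) : Submodule κ C.RatFn :=
  V ⊓ C.sections (A - D)

/-- `j` is critical for the sequence `D`. -/
def IsCritical (D : ℕ → C.Divisor) (j : ℕ) : Prop := D (j + 1) ≠ D j

/-- `a` is the multivanishing sequence of the linear series `(𝒪(A), V)` along the nondecreasing
sequence `D` of effective divisors: the value `deg D_i`, for `i` critical, appears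
`dim V(-D_i)/V(-D_{i+1})` times, and there are no other values. -/
def IsMultivanishing {r : ℕ} (V : Submodule κ C.RatFn) (A : C.Divisor) (D : ℕ → C.Divisor)
    (a : Fin (r + 1) → ℤ) : Prop :=
  Monotone a ∧
  (∀ i, IsCritical D i → {l | a l = (D i).degree}.ncard =
    Module.finrank κ (↥(vanishing V A (D i)) ⧸
      (vanishing V A (D (i + 1))).submoduleOf (vanishing V A (D i)))) ∧
  ∀ l, ∃ i, IsCritical D i ∧ a l = (D i).degree

end SmoothCurve

namespace MetrizedComplex

variable {κ : Type u} [Field κ] {𝔠 : MetrizedComplex κ}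

open SmoothCurve

variable (𝔠) in
/-- A pre-limit linear series of rank `r` with respect to `(w_v)_v`, up to the choice of the divisors
`A_v` on `Z_v` with `ℒ_v ≅ 𝒪(A_v)`: every line bundle on the smooth curve `Z_v` is of this form, and
its global sections are then the rational functions in `H⁰(Z_v, 𝒪(A_v))`. The field `vanishing_le` is
the condition that, for adjacent `v`, `v'`, if `a_l^{e,v} = deg D_j^{e,v}` with `j` critical, then
`a_{r-l}^{e,v'} ≥ deg D_{b-j}^{e,v'}` with `b = b_{v,v'}` (and `D_{b-j} = 0` if `j > b`). -/
structure PreLimitData (w : 𝔠.graph.V → Multidegree 𝔠.graph 𝔠.len) (r : ℕ) where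
  A : ∀ v, (𝔠.curve v).Divisor
  W : ∀ v, Submodule κ (𝔠.curve v).RatFn
  degree_eq : ∀ v, (A v).degree = (w v).vert v
  le_sections : ∀ v, W v ≤ (𝔠.curve v).sections (A v)
  finrank_eq : ∀ v, Module.finrank κ (W v) = r + 1
  vanishing_le : ∃ a : 𝔠.graph.V → 𝔠.graph.V → Fin (r + 1) → ℤ,
    ∀ v v', 𝔠.graph.bar.Adj v v' →
      IsMultivanishing (W v) (A v) (twistingDivisor (w v) v v') (a v v') ∧
      ∀ l j, IsCritical (twistingDivisor (w v) v v') j →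
        a v v' l = (twistingDivisor (w v) v v' j).degree →
          (twistingDivisor (w v') v' v (Multidegree.twistCount w v v' - j)).degree ≤ a v' v l.rev

/-- Isomorphism of pre-limit linear series: isomorphisms `𝒪(A_v) ≅ 𝒪(A'_v)`, which are the
multiplications by rational functions `g_v` with `A'_v = A_v - div g_v`, that carry the given spaces
of sections to each other. -/
def PreLimitData.Isomorphic {w : 𝔠.graph.V → Multidegree 𝔠.graph 𝔠.len} {r : ℕ}
    (x x' : 𝔠.PreLimitData w r) : Prop :=
  ∃ g : ∀ v, (𝔠.curve v).RatFn, ∀ v, g v ≠ 0 ∧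
    (∀ P, x'.A v P = x.A v P - (𝔠.curve v).ord (g v) P) ∧
    x'.W v = (x.W v).map (LinearMap.mulLeft κ (g v))

variable (𝔠) in
/-- The set of pre-limit linear series (up to isomorphism) of rank `r` with respect to `(w_v)_v`. -/
abbrev PreLimitSeries (w : 𝔠.graph.V → Multidegree 𝔠.graph 𝔠.len) (r : ℕ) :=
  Quot (PreLimitData.Isomorphic (𝔠 := 𝔠) (w := w) (r := r))

/-! ## The forgetful map -/

/-- The pair `(D, H)` is the one obtained from the pre-limit linear series `x` with the choices of
sections `s_v` and of a multidegree `u`: `D` is of multidegree `u` with `C_v`-part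
`div⁰(s_v) - D_{u,w_v}^v`, and `H_v = {s / s_v}`. Here `div⁰(s_v) = div(s_v) + A_v`, and
`D_{u,w_v}^v = ∑ slp_{e,v}(f) x_e^v` with `D_{w_v} = D_u + div f`. -/
def IsForgetfulPair {w : 𝔠.graph.V → Multidegree 𝔠.graph 𝔠.len} {r : ℕ} {d : ℤ}
    (x : 𝔠.PreLimitData w r) (s : ∀ v, (𝔠.curve v).RatFn) (u : Multidegree 𝔠.graph 𝔠.len)
    (y : 𝔠.LimitPair d r) : Prop :=
  y.D.IsOfMultidegree u ∧
  (∀ v, ∃ f : MGraph.RatFn 𝔠.graph 𝔠.len, u.IsEquivVia (w v) f ∧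
    ∀ P, y.D (.inl ⟨v, P⟩) = (𝔠.curve v).ord (s v) P + x.A v P - slopeAt f v P) ∧
  ∀ v, y.H v = (x.W v).map (LinearMap.mulLeft κ (s v)⁻¹)

/-- `F` is the forgetful map: whatever nonzero sections `s_v ∈ W_v` and multidegree `u` in `G(w₀)` are
chosen, the resulting pair is a limit linear series and represents the value of `F`. -/
def IsForgetfulMap {w₀ : Multidegree 𝔠.graph 𝔠.len} {w : 𝔠.graph.V → Multidegree 𝔠.graph 𝔠.len}
    {r : ℕ} (F : 𝔠.PreLimitSeries w r → 𝔠.LimitSeriesOf w₀ r) : Prop :=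
  ∀ (x : 𝔠.PreLimitData w r) (s : ∀ v, (𝔠.curve v).RatFn) (u : Multidegree 𝔠.graph 𝔠.len),
    (∀ v, s v ∈ x.W v ∧ s v ≠ 0) → Multidegree.Reaches w₀ u →
      ∃ y : 𝔠.LimitPair w₀.degree r, IsForgetfulPair x s u y ∧
        (F (Quot.mk _ x)).1 = Quot.mk _ y

end MetrizedComplex

end

end LimitLinear

namespace LimitLinear

open AlgebraicGeometry CategoryTheory Filter Topology

set_option linter.unusedSectionVars false

/-! ## Local rings and orders on a curve -/

noncomputable section

namespace SmoothCurve

variable {κ : Type u} [Field κ] [IsAlgClosed κ] (C : SmoothCurve κ)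

/-! Both sides of the correspondence are translated into inequalities between codimensions of spaces
of sections, one family for each edge of the tree `G.bar`.

Combinatorics. An edge `e` carries a virtual chip whose position is an integer modulo `n e`. Pushing
it away from `v` by `k` makes a difference of two ceilings, `leave`, of chips leave `v`. Sequences
of twists are the action of coboundaries of functions `c : G.V → ℤ` (`reaches_iff`). Since `G.bar`
is a tree, being `v`-reduced is a condition at each vertex `u ≠ v` separately (`isReduced_iff`): the
coefficient at `u` is nonnegative, but smaller than the number of chips that one more push from `u`
towards `v` would remove. Solving these conditions from the leaves towards `v` gives existence and
uniqueness. For adjacent `v`, `v'` the same argument shows that the two reduced multidegrees differ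
only along the edges joining `v` and `v'`, whence tightness.

Pre-limit side. A value `a l` of a multivanishing sequence lies below `deg D_j` exactly if `l` is
less than the codimension of `V(-D_j)`. Hence the condition on an edge `{v, v'}` says that `codim
V_v(-D_{j+1}) + codim V_{v'}(-D_{b-j}) ≤ r + 1` for every integer `j`
(`exists_isMultivanishing_iff`).

From these inequalities to the rank. Let `E` be effective of degree `r`. Once the values `F` of
`f_Γ` at the vertices are chosen, `f_Γ` can be completed on each edge so that the chips of `E` and
one further chip appear there (`exists_ratFn`). What remains is that each `f_v` vanishes to
prescribed orders at the marked points, and the orders towards `v'` depend only on the real number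
`F v - F v'`. This number is chosen so that the conditions cost at `v` at most the mass of `E`
beyond `v'`, and conversely (`exists_drop`). There are no cycles in `G.bar`, so the differences come
from a function `F`, and the conditions at `v` cost at most `r` dimensions out of `r + 1`.

From the rank to the inequalities. Imposing zeros at suitable points, one finds `f` with `D + div f
≥ 0` whose components avoid given subspaces of total dimension at most `r` (`exists_ratFn_notMem`).
A maximum principle for reduced multidegrees (`slope_le_of_redAt`) then forces `H_v` into the
sections of the expected line bundle. If an inequality failed, `f_v` and `f_{v'}` could avoid both
vanishing subspaces, which bounds `F v - F v'` and `F v' - F v` by integers with sum `-1`.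

Finally the slopes at `v` of a function relating `D_u` to the reduced divisor `D_{w_v}` do not
depend on the function (`slope_eq_of_isEquivVia`), so the line bundles and the divisor determine
each other up to the two equivalences. The geometric input is that the local rings are discrete
valuation rings with residue field `κ`, that everywhere regular functions are constant, that orders
at finitely many points can be approximated, and that principal divisors have degree zero. -/

theorem appTop_surjective : Function.Surjective C.str.appTop.hom := by
  have hfin := finite_appTop_of_universallyClosed κ C.str
  have hint : ((Scheme.ΓSpecIso (.of κ)).inv ≫ C.str.appTop).hom.IsIntegral := by
    apply RingHom.isIntegral_respectsIso.2 (e := (Scheme.ΓSpecIso _).symm.commRingCatIsoToRingEquiv)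
    exact isIntegral_appTop_of_universallyClosed C.str
  have hF := isField_of_universallyClosed κ C.str
  let : Field Γ(C.Z, ⊤) := hF.toField
  have hb := IsAlgClosed.ringHom_bijective_of_isIntegral _ hint
  intro y
  obtain ⟨c, hc⟩ := hb.2 y
  exact ⟨_, hc⟩

theorem injective_of_etale {k A : Type*} [CommRing k] [IsDomain k] [CommRing A] [Nontrivial A]
    (g : MvPolynomial (Fin 1) k →+* A) (hg : g.Etale) : Function.Injective g := by
  algebraize [g]
  have : Module.Flat (MvPolynomial (Fin 1) k) A := inferInstance
  exact FaithfulSMul.algebraMap_injective (MvPolynomial (Fin 1) k) A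

/-- Otherwise the curve is a single point, and its ring of global functions is étale over a
polynomial ring in one variable, which it contains by flatness. But all global functions are
constants, so the variable would be a constant. -/
theorem not_isClosed_genericPoint : ¬ IsClosed {genericPoint C.Z} := by
  intro hcl
  have huniv : ({genericPoint C.Z} : Set C.Z) = Set.univ := by
    rw [← hcl.closure_eq, (genericPoint_spec C.Z)]
  obtain ⟨U, hU, V, hV, hx, e, h⟩ :=
    SmoothOfRelativeDimension.exists_isStandardSmoothOfRelativeDimension (n := 1) (f := C.str)
      (genericPoint C.Z)
  have hVt : V = ⊤ := by
    ext y
    have : y = genericPoint C.Z := by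
      have := Set.mem_univ y
      rwa [← huniv] at this
    simpa [this] using hx
  have hUt : U = ⊤ := by
    ext y
    have : y = C.str (genericPoint C.Z) := Subsingleton.elim (α := PrimeSpectrum κ) y _
    simpa [this] using e hx
  subst hVt hUt
  let : Field Γ(Spec (.of κ), ⊤) :=
    ((Scheme.ΓSpecIso (.of κ)).commRingCatIsoToRingEquiv.toMulEquiv.isField
      (Field.toIsField κ)).toField
  obtain ⟨g, hgC, hg⟩ := h.exists_etale_mvPolynomial
  have : Nonempty (⊤ : C.Z.Opens) := ⟨⟨genericPoint C.Z, trivial⟩⟩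
  have hinj := injective_of_etale g hg
  obtain ⟨c, hc⟩ := C.appTop_surjective (g (MvPolynomial.X 0))
  have h1 : C.str.appTop.hom c = g (MvPolynomial.C c) := by
    rw [← RingHom.comp_apply, hgC]
    exact congrArg (fun φ => φ.hom c) (Scheme.Hom.appLE_eq_app (f := C.str) (U := ⊤)).symm
  rw [h1] at hc
  have h2 := congrArg MvPolynomial.totalDegree (hinj hc)
  simp at h2

theorem coheight_le_one (x : C.Z) : Order.coheight x ≤ 1 := by
  have h := stalk_isPrincipal C.str x
  have h1 : ringKrullDim (C.Z.presheaf.stalk x) ≤ 1 := by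
    rw [← IsLocalRing.maximalIdeal_height_eq_ringKrullDim]
    exact_mod_cast Ideal.height_le_one_of_isPrincipal_of_mem_minimalPrimes
      (IsLocalRing.maximalIdeal (C.Z.presheaf.stalk x)) _ (by
        rw [Ideal.minimalPrimes_eq_subsingleton_self]; rfl)
  rw [ringKrullDim_stalk_eq_coheight] at h1
  exact_mod_cast h1

theorem coheight_eq_one_of_ne (x : C.Z) (hx : x ≠ genericPoint C.Z) : Order.coheight x = 1 := by
  refine le_antisymm (C.coheight_le_one x) ?_
  rw [Order.one_le_iff_ne_zero]
  intro h0
  rw [Order.coheight_eq_zero] at h0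
  have h1 : genericPoint C.Z ⤳ x := (genericPoint_spec C.Z).specializes trivial
  have h2 := h0 (b := genericPoint C.Z) h1
  exact hx (Specializes.antisymm (h2 : x ⤳ _) h1).eq

theorem ne_genericPoint (P : C.Point) : P.1 ≠ genericPoint C.Z := by
  intro h
  have := P.2
  rw [h] at this
  exact C.not_isClosed_genericPoint this

theorem coheight_point (P : C.Point) : Order.coheight P.1 = 1 :=
  C.coheight_eq_one_of_ne _ (C.ne_genericPoint P)

/-- A point that is neither generic nor closed would specialize to a closed point of coheight at
least two, whereas principal maximal ideals bound the coheight by one. -/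
theorem isClosed_singleton_of_ne (x : C.Z) (hx : x ≠ genericPoint C.Z) : IsClosed {x} := by
  obtain ⟨y, hy, hyc⟩ := IsClosed.exists_closed_singleton (S := closure {x}) isClosed_closure
    ⟨x, subset_closure rfl⟩
  have hxy : x ⤳ y := specializes_iff_mem_closure.mpr hy
  by_cases hyx : y = x
  · rwa [← hyx]
  · exfalso
    -- In the order used for `coheight`, `x ⤳ y` means `y ≤ x`; the generic point is the greatest
    -- element.
    have h1 : y < x := by
      refine lt_of_le_not_ge (show x ⤳ y from hxy) fun h => hyx ?_
      exact (Specializes.antisymm (show y ⤳ x from h) hxy).eq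
    have h2 := C.coheight_eq_one_of_ne x hx
    have h3 := Order.coheight_add_one_le h1
    have h4 := C.coheight_le_one y
    rw [h2] at h3
    exact absurd (h3.trans h4) (by decide)

instance (P : C.Point) : IsDiscreteValuationRing (C.Z.presheaf.stalk P.1) := by
  have hnf : ¬ IsField (C.Z.presheaf.stalk P.1) := by
    intro hf
    have h1 := ringKrullDim_stalk_eq_coheight P.1
    rw [C.coheight_point P, ringKrullDim_eq_zero_of_isField hf] at h1
    simp at h1
  exact ((IsDiscreteValuationRing.TFAE (C.Z.presheaf.stalk P.1) hnf).out 4 0).mp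
    (stalk_isPrincipal C.str P.1)

instance (P : C.Point) : Ring.KrullDimLE 1 (C.Z.presheaf.stalk P.1) :=
  krullDimLE_of_coheight_le (C.coheight_point P).le

theorem ord_mul {f g : C.RatFn} (hf : f ≠ 0) (hg : g ≠ 0) (P : C.Point) :
    C.ord (f * g) P = C.ord f P + C.ord g P := Scheme.ord_mul hf hg

theorem min_ord_le (f g : C.RatFn) (h : f + g ≠ 0) (P : C.Point) :
    min (C.ord f P) (C.ord g P) ≤ C.ord (f + g) P := min_ord_le_ord_add C.str P.1 f g h

theorem zero_le_ord_iff {f : C.RatFn} (hf : f ≠ 0) (P : C.Point) :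
    0 ≤ C.ord f P ↔ ∃ a : C.Z.presheaf.stalk P.1, algebraMap _ C.RatFn a = f := by
  unfold ord
  rw [Scheme.le_ord_iff (C.coheight_point P) hf]
  change _ ≤ Ring.ordFrac (C.Z.presheaf.stalk P.1) f ↔ _
  rw [Ring.ordFrac_eq_valuation_inv]
  have h0 : (IsDiscreteValuationRing.maximalIdeal (C.Z.presheaf.stalk P.1)).valuation C.RatFn f
      ≠ 0 := (Valuation.ne_zero_iff _).mpr hf
  have h1 : (((Multiplicative.ofAdd (0 : ℤ) : Multiplicative ℤ)) : WithZero (Multiplicative ℤ))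
      = 1 := rfl
  rw [h1, one_le_inv₀ (zero_lt_iff.mpr h0)]
  refine ⟨fun h => IsDiscreteValuationRing.exists_lift_of_le_one h, ?_⟩
  rintro ⟨a, rfl⟩
  exact IsDedekindDomain.HeightOneSpectrum.valuation_le_one _ _

theorem exists_ord_eq_one (P : C.Point) : ∃ t : C.RatFn, t ≠ 0 ∧ C.ord t P = 1 := by
  obtain ⟨ϖ, hϖ⟩ := IsDiscreteValuationRing.exists_irreducible (C.Z.presheaf.stalk P.1)
  have hne : algebraMap (C.Z.presheaf.stalk P.1) C.RatFn ϖ ≠ 0 := by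
    rw [Ne, FaithfulSMul.algebraMap_eq_zero_iff]
    exact hϖ.ne_zero
  refine ⟨_, hne, ?_⟩
  unfold ord
  rw [Scheme.ord_eq_iff (C.coheight_point P) hne]
  exact Ring.ordFrac_irreducible hϖ

theorem ord_one (P : C.Point) : C.ord 1 P = 0 := by
  have := C.ord_mul one_ne_zero one_ne_zero P
  rw [mul_one] at this
  omega

theorem ord_inv {f : C.RatFn} (hf : f ≠ 0) (P : C.Point) : C.ord f⁻¹ P = - C.ord f P := by
  have := C.ord_mul hf (inv_ne_zero hf) P
  rw [mul_inv_cancel₀ hf, ord_one] at this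
  omega

/-- The map from the ground field to the local ring at a point. -/
def toStalk (x : C.Z) : κ →+* C.Z.presheaf.stalk x :=
  ((Scheme.ΓSpecIso (.of κ)).inv ≫ C.str.appTop ≫ C.Z.presheaf.germ ⊤ x trivial).hom

theorem algebraMap_toStalk (x : C.Z) (c : κ) :
    algebraMap (C.Z.presheaf.stalk x) C.RatFn (C.toStalk x c) = algebraMap κ C.RatFn c := by
  have : Nonempty (⊤ : C.Z.Opens) := ⟨⟨genericPoint C.Z, trivial⟩⟩
  exact Scheme.algebraMap_germ_eq_germToFunctionField (X := C.Z) (U := ⊤) (x := x) trivial _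

theorem fromSpecStalk_comp_str (x : C.Z) :
    C.Z.fromSpecStalk x ≫ C.str = Spec.map (CommRingCat.ofHom (C.toStalk x)) := by
  apply ext_of_isAffine
  rw [Scheme.Hom.comp_appTop, Scheme.fromSpecStalk_appTop]
  have h2 := Scheme.ΓSpecIso_inv_naturality (CommRingCat.ofHom (C.toStalk x))
  rw [← cancel_epi (Scheme.ΓSpecIso (.of κ)).inv, ← h2]
  simp [toStalk]

/-- The residue field at a closed point is `κ`, because `κ` is algebraically closed. -/
theorem exists_residue (P : C.Point) (a : C.Z.presheaf.stalk P.1) :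
    ∃ c : κ, a - C.toStalk P.1 c ∈ IsLocalRing.maximalIdeal (C.Z.presheaf.stalk P.1) := by
  let φ : CommRingCat.of κ ⟶ C.Z.residueField P.1 :=
    CommRingCat.ofHom (((C.Z.residue P.1).hom).comp (C.toStalk P.1))
  have hφ : φ = (residueFieldIsoBase C.str P.1 P.2).inv := by
    apply Spec.map_injective
    refine Eq.trans ?_ (SpecMap_residueFieldIsoBase_inv C.str P.1 P.2).symm
    rw [Scheme.fromSpecResidueField, Category.assoc, fromSpecStalk_comp_str, ← Spec.map_comp]
    rfl
  have hs : Function.Surjective φ.hom := by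
    rw [hφ]
    exact (ConcreteCategory.bijective_of_isIso (residueFieldIsoBase C.str P.1 P.2).inv).2
  obtain ⟨c, hc⟩ := hs (C.Z.residue P.1 a)
  refine ⟨c, ?_⟩
  rw [← IsLocalRing.residue_eq_zero_iff, map_sub, sub_eq_zero]
  exact hc.symm

theorem one_le_ord_of_mem {P : C.Point} {a : C.Z.presheaf.stalk P.1}
    (ha : a ∈ IsLocalRing.maximalIdeal (C.Z.presheaf.stalk P.1))
    (h0 : algebraMap _ C.RatFn a ≠ 0) : 1 ≤ C.ord (algebraMap _ C.RatFn a) P := by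
  have h1 := (C.zero_le_ord_iff h0 P).mpr ⟨a, rfl⟩
  by_contra hlt
  have h2 : 0 ≤ C.ord (algebraMap _ C.RatFn a)⁻¹ P := by
    rw [C.ord_inv h0]; omega
  obtain ⟨b, hb⟩ := (C.zero_le_ord_iff (inv_ne_zero h0) P).mp h2
  have h3 : a * b = 1 := by
    apply IsFractionRing.injective (C.Z.presheaf.stalk P.1) C.RatFn
    rw [map_mul, hb, map_one, mul_inv_cancel₀ h0]
  exact (IsLocalRing.mem_maximalIdeal a).mp ha (IsUnit.of_mul_eq_one b h3)

/-- The constant is the residue of `f / g` at `P`; subtracting this multiple of `g` cancels the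
leading term. -/
theorem exists_sub_smul {f g : C.RatFn} (hf : f ≠ 0) (hg : g ≠ 0) (P : C.Point)
    (h : C.ord g P ≤ C.ord f P) : ∃ c : κ, f - c • g = 0 ∨ C.ord g P < C.ord (f - c • g) P := by
  have h0 : f / g ≠ 0 := div_ne_zero hf hg
  have h1 : 0 ≤ C.ord (f / g) P := by
    rw [div_eq_mul_inv, C.ord_mul hf (inv_ne_zero hg), C.ord_inv hg]; omega
  obtain ⟨a, ha⟩ := (C.zero_le_ord_iff h0 P).mp h1
  obtain ⟨c, hc⟩ := C.exists_residue P a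
  refine ⟨c, ?_⟩
  by_cases hz : f - c • g = 0
  · exact Or.inl hz
  right
  have h2 : algebraMap _ C.RatFn (a - C.toStalk P.1 c) * g = f - c • g := by
    rw [map_sub, ha, algebraMap_toStalk, sub_mul, div_mul_cancel₀ _ hg, Algebra.smul_def]
  have h3 : algebraMap _ C.RatFn (a - C.toStalk P.1 c) ≠ 0 := by
    intro h; rw [h, zero_mul] at h2; exact hz h2.symm
  have h4 := C.one_le_ord_of_mem hc h3
  rw [← h2, C.ord_mul h3 hg]
  omega

theorem finite_ord_ne_zero {f : C.RatFn} (hf : f ≠ 0) : {P : C.Point | C.ord f P ≠ 0}.Finite := by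
  obtain ⟨U, -, f', hU, hff, hu⟩ := exists_isUnit_germ_eq (X := C.Z) f hf
  have hS : IsClosed (U : Set C.Z)ᶜ := U.isOpen.isClosed_compl
  have hfin : ((U : Set C.Z)ᶜ).Finite := by
    refine finite_of_forall_isClosed_singleton hS fun x hx => C.isClosed_singleton_of_ne x ?_
    rintro rfl
    exact hx (((genericPoint_spec C.Z).mem_open_set_iff U.isOpen).mpr (by simpa using hU))
  refine (hfin.preimage (f := Subtype.val) Subtype.val_injective.injOn).subset ?_
  intro P hP
  by_contra hPU
  apply hP
  rw [← hff]
  exact Scheme.ord_of_isUnit hu (by simpa using hPU)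

instance : JacobsonSpace C.Z := LocallyOfFiniteType.jacobsonSpace C.str

/-- With finitely many closed points the generic point would be open. In a Jacobson space a nonempty
open set contains a closed point, and the generic point is not closed. -/
instance : Infinite C.Point := by
  by_contra hfin
  rw [not_infinite_iff_finite] at hfin
  have h1 : (closedPoints C.Z).Finite := Set.toFinite _
  have h2 : IsOpen ({genericPoint C.Z} : Set C.Z) := by
    have : ({genericPoint C.Z} : Set C.Z) = (⋃ x ∈ closedPoints C.Z, {x})ᶜ := by
      ext y
      simp only [Set.mem_singleton_iff, Set.mem_compl_iff, Set.mem_iUnion, exists_prop,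
        exists_eq_right']
      constructor
      · rintro rfl h
        exact C.not_isClosed_genericPoint h
      · intro h
        by_contra hy
        exact h (C.isClosed_singleton_of_ne y hy)
    rw [this]
    exact (h1.isClosed_biUnion fun x hx => hx).isOpen_compl
  obtain ⟨y, hy, hyc⟩ := nonempty_inter_closedPoints (Set.singleton_nonempty _)
    h2.isLocallyClosed
  rw [Set.mem_singleton_iff.mp hy] at hyc
  exact C.not_isClosed_genericPoint hyc

/-- This is separatedness. Without such an `f`, the local ring at `P` lies in the local ring at `Q`
inside the function field. The spectrum of the latter then has two maps to the curve that agree at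
the generic point, and the valuative criterion makes them equal. So `Q` specializes to `P`, and both
are closed. -/
theorem exists_ord_lt_zero {P Q : C.Point} (hPQ : P ≠ Q) :
    ∃ f : C.RatFn, f ≠ 0 ∧ 0 ≤ C.ord f P ∧ C.ord f Q < 0 := by
  by_contra! hcon
  have hmem : ∀ a : (C.Z.presheaf.stalk P.1), algebraMap (C.Z.presheaf.stalk P.1) C.RatFn a ∈ (algebraMap (C.Z.presheaf.stalk Q.1) C.RatFn).range := by
    intro a
    by_cases h0 : algebraMap (C.Z.presheaf.stalk P.1) C.RatFn a = 0
    · rw [h0]; exact zero_mem _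
    · obtain ⟨b, hb⟩ := (C.zero_le_ord_iff h0 Q).mp
        (hcon _ h0 ((C.zero_le_ord_iff h0 P).mpr ⟨a, rfl⟩))
      exact ⟨b, hb⟩
  have hinj : Function.Injective (algebraMap (C.Z.presheaf.stalk Q.1) C.RatFn) := IsFractionRing.injective (C.Z.presheaf.stalk Q.1) C.RatFn
  let e : (C.Z.presheaf.stalk Q.1) ≃+* (algebraMap (C.Z.presheaf.stalk Q.1) C.RatFn).range :=
    RingEquiv.ofBijective _ ⟨fun x y hxy => hinj (congrArg Subtype.val hxy),
      (algebraMap (C.Z.presheaf.stalk Q.1) C.RatFn).rangeRestrict_surjective⟩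
  let φ : (C.Z.presheaf.stalk P.1) →+* (C.Z.presheaf.stalk Q.1) := e.symm.toRingHom.comp ((algebraMap (C.Z.presheaf.stalk P.1) C.RatFn).codRestrict _ hmem)
  have hφ : ∀ a, algebraMap (C.Z.presheaf.stalk Q.1) C.RatFn (φ a) = algebraMap (C.Z.presheaf.stalk P.1) C.RatFn a := by
    intro a
    have := e.apply_symm_apply ((algebraMap (C.Z.presheaf.stalk P.1) C.RatFn).codRestrict _ hmem a)
    exact congrArg Subtype.val this
  have hgen : ∀ x : C.Z, genericPoint C.Z ⤳ x := fun x => (genericPoint_spec C.Z).specializes trivial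
  have e1 : CommRingCat.ofHom φ ≫ CommRingCat.ofHom (algebraMap (C.Z.presheaf.stalk Q.1) C.RatFn) =
      CommRingCat.ofHom (algebraMap (C.Z.presheaf.stalk P.1) C.RatFn) := by
    ext a; exact hφ a
  have h1 : Spec.map (CommRingCat.ofHom (algebraMap (C.Z.presheaf.stalk Q.1) C.RatFn)) ≫ C.Z.fromSpecStalk Q.1 =
      C.Z.fromSpecStalk (genericPoint C.Z) :=
    Scheme.SpecMap_stalkSpecializes_fromSpecStalk (hgen Q.1)
  have h2 : Spec.map (CommRingCat.ofHom (algebraMap (C.Z.presheaf.stalk Q.1) C.RatFn)) ≫ Spec.map (CommRingCat.ofHom φ) ≫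
      C.Z.fromSpecStalk P.1 = C.Z.fromSpecStalk (genericPoint C.Z) := by
    rw [← Category.assoc, ← Spec.map_comp, e1]
    exact Scheme.SpecMap_stalkSpecializes_fromSpecStalk (hgen P.1)
  have h3 : (Spec.map (CommRingCat.ofHom φ) ≫ C.Z.fromSpecStalk P.1) ≫ C.str =
      C.Z.fromSpecStalk Q.1 ≫ C.str := by
    rw [Category.assoc, fromSpecStalk_comp_str, fromSpecStalk_comp_str, ← Spec.map_comp]
    congr 1
    ext c
    apply hinj
    change algebraMap (C.Z.presheaf.stalk Q.1) C.RatFn (φ (C.toStalk P.1 c)) = algebraMap (C.Z.presheaf.stalk Q.1) C.RatFn (C.toStalk Q.1 c)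
    rw [hφ, algebraMap_toStalk, algebraMap_toStalk]
  have hdom : IsDomain (C.Z.presheaf.stalk Q.1) := inferInstance
  have hval : ValuationRing (C.Z.presheaf.stalk Q.1) := inferInstance
  let S : ValuativeCommSq C.str :=
    @ValuativeCommSq.mk _ _ C.str (C.Z.presheaf.stalk Q.1) (C.Z.presheaf.stalk Q.1).commRing hdom
      hval C.RatFn inferInstance inferInstance inferInstance
      (C.Z.fromSpecStalk (genericPoint C.Z)) (C.Z.fromSpecStalk Q.1 ≫ C.str)
      ⟨by rw [← h1, Category.assoc]⟩
  have hsub := IsSeparated.valuativeCriterion C.str S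
  let l₁ : S.commSq.LiftStruct := ⟨C.Z.fromSpecStalk Q.1, h1, rfl⟩
  let l₂ : S.commSq.LiftStruct :=
    ⟨Spec.map (CommRingCat.ofHom φ) ≫ C.Z.fromSpecStalk P.1, h2, h3⟩
  have h4 : C.Z.fromSpecStalk Q.1 = Spec.map (CommRingCat.ofHom φ) ≫ C.Z.fromSpecStalk P.1 :=
    congrArg CommSq.LiftStruct.l (hsub.elim l₁ l₂)
  have h5 : Q.1 ⤳ P.1 := by
    have h6 : C.Z.fromSpecStalk Q.1 (IsLocalRing.closedPoint (C.Z.presheaf.stalk Q.1)) = Q.1 :=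
      Scheme.fromSpecStalk_closedPoint
    rw [h4] at h6
    have h7 : Q.1 ∈ Set.range (C.Z.fromSpecStalk P.1) := ⟨_, h6⟩
    rwa [Scheme.range_fromSpecStalk] at h7
  have h8 : P.1 ∈ closure {Q.1} := specializes_iff_mem_closure.mp h5
  rw [(show IsClosed {Q.1} from Q.2).closure_eq] at h8
  exact hPQ (Subtype.ext h8)

/-- Near each closed point `f` comes from a section of the structure sheaf, and every point
specializes to a closed one. The local sections have the same germ at the generic point, hence glue
to a global section, which is constant. -/
theorem exists_eq_algebraMap {f : C.RatFn} (hf : f ≠ 0) (h : ∀ P, 0 ≤ C.ord f P) :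
    ∃ c : κ, algebraMap κ C.RatFn c = f := by
  let ι := {V : C.Z.Opens // ∃ (hV : genericPoint C.Z ∈ V) (s : Γ(C.Z, V)),
    C.Z.presheaf.germ V (genericPoint C.Z) hV s = f}
  let U : ι → C.Z.Opens := fun i => i.1
  choose hgU s hs using fun i : ι => i.2
  have hcov : (⊤ : C.Z.Opens) ≤ iSup U := by
    intro x _
    obtain ⟨P, hP⟩ : ∃ P : C.Point, x ⤳ P.1 := by
      obtain ⟨y, hy, hyc⟩ := IsClosed.exists_closed_singleton (S := closure {x}) isClosed_closure
        ⟨x, subset_closure rfl⟩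
      exact ⟨⟨y, hyc⟩, specializes_iff_mem_closure.mpr hy⟩
    obtain ⟨a, ha⟩ := (C.zero_le_ord_iff hf P).mp (h P)
    obtain ⟨V, hV, t, ht⟩ := C.Z.presheaf.exists_germ_eq a
    have hgV : genericPoint C.Z ∈ V :=
      ((genericPoint_spec C.Z).specializes (y := P.1) trivial).mem_open V.isOpen hV
    have : Nonempty V := ⟨⟨_, hgV⟩⟩
    have hmem : ∃ (hV : genericPoint C.Z ∈ V) (s : Γ(C.Z, V)),
        C.Z.presheaf.germ V (genericPoint C.Z) hV s = f :=
      ⟨hgV, t, by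
        rw [← ha, ← ht]
        exact (Scheme.algebraMap_germ_eq_germToFunctionField (X := C.Z) hV t).symm⟩
    exact TopologicalSpace.Opens.mem_iSup.mpr ⟨⟨V, hmem⟩, hP.mem_open V.isOpen hV⟩
  have hcomp : TopCat.Presheaf.IsCompatible C.Z.presheaf U s := by
    intro i j
    have hg : genericPoint C.Z ∈ U i ⊓ U j := ⟨hgU i, hgU j⟩
    apply germ_injective_of_isIntegral (X := C.Z) (genericPoint C.Z) hg
    exact (C.Z.presheaf.germ_res_apply _ _ hg (s i)).trans (((hs i).trans (hs j).symm).trans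
      (C.Z.presheaf.germ_res_apply _ _ hg (s j)).symm)
  obtain ⟨g, hg, -⟩ := TopCat.Sheaf.existsUnique_gluing' C.Z.sheaf U ⊤ (fun i => homOfLE le_top)
    hcov s hcomp
  obtain ⟨c', hc'⟩ := C.appTop_surjective g
  obtain ⟨i⟩ : Nonempty ι := by
    obtain ⟨i, -⟩ := TopologicalSpace.Opens.mem_iSup.mp (hcov (x := genericPoint C.Z) trivial)
    exact ⟨i⟩
  refine ⟨(Scheme.ΓSpecIso (.of κ)).hom.hom c', ?_⟩
  rw [← hs i, ← hg i]
  change C.Z.presheaf.germ ⊤ (genericPoint C.Z) trivial (C.str.appTop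
    ((Scheme.ΓSpecIso (.of κ)).inv ((Scheme.ΓSpecIso (.of κ)).hom c'))) = _
  have h9 : (Scheme.ΓSpecIso (.of κ)).inv ((Scheme.ΓSpecIso (.of κ)).hom c') = c' := by
    rw [← ConcreteCategory.comp_apply, Iso.hom_inv_id]; rfl
  rw [h9]
  exact (congrArg _ hc').trans (C.Z.presheaf.germ_res_apply (homOfLE le_top) _ (hgU i) g).symm

end SmoothCurve

end

/-! ## Approximation -/

noncomputable section

namespace SmoothCurve

variable {κ : Type u} [Field κ] [IsAlgClosed κ] (C : SmoothCurve κ)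

/-- The functions that vanish to order at least `m` at `P`. -/
def ordGE (P : C.Point) (m : ℤ) : Submodule κ C.RatFn where
  carrier := {f | f = 0 ∨ m ≤ C.ord f P}
  zero_mem' := Or.inl rfl
  add_mem' := by
    intro a b ha hb
    by_cases ha0 : a = 0
    · simpa [ha0] using hb
    by_cases hb0 : b = 0
    · simpa [hb0] using ha
    by_cases hab : a + b = 0
    · exact Or.inl hab
    have h := C.min_ord_le a b hab P
    have h1 := ha.resolve_left ha0
    have h2 := hb.resolve_left hb0
    exact Or.inr (by omega)
  smul_mem' := by
    intro c f hf
    rw [Algebra.smul_def]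
    by_cases h : algebraMap κ C.RatFn c * f = 0
    · exact Or.inl h
    · refine Or.inr ?_
      rw [C.ord_algebraMap_mul c f h P]
      exact hf.resolve_left (right_ne_zero_of_mul h)

theorem mem_sections {D : C.Divisor} {f : C.RatFn} :
    f ∈ C.sections D ↔ f = 0 ∨ ∀ P, 0 ≤ C.ord f P + D P := Iff.rfl

/-- A term of strictly larger order cannot cancel the leading term. Membership in `ordGE` instead of
an inequality of orders admits `g = 0`, whose order is a default value. -/
theorem add_ne_zero_and_ord_eq {f g : C.RatFn} (hf : f ≠ 0) (P : C.Point)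
    (hg : g ∈ C.ordGE P (C.ord f P + 1)) : f + g ≠ 0 ∧ C.ord (f + g) P = C.ord f P := by
  have key : ∀ h : C.RatFn, h ∈ C.ordGE P (C.ord f P + 1) → f ∉ C.ordGE P (C.ord f P + 1) := by
    intro _ _ hh
    rcases hh with h | h
    · exact hf h
    · omega
  have hne : f + g ≠ 0 := by
    intro h
    apply key g hg
    have h2 := neg_mem hg
    rwa [← eq_neg_of_add_eq_zero_left h] at h2
  refine ⟨hne, le_antisymm ?_ ?_⟩
  · by_contra hlt
    push Not at hlt
    apply key g hg
    have : f = (f + g) - g := by ring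
    rw [this]
    refine sub_mem (Or.inr (by rw [← this]; omega)) (by rw [← this]; exact hg)
  · have : f + g ∈ C.ordGE P (C.ord f P) := by
      refine add_mem (Or.inr le_rfl) ?_
      rcases hg with h | h
      · exact Or.inl h
      · exact Or.inr (by omega)
    exact this.resolve_left hne

theorem ord_zpow {f : C.RatFn} (hf : f ≠ 0) (P : C.Point) (k : ℤ) :
    C.ord (f ^ k) P = k * C.ord f P := by
  have hn : ∀ n : ℕ, C.ord (f ^ n) P = n * C.ord f P := by
    intro n
    induction n with
    | zero => simp [C.ord_one]
    | succ n ih => rw [pow_succ, C.ord_mul (pow_ne_zero n hf) hf, ih]; push_cast; ring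
  obtain ⟨n, rfl | rfl⟩ := k.eq_nat_or_neg
  · rw [zpow_natCast, hn]
  · rw [zpow_neg, zpow_natCast, C.ord_inv (pow_ne_zero n hf), hn]; ring

theorem ord_pow {f : C.RatFn} (hf : f ≠ 0) (P : C.Point) (k : ℕ) :
    C.ord (f ^ k) P = k * C.ord f P := by
  rw [← zpow_natCast, C.ord_zpow hf]

theorem exists_pos_neg {P Q : C.Point} (h : P ≠ Q) :
    ∃ v : C.RatFn, v ≠ 0 ∧ 0 < C.ord v P ∧ C.ord v Q < 0 := by
  obtain ⟨f, hf, hf1, hf2⟩ := C.exists_ord_lt_zero h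
  obtain ⟨g, hg, hg1, hg2⟩ := C.exists_ord_lt_zero h.symm
  refine ⟨f * g⁻¹, mul_ne_zero hf (inv_ne_zero hg), ?_, ?_⟩ <;>
    rw [C.ord_mul hf (inv_ne_zero hg), C.ord_inv hg] <;> omega

/-- One point is added at a time: a high power of a function with a zero at `P` and a pole at the
new point is added to the function found before. -/
theorem exists_pos_forall_neg (P : C.Point) (S : Finset C.Point) (hS : P ∉ S) :
    ∃ u : C.RatFn, u ≠ 0 ∧ 0 < C.ord u P ∧ ∀ Q ∈ S, C.ord u Q < 0 := by
  classical
  induction S using Finset.induction_on with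
  | empty =>
    obtain ⟨t, ht, h1⟩ := C.exists_ord_eq_one P
    exact ⟨t, ht, by omega, by simp⟩
  | insert Q S hQ ih =>
    rw [Finset.mem_insert, not_or] at hS
    obtain ⟨u, hu, hu1, hu2⟩ := ih hS.2
    obtain ⟨v, hv, hv1, hv2⟩ := C.exists_pos_neg hS.1
    by_cases hQu : C.ord u Q < 0
    · exact ⟨u, hu, hu1, fun R hR => (Finset.mem_insert.mp hR).elim (fun h => h ▸ hQu) (hu2 R)⟩
    -- Since `r` exceeds all the numbers `|ord u R|` and `ord u R < 0`, the orders of `v ^ r` and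
    -- `u` at `R ∈ S` never coincide, so the sum has the smaller of the two.
    set r : ℕ := ∑ R ∈ S, (C.ord u R).natAbs + 1 with hr
    have hvr := pow_ne_zero r hv
    have ho := fun R => C.ord_pow hv R r
    have hrpos : (1 : ℤ) ≤ r := by omega
    obtain ⟨hz, hzQ⟩ := C.add_ne_zero_and_ord_eq (f := v ^ r) (g := u) hvr Q (Or.inr (by
      rw [ho]; nlinarith))
    refine ⟨v ^ r + u, hz, ?_, ?_⟩
    · have h1 : v ^ r + u ∈ C.ordGE P 1 :=
        add_mem (Or.inr (by rw [ho]; nlinarith)) (Or.inr (by omega))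
      have := h1.resolve_left hz
      omega
    · intro R hR
      rcases Finset.mem_insert.mp hR with rfl | hR
      · rw [hzQ, ho]; nlinarith
      · have h1 := hu2 R hR
        have h2 : (C.ord u R).natAbs < r := by
          rw [hr, Nat.lt_succ_iff]
          exact Finset.single_le_sum (f := fun R => (C.ord u R).natAbs) (by simp) hR
        have h3 : (r : ℤ) * C.ord v R ≠ C.ord u R := by
          intro h
          rcases lt_trichotomy (C.ord v R) 0 with h4 | h4 | h4
          · have : (r : ℤ) * C.ord v R ≤ - r := by nlinarith
            omega
          · rw [h4] at h; omega
          · have : (0 : ℤ) < (r : ℤ) * C.ord v R := by positivity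
            omega
        rcases lt_or_gt_of_ne h3 with h4 | h4
        · rw [(C.add_ne_zero_and_ord_eq (f := v ^ r) (g := u) hvr R (Or.inr (by rw [ho]; omega))).2,
            ho]
          omega
        · rw [add_comm,
            (C.add_ne_zero_and_ord_eq (f := u) (g := v ^ r) hu R (Or.inr (by rw [ho]; omega))).2]
          exact h1

/-- If `u` has a zero at `P` and poles at the other points, `(1 + u ^ k)⁻¹` is a unit at `P` and
vanishes to high order at the others; a power of a uniformizer then adjusts the order at `P`. -/
theorem exists_ord_eq_forall_le (P : C.Point) (S : Finset C.Point) (a N : ℤ) :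
    ∃ u : C.RatFn, u ≠ 0 ∧ C.ord u P = a ∧ ∀ Q ∈ S, Q ≠ P → N ≤ C.ord u Q := by
  classical
  obtain ⟨u, hu, hu1, hu2⟩ := C.exists_pos_forall_neg P (S.erase P) (by simp)
  obtain ⟨t, ht, ht1⟩ := C.exists_ord_eq_one P
  set k : ℕ := ∑ Q ∈ S, (N - a * C.ord t Q).natAbs + 1 with hk
  have huk := pow_ne_zero k hu
  have h1 : ∀ Q, C.ord u Q < 0 → u ^ k + 1 ≠ 0 ∧ C.ord (u ^ k + 1) Q = k * C.ord u Q := by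
    intro Q hQ
    rw [← C.ord_pow hu]
    refine C.add_ne_zero_and_ord_eq huk Q (Or.inr ?_)
    rw [C.ord_pow hu, C.ord_one]
    have : (1 : ℤ) ≤ k := by omega
    nlinarith
  have h2 : 1 + u ^ k ≠ 0 ∧ C.ord (1 + u ^ k) P = C.ord 1 P := by
    refine C.add_ne_zero_and_ord_eq one_ne_zero P (Or.inr ?_)
    rw [C.ord_pow hu, C.ord_one]
    have : (1 : ℤ) ≤ k := by omega
    nlinarith
  have h3 := inv_ne_zero h2.1
  have h4 := zpow_ne_zero a ht
  refine ⟨t ^ a * (1 + u ^ k)⁻¹, mul_ne_zero h4 h3, ?_, ?_⟩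
  · rw [C.ord_mul h4 h3, C.ord_zpow ht, C.ord_inv h2.1, h2.2, ht1, C.ord_one]; ring
  · intro Q hQ hne
    have h5 := hu2 Q (Finset.mem_erase.mpr ⟨hne, hQ⟩)
    have h6 := (h1 Q h5).2
    rw [add_comm] at h6
    rw [C.ord_mul h4 h3, C.ord_zpow ht, C.ord_inv h2.1, h6]
    have h7 : (N - a * C.ord t Q).natAbs < k := by
      rw [hk, Nat.lt_succ_iff]
      exact Finset.single_le_sum (f := fun Q => (N - a * C.ord t Q).natAbs) (by simp) hQ
    have h8 : (k : ℤ) ≤ - (k * C.ord u Q) := by nlinarith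
    omega

end SmoothCurve

end

/-! ## Spaces of sections and degrees -/

noncomputable section

namespace SmoothCurve

variable {κ : Type u} [Field κ] [IsAlgClosed κ] (C : SmoothCurve κ)

/-- Leading coefficients at `P` lie in `κ`, so raising the required order of vanishing by one costs
at most one dimension. -/
theorem le_sup_span_of_le_ordGE {M : Submodule κ C.RatFn} {P : C.Point} {m : ℤ}
    (hM : M ≤ C.ordGE P m) :
    ∃ g, M ≤ M ⊓ C.ordGE P (m + 1) ⊔ Submodule.span κ {g} := by
  by_cases hN : M ≤ C.ordGE P (m + 1)
  · exact ⟨0, le_sup_of_le_left (le_inf le_rfl hN)⟩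
  obtain ⟨g, hgM, hg⟩ := SetLike.not_le_iff_exists.mp hN
  refine ⟨g, fun f hf => ?_⟩
  have hg0 : g ≠ 0 := fun h => hg (Or.inl h)
  have hgm : C.ord g P = m := by
    have h1 := (hM hgM).resolve_left hg0
    have h2 : ¬ m + 1 ≤ C.ord g P := fun h => hg (Or.inr h)
    omega
  by_cases hf0 : f = 0
  · rw [hf0]; exact zero_mem _
  have h1 := (hM hf).resolve_left hf0
  obtain ⟨c, hc⟩ := C.exists_sub_smul hf0 hg0 P (by omega)
  have h2 : f = (f - c • g) + c • g := by ring
  rw [h2]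
  refine Submodule.add_mem_sup ⟨sub_mem hf (M.smul_mem c hgM), ?_⟩
    (Submodule.smul_mem _ c (Submodule.mem_span_singleton_self g))
  rcases hc with hc | hc
  · exact Or.inl hc
  · exact Or.inr (by omega)

theorem finite_and_finrank_le {M : Submodule κ C.RatFn} {P : C.Point} {m : ℤ}
    (hM : M ≤ C.ordGE P m) [Module.Finite κ ↥(M ⊓ C.ordGE P (m + 1))] :
    Module.Finite κ M ∧
      Module.finrank κ M ≤ Module.finrank κ ↥(M ⊓ C.ordGE P (m + 1)) + 1 := by
  obtain ⟨g, hg⟩ := C.le_sup_span_of_le_ordGE hM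
  have hfin : Module.Finite κ M := Submodule.finiteDimensional_of_le hg
  refine ⟨hfin, (Submodule.finrank_mono hg).trans
    ((Submodule.finrank_add_le_finrank_add_finrank _ _).trans ?_)⟩
  have := finrank_span_le_card (R := κ) ({g} : Set C.RatFn)
  simp only [Set.toFinset_singleton, Finset.card_singleton] at this
  omega

theorem sections_zero_le : C.sections 0 ≤ Submodule.span κ {1} := by
  intro f hf
  by_cases hf0 : f = 0
  · rw [hf0]; exact zero_mem _
  obtain ⟨c, rfl⟩ := C.exists_eq_algebraMap hf0 fun P => by simpa using hf.resolve_left hf0 P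
  rw [Algebra.algebraMap_eq_smul_one]
  exact Submodule.smul_mem _ c (Submodule.mem_span_singleton_self 1)

theorem Divisor.degree_add (D D' : C.Divisor) : (D + D').degree = D.degree + D'.degree :=
  Finsupp.sum_add_index' (by simp) (by simp)

theorem Divisor.degree_single (P : C.Point) (m : ℤ) :
    Divisor.degree (C := C) (Finsupp.single P m) = m := Finsupp.sum_single_index rfl

/-- The bound `-D P` is written as `m + 1` with `m = -(D P + 1)` to fit `finite_and_finrank_le`. -/
theorem sections_inf_ordGE (D : C.Divisor) (P : C.Point) :
    C.sections (D + Finsupp.single P 1) ⊓ C.ordGE P (- (D P + 1) + 1) =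
      C.sections D := by
  classical
  ext f
  constructor
  · rintro ⟨h1, h2⟩
    rcases h1 with h1 | h1
    · exact Or.inl h1
    rcases h2 with h2 | h2
    · exact Or.inl h2
    right
    intro Q
    have h3 := h1 Q
    by_cases hQ : P = Q
    · subst hQ
      omega
    · simpa [Finsupp.single_apply, hQ] using h3
  · intro h
    rcases h with h | h
    · rw [h]; exact zero_mem _
    refine ⟨Or.inr fun Q => ?_, Or.inr ?_⟩
    · have h3 := h Q
      simp only [Finsupp.add_apply, Finsupp.single_apply]
      split_ifs <;> omega
    · have h3 := h P
      omega

theorem finite_sections_add_single (D : C.Divisor) (P : C.Point)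
    [Module.Finite κ (C.sections D)] :
    Module.Finite κ (C.sections (D + Finsupp.single P 1)) ∧
      Module.finrank κ (C.sections (D + Finsupp.single P 1)) ≤
        Module.finrank κ (C.sections D) + 1 := by
  have h := C.sections_inf_ordGE D P
  have hM : C.sections (D + Finsupp.single P 1) ≤ C.ordGE P (- (D P + 1)) := by
    intro f hf
    rcases hf with hf | hf
    · exact Or.inl hf
    · exact Or.inr (by have := hf P; rw [Finsupp.add_apply, Finsupp.single_eq_same] at this; omega)
  have hfin : Module.Finite κ
      ↥(C.sections (D + Finsupp.single P 1) ⊓ C.ordGE P (- (D P + 1) + 1)) := by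
    rw [h]; infer_instance
  have h2 := C.finite_and_finrank_le hM
  rw [h] at h2
  exact h2

@[elab_as_elim]
theorem effective_induction {p : C.Divisor → Prop} (h0 : p 0)
    (hs : ∀ D P, 0 ≤ D → p D → p (D + Finsupp.single P 1)) (D : C.Divisor) (hD : 0 ≤ D) : p D := by
  classical
  induction D using Finsupp.induction with
  | zero => exact h0
  | single_add P m D hPD hm ih =>
    have hD0 : 0 ≤ D := by
      intro Q
      have := hD Q
      by_cases hQ : P = Q
      · subst hQ; simp [Finsupp.notMem_support_iff.mp hPD]
      · simpa [Finsupp.single_apply, hQ] using this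
    have hm0 : 0 ≤ m := by
      have := hD P
      simpa [Finsupp.notMem_support_iff.mp hPD] using this
    obtain ⟨n, rfl⟩ : ∃ n : ℕ, m = Int.ofNat n := Int.eq_ofNat_of_zero_le hm0
    clear hD hm hm0
    rw [add_comm]
    induction n with
    | zero =>
      have h0 : D + Finsupp.single P (Int.ofNat 0) = D := by simp
      rw [h0]
      exact ih hD0
    | succ n ihn =>
      have h2 : D + Finsupp.single P (Int.ofNat n) + Finsupp.single P 1 =
          D + Finsupp.single P (Int.ofNat (n + 1)) := by
        rw [add_assoc, ← Finsupp.single_add]; rfl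
      rw [← h2]
      exact hs _ P (add_nonneg hD0 (Finsupp.single_nonneg.mpr (Int.natCast_nonneg n))) ihn

theorem finite_sections_of_nonneg (D : C.Divisor) (hD : 0 ≤ D) :
    Module.Finite κ (C.sections D) ∧ (Module.finrank κ (C.sections D) : ℤ) ≤ D.degree + 1 := by
  refine C.effective_induction ?_ ?_ D hD
  · have hfin : Module.Finite κ (C.sections 0) :=
      Submodule.finiteDimensional_of_le C.sections_zero_le
    refine ⟨hfin, ?_⟩
    have h1 := Submodule.finrank_mono C.sections_zero_le
    have h2 := finrank_span_le_card (R := κ) ({1} : Set C.RatFn)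
    simp only [Set.toFinset_singleton, Finset.card_singleton] at h2
    simp only [Divisor.degree, Finsupp.sum_zero_index]
    exact_mod_cast h1.trans h2
  · rintro D P - ⟨ih1, ih2⟩
    have h1 := C.finite_sections_add_single D P
    refine ⟨h1.1, ?_⟩
    rw [Divisor.degree_add, Divisor.degree_single]
    have := h1.2
    omega

/-! ### Principal divisors have degree zero -/

/-- The divisor of a rational function. -/
def divOf (f : C.RatFn) : C.Divisor :=
  Finsupp.ofSupportFinite (C.ord f) (by
    by_cases hf : f = 0
    · have : C.ord f = 0 := by
        ext P; simp [hf, ord]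
      simp [this]
    · exact C.finite_ord_ne_zero hf)

@[simp] theorem divOf_apply (f : C.RatFn) (P : C.Point) : C.divOf f P = C.ord f P := rfl

/-- The divisor of poles of a rational function. -/
def poles (f : C.RatFn) : C.Divisor := (C.divOf f).mapRange (fun m => max 0 (-m)) (by simp)

@[simp] theorem poles_apply (f : C.RatFn) (P : C.Point) : C.poles f P = max 0 (- C.ord f P) := rfl

theorem poles_nonneg (f : C.RatFn) : 0 ≤ C.poles f := fun P => by simp

/-- The poles of `x⁻¹` are the zeros of `x`. For each zero `P` and each `a < ord_P x` take a
function `u` of order `a` at `P`. The products `x ^ j * u` with `j < k` are linearly independent and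
lie in the sections of `k` times the polar divisor plus a divisor `C0` independent of `k`. Comparing
dimensions for large `k` gives the inequality. -/
theorem degree_poles_inv_le {x : C.RatFn} (hx : x ≠ 0) :
    (C.poles x⁻¹).degree ≤ (C.poles x).degree := by
  classical
  set Z := (C.poles x⁻¹).support with hZ
  have hZpos : ∀ P ∈ Z, 0 < C.ord x P := by
    intro P hP
    rw [hZ, Finsupp.mem_support_iff, poles_apply, C.ord_inv hx] at hP
    omega
  let ι := Σ P : Z, Fin (C.ord x P.1).toNat
  -- The bound at the other zeros is the degree of the zero divisor. It exceeds every `a` that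
  -- occurs, so there the function never competes with the ones attached to that zero.
  choose u hu0 hu1 hu2 using fun i : ι =>
    C.exists_ord_eq_forall_le i.1.1 Z (i.2 : ℕ) 
      (∑ Q ∈ Z, C.ord x Q)
  have hcard : (Fintype.card ι : ℤ) = (C.poles x⁻¹).degree := by
    rw [Fintype.card_sigma, Divisor.degree, Finsupp.sum]
    simp only [Fintype.card_fin]
    rw [← Finset.sum_coe_sort Z]
    push_cast
    refine Finset.sum_congr rfl fun P _ => ?_
    rw [poles_apply, C.ord_inv hx]
    simp [max_comm]
  set C0 : C.Divisor := ∑ i : ι, C.poles (u i) with hC0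
  have hC0nn : 0 ≤ C0 := Finset.sum_nonneg fun i _ => C.poles_nonneg _
  have hmain : ∀ k : ℕ, (k : ℤ) * (C.poles x⁻¹).degree ≤
      k * (C.poles x).degree + C0.degree + 1 := by
    intro k
    have hDnn : 0 ≤ k • C.poles x + C0 := add_nonneg (nsmul_nonneg (C.poles_nonneg x) k) hC0nn
    obtain ⟨hfin, hle⟩ := C.finite_sections_of_nonneg (k • C.poles x + C0) hDnn
    have hdeg : (k • C.poles x + C0).degree = k * (C.poles x).degree + C0.degree := by
      rw [Divisor.degree_add]
      congr 1
      rw [Divisor.degree, Finsupp.sum_smul_index' (by simp), Divisor.degree, Finsupp.sum,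
        Finsupp.sum, Finset.mul_sum]
      simp
    let b : Fin k × ι → C.RatFn := fun i => x ^ (i.1 : ℕ) * u i.2
    have hb0 : ∀ i, b i ≠ 0 := fun i => mul_ne_zero (pow_ne_zero _ hx) (hu0 _)
    have hbo : ∀ i P, C.ord (b i) P = (i.1 : ℕ) * C.ord x P + C.ord (u i.2) P := by
      intro i P
      rw [C.ord_mul (pow_ne_zero _ hx) (hu0 _), C.ord_pow hx]
    have hbmem : ∀ i, b i ∈ C.sections (k • C.poles x + C0) := by
      intro i
      refine Or.inr fun P => ?_
      rw [hbo]
      have h1 : C.poles (u i.2) P ≤ C0 P := by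
        have := Finset.single_le_sum (f := fun i => C.poles (u i))
          (fun i _ => C.poles_nonneg _) (Finset.mem_univ i.2)
        exact this P
      simp only [Finsupp.add_apply, Finsupp.smul_apply, poles_apply, nsmul_eq_mul] at h1 ⊢
      have h2 : (i.1 : ℤ) ≤ k := by exact_mod_cast i.1.2.le
      have h3 : (0 : ℤ) ≤ (i.1 : ℕ) := by positivity
      have h4 : 0 ≤ (i.1 : ℕ) * C.ord x P + k * max 0 (-C.ord x P) := by
        rcases le_total 0 (C.ord x P) with h | h
        · positivity
        · rw [max_eq_right (by omega)]; nlinarith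
      omega
    -- In a relation, take the least exponent `j` of `x` that occurs, a zero `P` that occurs with
    -- it, and then the least `a`. At `P` this term has order `j * ord_P x + a` with `a < ord_P x`,
    -- strictly below the orders of all other terms.
    have hli : LinearIndependent κ b := by
      have hsum : ∀ P ∈ Z, C.ord x P ≤ ∑ Q ∈ Z, C.ord x Q := fun P hP =>
        Finset.single_le_sum (fun Q hQ => (hZpos Q hQ).le) hP
      have hu0' : ∀ (i : ι) (P) (_ : P ∈ Z), 0 ≤ C.ord (u i) P := by
        intro i P hP
        by_cases h : P = i.1.1
        · rw [h, hu1]; positivity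
        · exact ((hZpos P hP).le.trans (hsum P hP)).trans (hu2 i P hP h)
      rw [Fintype.linearIndependent_iff]
      intro g hg
      by_contra! hex
      obtain ⟨i', hi'⟩ := hex
      obtain ⟨i0, hi0, hmin0⟩ := Finset.exists_min_image
        (Finset.univ.filter fun i => g i ≠ 0) (fun i => i.1) ⟨i', by simpa using hi'⟩
      obtain ⟨⟨j, P, a⟩, hi1, hmin1⟩ := Finset.exists_min_image
        (Finset.univ.filter fun i : Fin k × ι => g i ≠ 0 ∧ i.1 = i0.1 ∧ i.2.1 = i0.2.1)
        (fun i => (i.2.2 : ℕ)) ⟨i0, by simpa using hi0⟩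
      simp only [Finset.mem_filter, Finset.mem_univ, true_and] at hi0 hmin0 hi1 hmin1
      obtain ⟨hgi, hj, hP⟩ := hi1
      subst hj
      have hae : ((a : ℕ) : ℤ) < C.ord x P.1 := by
        have := a.2
        omega
      have hordb : C.ord (b ⟨i0.1, P, a⟩) P.1 = (i0.1 : ℕ) * C.ord x P.1 + (a : ℕ) := by
        rw [hbo, hu1]
      have hsm : ∀ {i}, g i ≠ 0 → g i • b i ≠ 0 := fun h => smul_ne_zero h (hb0 _)
      have hordg : C.ord (g ⟨i0.1, P, a⟩ • b ⟨i0.1, P, a⟩) P.1 =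
          (i0.1 : ℕ) * C.ord x P.1 + (a : ℕ) := by
        rw [← hordb, Algebra.smul_def]
        refine C.ord_algebraMap_mul _ _ ?_ _
        rw [← Algebra.smul_def]
        exact hsm hgi
      have hrest : ∑ i ∈ Finset.univ.erase (⟨i0.1, P, a⟩ : Fin k × ι), g i • b i ∈
          C.ordGE P.1 (C.ord (g ⟨i0.1, P, a⟩ • b ⟨i0.1, P, a⟩) P.1 + 1) := by
        refine Submodule.sum_mem _ fun i hi => ?_
        by_cases hgi' : g i = 0
        · rw [hgi', zero_smul]; exact zero_mem _
        refine Submodule.smul_mem _ _ (Or.inr ?_)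
        rw [hordg, hbo]
        have hj0 : (i0.1 : ℕ) ≤ (i.1 : ℕ) := hmin0 i hgi'
        rcases hj0.lt_or_eq with hlt | heq
        · have h1 := hu0' i.2 P.1 P.2
          have h2 : ((i0.1 : ℕ) : ℤ) + 1 ≤ (i.1 : ℕ) := by exact_mod_cast hlt
          nlinarith
        · rw [← heq]
          by_cases hPi : P = i.2.1
          · have h1 := hmin1 i ⟨hgi', Fin.ext heq.symm, by rw [← hPi, hP]⟩
            have h2 : (a : ℕ) ≠ (i.2.2 : ℕ) := by
              intro h
              apply Finset.ne_of_mem_erase hi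
              obtain ⟨i1, P', a'⟩ := i
              dsimp only at hPi heq h
              subst hPi
              have e1 : i0.1 = i1 := Fin.ext heq
              have e2 : a = a' := Fin.ext h
              rw [e1, e2]
            have h3 : C.ord (u i.2) P.1 = (i.2.2 : ℕ) := by rw [hPi, hu1]
            omega
          · have h1 := hu2 i.2 P.1 P.2 (fun h => hPi (Subtype.ext h))
            have h2 := hsum P.1 P.2
            omega
      have h := (C.add_ne_zero_and_ord_eq (hsm hgi) P.1 hrest).1
      apply h
      rw [← hg]
      exact Finset.add_sum_erase Finset.univ (fun i => g i • b i) (Finset.mem_univ _)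
    have hli' : LinearIndependent κ (fun i => (⟨b i, hbmem i⟩ : C.sections (k • C.poles x + C0))) :=
      LinearIndependent.of_comp (C.sections (k • C.poles x + C0)).subtype hli
    have h5 := hli'.fintype_card_le_finrank
    rw [Fintype.card_prod, Fintype.card_fin] at h5
    rw [← hcard]
    have h6 : ((k * Fintype.card ι : ℕ) : ℤ) ≤ (k • C.poles x + C0).degree + 1 :=
      le_trans (by exact_mod_cast h5) hle
    rw [hdeg] at h6
    push_cast at h6
    exact h6
  by_contra hlt
  push Not at hlt
  -- If the degrees differed by at least one, the bound would say `k ≤ deg C0 + 1`; this `k` is the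
  -- first to violate it.
  have h1 := hmain ((C0.degree + 2).toNat)
  have h2 : 0 ≤ C0.degree := Finset.sum_nonneg fun P _ => hC0nn P
  rw [Int.toNat_of_nonneg (by omega)] at h1
  nlinarith

theorem degree_divOf {f : C.RatFn} (hf : f ≠ 0) : (C.divOf f).degree = 0 := by
  have key : C.divOf f + C.poles f = C.poles f⁻¹ := by
    ext P
    simp only [Finsupp.add_apply, divOf_apply, poles_apply, C.ord_inv hf]
    omega
  have h1 := congrArg Divisor.degree key
  rw [Divisor.degree_add] at h1
  have h2 := C.degree_poles_inv_le hf
  have h3 := C.degree_poles_inv_le (inv_ne_zero hf)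
  rw [inv_inv] at h3
  omega

end SmoothCurve

end

/-! ## Vanishing subspaces -/

noncomputable section

namespace SmoothCurve

variable {κ : Type u} [Field κ] [IsAlgClosed κ] {C : SmoothCurve κ}

theorem Divisor.degree_nonneg {D : C.Divisor} (hD : 0 ≤ D) : 0 ≤ D.degree :=
  Finset.sum_nonneg fun P _ => hD P

theorem Divisor.degree_neg (D : C.Divisor) : (-D).degree = - D.degree := by
  have h := Divisor.degree_add C D (-D)
  rw [add_neg_cancel] at h
  simp only [Divisor.degree, Finsupp.sum_zero_index] at *
  omega

theorem Divisor.degree_sub (D D' : C.Divisor) : (D - D').degree = D.degree - D'.degree := by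
  rw [sub_eq_add_neg, Divisor.degree_add, Divisor.degree_neg]; ring

theorem Divisor.degree_mono {D D' : C.Divisor} (h : D ≤ D') : D.degree ≤ D'.degree := by
  have := Divisor.degree_nonneg (sub_nonneg.mpr h)
  rw [Divisor.degree_sub] at this
  omega

theorem Divisor.degree_lt {D D' : C.Divisor} (h : D < D') : D.degree < D'.degree := by
  obtain ⟨hle, P, hP⟩ := Finsupp.lt_def.mp h
  have h1 : D + Finsupp.single P 1 ≤ D' := by
    classical
    intro Q
    rw [Finsupp.add_apply, Finsupp.single_apply]
    split_ifs with hQ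
    · subst hQ; omega
    · simpa using hle Q
  have := Divisor.degree_mono h1
  rw [Divisor.degree_add, Divisor.degree_single] at this
  omega

theorem sections_mono {A B : C.Divisor} (h : A ≤ B) : C.sections A ≤ C.sections B := by
  rintro f (hf | hf)
  · exact Or.inl hf
  · exact Or.inr fun P => (hf P).trans (by have := h P; omega)

theorem vanishing_anti (W : Submodule κ C.RatFn) (A : C.Divisor) {B B' : C.Divisor} (h : B ≤ B') :
    vanishing W A B' ≤ vanishing W A B :=
  inf_le_inf_left _ (sections_mono (sub_le_sub_left h A))

theorem vanishing_eq_of_nonpos {W : Submodule κ C.RatFn} {A B : C.Divisor}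
    (hW : W ≤ C.sections A) (hB : B ≤ 0) : vanishing W A B = W :=
  inf_eq_left.mpr (hW.trans (sections_mono (le_sub_self_iff A |>.mpr hB)))

theorem mem_vanishing {W : Submodule κ C.RatFn} {A B : C.Divisor} {f : C.RatFn} (hf : f ≠ 0) :
    f ∈ vanishing W A B ↔ f ∈ W ∧ ∀ P, B P ≤ C.ord f P + A P := by
  unfold vanishing
  rw [Submodule.mem_inf, mem_sections, or_iff_right hf]
  refine and_congr_right fun _ => forall_congr' fun P => ?_
  rw [Finsupp.sub_apply]
  omega

theorem finrank_vanishing_le (W : Submodule κ C.RatFn) [Module.Finite κ W] (A B E : C.Divisor)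
    (hE : 0 ≤ E) : (Module.finrank κ (vanishing W A B) : ℤ) ≤
      Module.finrank κ (vanishing W A (B + E)) + E.degree := by
  have hfin : ∀ N : Submodule κ C.RatFn, Module.Finite κ ↥(W ⊓ N) := fun N =>
    Submodule.finiteDimensional_of_le inf_le_left
  refine C.effective_induction (D := E) ?_ ?_ hE
  · rw [add_zero]; simp [Divisor.degree]
  · rintro D P - ih
    obtain ⟨A', hA'⟩ : ∃ A' : C.Divisor, A' = A - (B + (D + Finsupp.single P 1)) := ⟨_, rfl⟩
    have h := C.sections_inf_ordGE A' P
    have h1 : A' + Finsupp.single P 1 = A - (B + D) := by rw [hA']; abel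
    rw [h1] at h
    set m := -(A' P + 1) with hm
    have hM : vanishing W A (B + D) ≤ C.ordGE P m := by
      rintro f ⟨-, hf⟩
      rcases hf with hf | hf
      · exact Or.inl hf
      · refine Or.inr ?_
        have := hf P
        rw [← h1, Finsupp.add_apply, Finsupp.single_eq_same] at this
        omega
    have h2 : vanishing W A (B + D) ⊓ C.ordGE P (m + 1) =
        vanishing W A (B + (D + Finsupp.single P 1)) := by
      unfold vanishing
      rw [inf_assoc, h, hA']
    have hfin2 : Module.Finite κ ↥(vanishing W A (B + D) ⊓ C.ordGE P (m + 1)) := by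
      rw [h2]; exact hfin _
    have h3 := (C.finite_and_finrank_le hM).2
    rw [h2] at h3
    rw [Divisor.degree_add, Divisor.degree_single]
    omega

/-- A point outside `B` at which some function of `H` is a unit cuts the dimension by at least one,
so at most `dim H` points are needed to kill `H`. The set `B` will contain the marked points and the
support of a divisor, where a zero of the function could be hidden by other contributions. -/
theorem exists_divisor_forall_lt (H : Submodule κ C.RatFn) [Module.Finite κ H]
    (B : Set C.Point) (hB : B.Finite) :
    ∃ E : C.Divisor, 0 ≤ E ∧ E.degree ≤ Module.finrank κ H ∧
      ∀ h ∈ H, h ≠ 0 → ∃ P ∉ B, C.ord h P < E P := by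
  classical
  induction hn : Module.finrank κ H using Nat.strong_induction_on generalizing H B with
  | _ n ih =>
    by_cases hH : H = ⊥
    · refine ⟨0, le_rfl, by simp [Divisor.degree], fun h hh h0 => ?_⟩
      rw [hH] at hh
      exact absurd ((Submodule.mem_bot κ).mp hh) h0
    obtain ⟨h0, hh0, hne⟩ := Submodule.exists_mem_ne_zero_of_ne_bot hH
    obtain ⟨P, hP⟩ := (hB.union (C.finite_ord_ne_zero hne)).exists_notMem
    rw [Set.mem_union, not_or] at hP
    have hP2 : C.ord h0 P = 0 := by simpa using hP.2
    have hlt : Module.finrank κ ↥(H ⊓ C.ordGE P 1) < Module.finrank κ H := by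
      refine Submodule.finrank_lt_finrank_of_lt (lt_of_le_of_ne inf_le_left fun h => ?_)
      have : h0 ∈ H ⊓ C.ordGE P 1 := by rw [h]; exact hh0
      rcases this.2 with h | h
      · exact hne h
      · omega
    have hfin : Module.Finite κ ↥(H ⊓ C.ordGE P 1) :=
      Submodule.finiteDimensional_of_le inf_le_left
    -- `P` joins the forbidden set so that the point obtained for the smaller space differs from `P`
    -- and keeps its coefficient when `P` is added to `E`.
    obtain ⟨E, hE0, hEd, hE⟩ := ih _ (hn ▸ hlt) (H ⊓ C.ordGE P 1) (insert P B) (hB.insert P) rfl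
    refine ⟨E + Finsupp.single P 1, add_nonneg hE0 (Finsupp.single_nonneg.mpr zero_le_one), ?_, ?_⟩
    · rw [Divisor.degree_add, Divisor.degree_single]
      omega
    · intro h hh hne'
      by_cases hhP : h ∈ C.ordGE P 1
      · obtain ⟨Q, hQ, hQ2⟩ := hE h ⟨hh, hhP⟩ hne'
        rw [Set.mem_insert_iff, not_or] at hQ
        refine ⟨Q, hQ.2, ?_⟩
        rw [Finsupp.add_apply, Finsupp.single_apply, if_neg (Ne.symm hQ.1)]
        omega
      · refine ⟨P, hP.1, ?_⟩
        have h1 : ¬ 1 ≤ C.ord h P := fun h1 => hhP (Or.inr h1)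
        have h2 := hE0 P
        rw [Finsupp.add_apply, Finsupp.single_eq_same]
        simp only [Finsupp.coe_zero, Pi.zero_apply] at h2
        omega

end SmoothCurve

/-- Codimensions are subadditive under intersection, since the sum of two subspaces of `W` is still
contained in `W`. -/
theorem finrank_le_finrank_inf_iInf {K M ι : Type*} [Field K] [AddCommGroup M] [Module K M]
    (W : Submodule K M) [Module.Finite K W] (N : ι → Submodule K M) (c : ι → ℕ)
    (s : Finset ι)
    (hc : ∀ i ∈ s, Module.finrank K W ≤ Module.finrank K ↥(W ⊓ N i) + c i) :
    Module.finrank K W ≤ Module.finrank K ↥(W ⊓ ⨅ i ∈ s, N i) + ∑ i ∈ s, c i := by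
  classical
  induction s using Finset.induction_on with
  | empty =>
    have : W ⊓ ⨅ i ∈ (∅ : Finset ι), N i = W := by simp
    rw [this]; simp
  | insert i s hi ih =>
    have ih := ih fun j hj => hc j (Finset.mem_insert_of_mem hj)
    have h1 := hc i (Finset.mem_insert_self i s)
    rw [Finset.iInf_insert, Finset.sum_insert hi]
    have hfin : ∀ N : Submodule K M, Module.Finite K ↥(W ⊓ N) := fun N =>
      Submodule.finiteDimensional_of_le inf_le_left
    have := hfin (N i)
    have := hfin (⨅ i ∈ s, N i)
    have h2 := Submodule.finrank_sup_add_finrank_inf_eq (W ⊓ N i) (W ⊓ ⨅ i ∈ s, N i)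
    have h3 : W ⊓ N i ⊓ (W ⊓ ⨅ i ∈ s, N i) = W ⊓ (N i ⊓ ⨅ i ∈ s, N i) :=
      (inf_inf_distrib_left W _ _).symm
    rw [h3] at h2
    have h4 : Module.finrank K ↥(W ⊓ N i ⊔ W ⊓ ⨅ i ∈ s, N i) ≤ Module.finrank K W :=
      Submodule.finrank_mono (sup_le inf_le_left inf_le_left)
    omega

end

/-! ## Codimensions and multivanishing sequences -/

noncomputable section

namespace SmoothCurve

variable {κ : Type u} [Field κ] [IsAlgClosed κ] {C : SmoothCurve κ}

/-- The codimension of the space of sections in `W` that vanish along `B`. -/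
def codimVanishing (W : Submodule κ C.RatFn) (A B : C.Divisor) : ℕ :=
  Module.finrank κ W - Module.finrank κ (vanishing W A B)

section Codim

variable {W : Submodule κ C.RatFn} [Module.Finite κ W] {A : C.Divisor}

theorem finite_vanishing (W : Submodule κ C.RatFn) [Module.Finite κ W] (A B : C.Divisor) :
    Module.Finite κ (vanishing W A B) :=
  Submodule.finiteDimensional_of_le inf_le_left

theorem finrank_vanishing_le_finrank (W : Submodule κ C.RatFn) [Module.Finite κ W]
    (A B : C.Divisor) : Module.finrank κ (vanishing W A B) ≤ Module.finrank κ W :=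
  Submodule.finrank_mono inf_le_left

theorem finrank_vanishing_add_codim (B : C.Divisor) :
    Module.finrank κ (vanishing W A B) + codimVanishing W A B = Module.finrank κ W :=
  Nat.add_sub_of_le (finrank_vanishing_le_finrank W A B)

theorem codimVanishing_mono {B B' : C.Divisor} (h : B ≤ B') :
    codimVanishing W A B ≤ codimVanishing W A B' := by
  have := finite_vanishing W A B
  have := Submodule.finrank_mono (vanishing_anti W A h)
  unfold codimVanishing
  omega

theorem codimVanishing_le_add_degree {B B' : C.Divisor} (h : B ≤ B') :
    (codimVanishing W A B' : ℤ) ≤ codimVanishing W A B + (B' - B).degree := by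
  have h1 := finrank_vanishing_le W A B (B' - B) (sub_nonneg.mpr h)
  rw [add_sub_cancel] at h1
  have h2 := finrank_vanishing_add_codim (W := W) (A := A) B
  have h3 := finrank_vanishing_add_codim (W := W) (A := A) B'
  omega

theorem codimVanishing_of_nonpos (hW : W ≤ C.sections A) {B : C.Divisor} (hB : B ≤ 0) :
    codimVanishing W A B = 0 := by
  unfold codimVanishing
  rw [vanishing_eq_of_nonpos hW hB, Nat.sub_self]

theorem finrank_quotient_vanishing {B B' : C.Divisor} (h : B ≤ B') :
    Module.finrank κ (↥(vanishing W A B) ⧸ (vanishing W A B').submoduleOf (vanishing W A B)) =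
      codimVanishing W A B' - codimVanishing W A B := by
  have := finite_vanishing W A B
  have h1 := Submodule.finrank_quotient_add_finrank
    ((vanishing W A B').submoduleOf (vanishing W A B))
  rw [(Submodule.submoduleOfEquivOfLe (vanishing_anti W A h)).finrank_eq] at h1
  have h2 := finrank_vanishing_add_codim (W := W) (A := A) B
  have h3 := finrank_vanishing_add_codim (W := W) (A := A) B'
  omega

end Codim

theorem degree_lt_of_isCritical {D : ℕ → C.Divisor} (hD : Monotone D) {i j : ℕ} (hij : i < j)
    (hi : IsCritical D i) : (D i).degree < (D j).degree :=
  (Divisor.degree_lt (lt_of_le_of_ne (hD (Nat.le_succ i)) (Ne.symm hi))).trans_le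
    (Divisor.degree_mono (hD hij))

theorem degree_lt_iff_of_isCritical {D : ℕ → C.Divisor} (hD : Monotone D) {i j : ℕ}
    (hi : IsCritical D i) : (D i).degree < (D j).degree ↔ i < j :=
  ⟨fun h => lt_of_not_ge fun hji => absurd h (Divisor.degree_mono (hD hji)).not_gt,
    fun h => degree_lt_of_isCritical hD h hi⟩

theorem degree_eq_iff_of_isCritical {D : ℕ → C.Divisor} (hD : Monotone D) {i j : ℕ}
    (hi : IsCritical D i) (hj : IsCritical D j) : (D i).degree = (D j).degree ↔ i = j := by
  refine ⟨fun h => ?_, fun h => h ▸ rfl⟩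
  rcases lt_trichotomy i j with hij | hij | hij
  · exact absurd h (degree_lt_of_isCritical hD hij hi).ne
  · exact hij
  · exact absurd h (degree_lt_of_isCritical hD hij hj).ne'

variable {r : ℕ} {W : Submodule κ C.RatFn} [Module.Finite κ W] {A : C.Divisor}

/-- The multiplicities of the critical values below `deg D_j` telescope to a codimension; a step
that is not critical changes neither side. -/
theorem IsMultivanishing.ncard_lt {D : ℕ → C.Divisor} (hD : Monotone D) (hD0 : D 0 = 0)
    (hW : W ≤ C.sections A) {a : Fin (r + 1) → ℤ} (ha : IsMultivanishing W A D a) (j : ℕ) :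
    {l | a l < (D j).degree}.ncard = codimVanishing W A (D j) := by
  induction j with
  | zero =>
    rw [codimVanishing_of_nonpos hW hD0.le, Set.ncard_eq_zero, Set.eq_empty_iff_forall_notMem]
    intro l hl
    obtain ⟨i, hi, hil⟩ := ha.2.2 l
    rw [Set.mem_ofPred_eq, hil] at hl
    exact absurd ((degree_lt_iff_of_isCritical hD hi).mp hl) (Nat.not_lt_zero i)
  | succ j ih =>
    by_cases hj : IsCritical D j
    · have h1 : {l | a l < (D (j + 1)).degree} =
          {l | a l < (D j).degree} ∪ {l | a l = (D j).degree} := by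
        ext l
        obtain ⟨i, hi, hil⟩ := ha.2.2 l
        simp only [Set.mem_union, Set.mem_ofPred_eq, hil]
        rw [degree_lt_iff_of_isCritical hD hi, degree_lt_iff_of_isCritical hD hi,
          degree_eq_iff_of_isCritical hD hi hj, Nat.lt_succ_iff_lt_or_eq]
      rw [h1, Set.ncard_union_eq, ih, ha.2.1 j hj,
        finrank_quotient_vanishing (hD (Nat.le_add_right j 1))]
      · have := codimVanishing_mono (W := W) (A := A) (hD (Nat.le_add_right j 1))
        omega
      · rw [Set.disjoint_left]
        intro l hl hl'
        exact absurd hl' (ne_of_lt hl)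
    · rw [not_not.mp hj, ih]

/-- By monotonicity of `a` the set counted in `ncard_lt` is an initial segment, so its size decides
membership. This is the dictionary between sequences and codimensions. -/
theorem IsMultivanishing.lt_degree_iff {D : ℕ → C.Divisor} (hD : Monotone D) (hD0 : D 0 = 0)
    (hW : W ≤ C.sections A) {a : Fin (r + 1) → ℤ} (ha : IsMultivanishing W A D a) (j : ℕ)
    (l : Fin (r + 1)) : a l < (D j).degree ↔ (l : ℕ) < codimVanishing W A (D j) := by
  rw [← ha.ncard_lt hD hD0 hW j]
  constructor
  · intro h
    have h1 : ((Finset.Iic l : Finset (Fin (r + 1))) : Set (Fin (r + 1))) ⊆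
        {l | a l < (D j).degree} := by
      intro l' hl'
      exact (ha.1 (by simpa using hl')).trans_lt h
    have h2 := Set.ncard_le_ncard h1 (Set.toFinite _)
    rw [Set.ncard_coe_finset, Fin.card_Iic] at h2
    omega
  · intro h
    by_contra hl
    have h1 : {l | a l < (D j).degree} ⊆
        ((Finset.Iio l : Finset (Fin (r + 1))) : Set (Fin (r + 1))) := by
      intro l' hl'
      simp only [Finset.coe_Iio, Set.mem_Iio]
      by_contra hge
      exact hl ((ha.1 (not_lt.mp hge)).trans_lt hl')
    have h2 := Set.ncard_le_ncard h1 (Set.toFinite _)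
    rw [Set.ncard_coe_finset, Fin.card_Iio] at h2
    omega

/-- The codimensions of `W(-D_j)` climb from `0` to `r + 1`. The value `a l` is `deg D_j` for the
index `j` at which they pass from at most `l` to more than `l`; such a `j` is critical. -/
theorem exists_isMultivanishing {D : ℕ → C.Divisor} (hD : Monotone D) (hD0 : D 0 = 0)
    (hW : W ≤ C.sections A) (hr : Module.finrank κ W = r + 1)
    (hN : ∃ N, vanishing W A (D N) = ⊥) : ∃ a : Fin (r + 1) → ℤ, IsMultivanishing W A D a := by
  classical
  set c : ℕ → ℕ := fun j => codimVanishing W A (D j) with hc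
  have hcm : Monotone c := fun i j hij => codimVanishing_mono (hD hij)
  have hc0 : c 0 = 0 := codimVanishing_of_nonpos hW hD0.le
  obtain ⟨N, hN⟩ := hN
  have hcN : c N = r + 1 := by
    have := finrank_vanishing_add_codim (W := W) (A := A) (D N)
    rw [hN, finrank_bot] at this
    simp only [hc]
    omega
  have hle : ∀ i, c i ≤ r + 1 := fun i => by
    have := finrank_vanishing_add_codim (W := W) (A := A) (D i)
    simp only [hc]
    omega
  have hex : ∀ l : Fin (r + 1), ∃ j, (l : ℕ) < c (j + 1) ∧ c j ≤ l := by
    intro l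
    have h : ∃ j, (l : ℕ) < c j := ⟨N, by rw [hcN]; exact l.2⟩
    have h1 := Nat.find_spec h
    have h2 : Nat.find h ≠ 0 := by
      intro h0
      rw [h0, hc0] at h1
      omega
    obtain ⟨j, hj⟩ := Nat.exists_eq_succ_of_ne_zero h2
    refine ⟨j, by rw [hj] at h1; exact h1, ?_⟩
    have h3 := Nat.find_min h (m := j) (by omega)
    omega
  choose j hj1 hj2 using hex
  have hcrit : ∀ l, IsCritical D (j l) := by
    intro l h
    have h1 := hj1 l
    have h2 := hj2 l
    simp only [hc, h] at h1 h2
    omega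
  refine ⟨fun l => (D (j l)).degree, ?_, ?_, fun l => ⟨j l, hcrit l, rfl⟩⟩
  · intro l l' hll
    refine Divisor.degree_mono (hD ?_)
    by_contra hlt
    have h1 : c (j l' + 1) ≤ c (j l) := hcm (by omega)
    have h2 := hj1 l'
    have h3 := hj2 l
    have h4 : (l : ℕ) ≤ l' := hll
    omega
  · intro i hi
    rw [finrank_quotient_vanishing (hD (Nat.le_succ i))]
    have h1 : {l | (D (j l)).degree = (D i).degree} =
        {l : Fin (r + 1) | c i ≤ l ∧ (l : ℕ) < c (i + 1)} := by
      ext l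
      simp only [Set.mem_ofPred_eq]
      rw [degree_eq_iff_of_isCritical hD (hcrit l) hi]
      constructor
      · rintro rfl
        exact ⟨hj2 l, hj1 l⟩
      · rintro ⟨h2, h3⟩
        by_contra hne
        rcases lt_or_gt_of_ne hne with h | h
        · have := hcm (show j l + 1 ≤ i by omega)
          have := hj1 l
          omega
        · have := hcm (show i + 1 ≤ j l by omega)
          have := hj2 l
          omega
    rw [h1, ← Set.ncard_image_of_injective _ Fin.val_injective]
    have h2 : Fin.val '' {l : Fin (r + 1) | c i ≤ l ∧ (l : ℕ) < c (i + 1)} =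
        (Finset.Ico (c i) (c (i + 1)) : Set ℕ) := by
      ext m
      simp only [Set.mem_image, Set.mem_ofPred_eq, Finset.coe_Ico, Set.mem_Ico]
      constructor
      · rintro ⟨l, hl, rfl⟩; exact hl
      · intro hm
        exact ⟨⟨m, by have := hle (i + 1); omega⟩, hm, rfl⟩
    rw [h2, Set.ncard_coe_finset, Nat.card_Ico]

end SmoothCurve

open SmoothCurve

/-- The compatibility of two multivanishing sequences in terms of codimensions. -/
theorem forall_degree_le_rev_iff {κ : Type u} [Field κ] [IsAlgClosed κ] {C C' : SmoothCurve κ}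
    {r : ℕ} {W : Submodule κ C.RatFn} {W' : Submodule κ C'.RatFn} {A : C.Divisor} {A' : C'.Divisor}
    {D : ℕ → C.Divisor} {D' : ℕ → C'.Divisor} (hD : Monotone D) (hD0 : D 0 = 0)
    (hD' : Monotone D') (hD0' : D' 0 = 0) (hW : W ≤ C.sections A) (hW' : W' ≤ C'.sections A')
    (hr : Module.finrank κ W = r + 1) (hr' : Module.finrank κ W' = r + 1)
    {a a' : Fin (r + 1) → ℤ} (ha : IsMultivanishing W A D a) (ha' : IsMultivanishing W' A' D' a')
    (b : ℕ) :
    (∀ l j, IsCritical D j → a l = (D j).degree → (D' (b - j)).degree ≤ a' l.rev) ↔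
      ∀ j, codimVanishing W A (D (j + 1)) + codimVanishing W' A' (D' (b - j)) ≤ r + 1 := by
  have : Module.Finite κ W := Module.finite_of_finrank_pos (by omega)
  have : Module.Finite κ W' := Module.finite_of_finrank_pos (by omega)
  have h1 := fun j => finrank_vanishing_add_codim (W := W) (A := A) (D j)
  have h2 := fun j => finrank_vanishing_add_codim (W := W') (A := A') (D' j)
  constructor
  · intro H j
    by_cases h0 : codimVanishing W A (D (j + 1)) = 0
    · have := h2 (b - j); omega
    have h3 := h1 (j + 1)
    -- The last index with value below `deg D_{j+1}`. Its critical index `i` is at most `j`, hence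
    -- `b - j ≤ b - i`, and the hypothesis for `i` gives what is needed for `j`.
    set l : Fin (r + 1) := ⟨codimVanishing W A (D (j + 1)) - 1, by omega⟩ with hl
    have h4 : a l < (D (j + 1)).degree := by
      rw [ha.lt_degree_iff hD hD0 hW]
      simp only [hl]
      omega
    obtain ⟨i, hi, hai⟩ := ha.2.2 l
    rw [hai, degree_lt_iff_of_isCritical hD hi] at h4
    have h5 := H l i hi hai
    have h6 : (D' (b - j)).degree ≤ a' l.rev :=
      (Divisor.degree_mono (hD' (by omega))).trans h5
    have h7 := mt (ha'.lt_degree_iff hD' hD0' hW' (b - j) l.rev).mpr h6.not_gt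
    rw [Fin.val_rev] at h7
    simp only [hl] at h7
    omega
  · intro H l j hj hal
    by_contra hlt
    push Not at hlt
    rw [ha'.lt_degree_iff hD' hD0' hW', Fin.val_rev] at hlt
    have h3 : a l < (D (j + 1)).degree := by
      rw [hal]; exact degree_lt_of_isCritical hD (Nat.lt_succ_self j) hj
    rw [ha.lt_degree_iff hD hD0 hW] at h3
    have := H j
    omega

end

/-! ## Trees -/

noncomputable section

namespace Tree

variable {V : Type*} {T : SimpleGraph V}

open Classical in
/-- The neighbour of `u` that is closer to `x` than `u`. -/
def nxt (T : SimpleGraph V) (u x : V) : V :=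
  if h : ∃ w, T.Adj u w ∧ T.dist w x + 1 = T.dist u x then h.choose else u

theorem nxt_spec (hT : T.IsTree) {u x : V} (h : u ≠ x) :
    T.Adj u (nxt T u x) ∧ T.dist (nxt T u x) x + 1 = T.dist u x := by
  have hex : ∃ w, T.Adj u w ∧ T.dist w x + 1 = T.dist u x := by
    obtain ⟨p, hp⟩ := hT.connected.exists_walk_length_eq_dist u x
    cases p with
    | nil => exact absurd rfl h
    | cons hadj q =>
      rename_i w
      refine ⟨w, hadj, ?_⟩
      rw [SimpleGraph.Walk.length_cons] at hp
      have h1 := SimpleGraph.dist_le q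
      have h2 : T.dist u x ≤ T.dist w x + 1 := by
        have := hT.connected.dist_triangle (u := u) (v := w) (w := x)
        rw [SimpleGraph.dist_eq_one_iff_adj.mpr hadj] at this
        omega
      omega
  unfold nxt
  rw [dif_pos hex]
  exact hex.choose_spec

theorem nxt_adj (hT : T.IsTree) {u x : V} (h : u ≠ x) : T.Adj u (nxt T u x) := (nxt_spec hT h).1

/-- Both neighbours start a geodesic from `u` to `x`, and in a tree there is only one path. -/
theorem eq_nxt (hT : T.IsTree) {u x w : V} (hadj : T.Adj u w)
    (hd : T.dist w x + 1 = T.dist u x) : w = nxt T u x := by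
  have hux : u ≠ x := by
    rintro rfl
    rw [SimpleGraph.dist_self] at hd
    omega
  obtain ⟨h1, h2⟩ := nxt_spec hT hux
  obtain ⟨p, hp⟩ := hT.connected.exists_walk_length_eq_dist w x
  obtain ⟨q, hq⟩ := hT.connected.exists_walk_length_eq_dist (nxt T u x) x
  have hp' := SimpleGraph.Walk.isPath_of_length_eq_dist (SimpleGraph.Walk.cons hadj p)
    (by rw [SimpleGraph.Walk.length_cons, hp, hd])
  have hq' := SimpleGraph.Walk.isPath_of_length_eq_dist (SimpleGraph.Walk.cons h1 q)
    (by rw [SimpleGraph.Walk.length_cons, hq, h2])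
  have h3 := (hT.existsUnique_path u x).unique hp' hq'
  have h4 := congrArg SimpleGraph.Walk.snd h3
  simpa using h4

theorem nxt_eq_or (hT : T.IsTree) {u w : V} (hadj : T.Adj u w) (x : V) :
    (u ≠ x ∧ nxt T u x = w) ∨ (w ≠ x ∧ nxt T w x = u) := by
  rcases hT.dist_eq_dist_add_one_of_adj x hadj with h | h
  · left
    rw [SimpleGraph.dist_comm, SimpleGraph.dist_comm (u := x)] at h
    refine ⟨?_, (eq_nxt hT hadj h.symm).symm⟩
    rintro rfl
    rw [SimpleGraph.dist_self] at h
    omega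
  · right
    rw [SimpleGraph.dist_comm, SimpleGraph.dist_comm (u := x)] at h
    refine ⟨?_, (eq_nxt hT hadj.symm h.symm).symm⟩
    rintro rfl
    rw [SimpleGraph.dist_self] at h
    omega

theorem not_nxt_and (hT : T.IsTree) {u w x : V} (h : u ≠ x ∧ nxt T u x = w) :
    ¬ (w ≠ x ∧ nxt T w x = u) := by
  rintro ⟨h1, h2⟩
  have h3 := (nxt_spec hT h.1).2
  have h4 := (nxt_spec hT h1).2
  rw [h.2] at h3
  rw [h2] at h4
  omega

theorem nxt_eq_of_adj (hT : T.IsTree) {u w : V} (hadj : T.Adj u w) : nxt T u w = w :=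
  (eq_nxt hT hadj (by
    rw [SimpleGraph.dist_self, SimpleGraph.dist_eq_one_iff_adj.mpr hadj])).symm

/-- Adjacent vertices different from `u` lie in the same component of the tree with `u` removed, and
this component is entered through a single neighbour of `u`. -/
theorem nxt_congr (hT : T.IsTree) {u v v' : V} (hv : u ≠ v) (hv' : u ≠ v') (hadj : T.Adj v v') :
    nxt T u v = nxt T u v' := by
  obtain ⟨h1, h2⟩ := nxt_spec hT hv
  set w := nxt T u v with hw
  rcases nxt_eq_or hT h1 v' with h | h
  · exact h.2.symm
  exfalso
  have h3 := (nxt_spec hT h.1).2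
  rw [h.2] at h3
  have hd : T.dist v v' = 1 := SimpleGraph.dist_eq_one_iff_adj.mpr hadj
  have h4 := hT.connected.dist_triangle (u := w) (v := v) (w := v')
  have h5 := hT.connected.dist_triangle (u := u) (v := v') (w := v)
  rw [SimpleGraph.dist_comm (u := v') (v := v)] at h5
  by_cases hwv : w = v
  · have h0 : T.dist w v = 0 := by rw [hwv, SimpleGraph.dist_self]
    have h6 : T.dist u v' = 0 := by omega
    exact hv' (hT.connected.dist_eq_zero_iff.mp h6)
  · obtain ⟨h6, h7⟩ := nxt_spec hT hwv
    set y := nxt T w v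
    have h8 := hT.connected.dist_triangle (u := y) (v := v) (w := v')
    have h9 := hT.connected.dist_triangle (u := w) (v := y) (w := v')
    rw [SimpleGraph.dist_eq_one_iff_adj.mpr h6] at h9
    have h10 : y = nxt T w v' := eq_nxt hT h6 (by omega)
    rw [h.2] at h10
    rw [h10] at h7
    omega

/-- Distances to `x` are bounded, and the vertices whose next vertex is `u` are one step farther
away than `u`; the induction runs from the leaves towards `x`. -/
theorem leaf_induction [Finite V] (hT : T.IsTree) (x : V) {p : V → Prop}
    (h : ∀ u, u ≠ x → (∀ y, y ≠ x → nxt T y x = u → p y) → p u) : ∀ u, u ≠ x → p u := by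
  obtain ⟨M, hM⟩ : ∃ M, ∀ u, T.dist u x ≤ M := by
    have := (Set.finite_range fun u => T.dist u x).bddAbove
    obtain ⟨M, hM⟩ := this
    exact ⟨M, fun u => hM ⟨u, rfl⟩⟩
  intro u hu
  induction hk : M - T.dist u x using Nat.strong_induction_on generalizing u with
  | _ k ih =>
    refine h u hu fun y hy hyu => ?_
    have h1 := (nxt_spec hT hy).2
    rw [hyu] at h1
    have h2 := hM y
    exact ih (M - T.dist y x) (by omega) y hy rfl

/-- A tree has no cycles, hence no compatibility conditions: `F u` is the sum of `X` along the path
from `u` to `x`. -/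
theorem exists_potential {R : Type*} [AddCommMonoid R] (hT : T.IsTree) (x : V) (X : V → V → R) :
    ∃ F : V → R, ∀ u, u ≠ x → F u = F (nxt T u x) + X u (nxt T u x) := by
  let q : V → V := fun u => nxt T u x
  refine ⟨fun u => ∑ i ∈ Finset.range (T.dist u x), X (q^[i] u) (q^[i + 1] u), fun u hu => ?_⟩
  have h1 := (nxt_spec hT hu).2
  dsimp only
  rw [← h1, Finset.sum_range_succ']
  rfl

/-- When `y` is reached in this ordering, its next vertex towards `x` has been listed, while no
vertex beyond `y` has; this is what concentration on `x` requires. -/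
theorem exists_bfs_list [Finite V] (hT : T.IsTree) (x : V) :
    ∃ l : List V, l.Nodup ∧ (∀ y, y ∈ l) ∧ l.head? = some x ∧
      ∀ p y s, l = p ++ y :: s →
        (∀ z ∈ p, T.dist z x ≤ T.dist y x) ∧ ∀ z, T.dist z x < T.dist y x → z ∈ p := by
  classical
  have := Fintype.ofFinite V
  let R : V → V → Prop := fun a b => T.dist a x ≤ T.dist b x
  have : Std.Total R := ⟨fun a b => le_total _ _⟩
  have : IsTrans V R := ⟨fun a b c => le_trans⟩
  set l := (Finset.univ : Finset V).toList.insertionSort R with hl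
  have hmem : ∀ y, y ∈ l := by simp [hl]
  have hsort : l.Pairwise R := List.pairwise_insertionSort R _
  refine ⟨l, ?_, hmem, ?_, ?_⟩
  · exact (List.perm_insertionSort R _).nodup_iff.mpr (Finset.nodup_toList _)
  · cases hl' : l with
    | nil => have := hmem x; rw [hl'] at this; simp at this
    | cons a t =>
      rw [hl'] at hsort
      have h1 := hmem x
      rw [hl'] at h1
      rcases List.mem_cons.mp h1 with h | h
      · rw [h]; rfl
      · have h2 : T.dist a x ≤ T.dist x x := (List.pairwise_cons.mp hsort).1 x h
        rw [SimpleGraph.dist_self, Nat.le_zero, hT.connected.dist_eq_zero_iff] at h2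
        rw [h2]; rfl
  · intro p y s hps
    rw [hps, List.pairwise_append] at hsort
    obtain ⟨-, h2, h3⟩ := hsort
    refine ⟨fun z hz => h3 z hz y (by simp), fun z hz => ?_⟩
    have h4 := hmem z
    rw [hps, List.mem_append, List.mem_cons] at h4
    rcases h4 with h4 | rfl | h4
    · exact h4
    · omega
    · have : T.dist y x ≤ T.dist z x := (List.pairwise_cons.mp h2).1 z h4
      omega

end Tree

end

/-! ## Admissible multidegrees -/

noncomputable section

/-- `⌈x / n⌉`: the number of chips that have left a vertex along an edge of length `n` when the
virtual chip of the edge has moved to distance `x` from the vertex. -/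
def cl (n : ℕ+) (x : ℝ) : ℤ := ⌈x / (n : ℝ)⌉

theorem cl_mono (n : ℕ+) {x y : ℝ} (h : x ≤ y) : cl n x ≤ cl n y :=
  Int.ceil_mono (div_le_div_of_nonneg_right h (by positivity))

theorem cl_add_mul (n : ℕ+) (x : ℝ) (k : ℤ) : cl n (x + n * k) = cl n x + k := by
  have hn : (n : ℝ) ≠ 0 := by positivity
  unfold cl
  rw [add_div, mul_div_cancel_left₀ _ hn, Int.ceil_add_intCast]

/-- The position of a chip is an integer modulo `n`. Differences of ceilings do not see the
representative. -/
theorem cl_congr (n : ℕ+) {a b : ℤ} (h : (a : ZMod n) = b) (x y : ℝ) :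
    cl n (a + x) - cl n (a + y) = cl n (b + x) - cl n (b + y) := by
  rw [ZMod.intCast_eq_intCast_iff_dvd_sub] at h
  obtain ⟨k, hk⟩ := h
  have hb : (b : ℝ) = a + n * k := by
    have : b = a + (n : ℕ) * k := by omega
    rw [this]; push_cast; rfl
  have h1 := cl_add_mul n (a + x) k
  have h2 := cl_add_mul n (a + y) k
  rw [hb, show (a : ℝ) + n * k + x = a + x + n * k by ring,
    show (a : ℝ) + n * k + y = a + y + n * k by ring, h1, h2]
  ring

theorem cl_le_iff (n : ℕ+) (x : ℝ) (k : ℤ) : cl n x ≤ k ↔ x ≤ n * k := by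
  have hn : (0 : ℝ) < n := by positivity
  unfold cl
  rw [Int.ceil_le, div_le_iff₀ hn, mul_comm]

theorem lt_cl_iff (n : ℕ+) (x : ℝ) (k : ℤ) : k < cl n x ↔ n * k < x := by
  rw [← not_le, cl_le_iff, not_le]

open Classical in
-- The ceiling of `a / n` jumps exactly when `a` leaves a multiple of `n`, that is, when the virtual
-- chip starts from the vertex itself.
theorem cl_add_one (n : ℕ+) (a : ℤ) :
    cl n (a + 1) = cl n a + if (a : ZMod n) = 0 then 1 else 0 := by
  have hn : (0 : ℤ) < n := by positivity
  have h1 : (n : ℝ) * ((cl n a : ℤ) : ℝ) ≥ a := (cl_le_iff n a _).mp le_rfl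
  have h2 : (n : ℝ) * ((cl n a - 1 : ℤ) : ℝ) < a := (lt_cl_iff n a _).mp (by omega)
  have h1' : (a : ℤ) ≤ n * cl n a := by exact_mod_cast h1
  have h2' : (n : ℤ) * (cl n a - 1) < a := by exact_mod_cast h2
  split_ifs with h
  · rw [ZMod.intCast_zmod_eq_zero_iff_dvd] at h
    obtain ⟨k, hk⟩ := h
    have hk' : a = (n : ℤ) * k := by exact_mod_cast hk
    have h3 : k = cl n a := by
      have h4 : k ≤ cl n a := le_of_mul_le_mul_left (by rw [← hk']; exact h1') hn
      have h5 : cl n a - 1 < k := lt_of_mul_lt_mul_left (by rw [← hk']; exact h2') hn.le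
      omega
    apply le_antisymm
    · rw [cl_le_iff]
      have : (a : ℤ) + 1 ≤ n * (cl n a + 1) := by nlinarith
      exact_mod_cast this
    · rw [Int.add_one_le_iff, lt_cl_iff]
      have : (n : ℤ) * cl n a < a + 1 := by rw [← h3, ← hk']; omega
      exact_mod_cast this
  · rw [add_zero]
    apply le_antisymm
    · rw [cl_le_iff]
      have h3 : a ≠ n * cl n a := by
        intro h4
        apply h
        rw [ZMod.intCast_zmod_eq_zero_iff_dvd]
        exact ⟨cl n a, by exact_mod_cast h4⟩
      have : (a : ℤ) + 1 ≤ n * cl n a := by omega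
      exact_mod_cast this
    · exact cl_mono n (by linarith)

theorem natCast_ncard_eq_sum {α : Type*} [Fintype α] (S : Set α) [DecidablePred (· ∈ S)] :
    (S.ncard : ℤ) = ∑ x, if x ∈ S then 1 else 0 := by
  rw [Set.ncard_eq_toFinset_card', Finset.sum_boole]
  congr 2
  ext; simp

namespace MGraph

variable {G : MGraph.{u}}

instance : Fintype G.E := Fintype.ofFinite _
instance : Fintype G.V := Fintype.ofFinite _

theorem sign_tail (e : G.E) : sign e (G.tail e) = 1 := if_pos rfl

theorem sign_head (e : G.E) : sign e (G.head e) = -1 := if_neg (G.tail_ne_head e)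

theorem sign_mul_self (e : G.E) (v : G.V) : sign e v * sign e v = 1 := by
  unfold sign; split_ifs <;> rfl

theorem sign_eq (e : G.E) (v : G.V) : sign e v = 1 ∨ sign e v = -1 := by
  unfold sign; split_ifs <;> simp

theorem Joins.symm {e : G.E} {v w : G.V} (h : G.Joins e v w) : G.Joins e w v := Or.symm h

theorem Joins.inc {e : G.E} {v w : G.V} (h : G.Joins e v w) : G.Inc e v :=
  h.elim (fun h => Or.inl h.1) fun h => Or.inr h.2

theorem Joins.ne {e : G.E} {v w : G.V} (h : G.Joins e v w) : v ≠ w := by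
  rintro rfl
  rcases h with h | h <;> exact G.tail_ne_head e (h.1.trans h.2.symm)

theorem Joins.sign_neg {e : G.E} {v w : G.V} (h : G.Joins e v w) : sign e w = - sign e v := by
  rcases h with ⟨h1, h2⟩ | ⟨h1, h2⟩ <;> rw [← h1, ← h2, sign_tail, sign_head]
  rfl

theorem Joins.adj {e : G.E} {v w : G.V} (h : G.Joins e v w) : G.bar.Adj v w := ⟨e, h⟩

theorem Joins.eq {e : G.E} {v w w' : G.V} (h : G.Joins e v w) (h' : G.Joins e v w') : w = w' := by
  have := G.tail_ne_head e
  rcases h with ⟨h1, h2⟩ | ⟨h1, h2⟩ <;> rcases h' with ⟨h3, h4⟩ | ⟨h3, h4⟩ <;> subst_vars <;> simp_all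

theorem Inc.exists_joins {e : G.E} {v : G.V} (h : G.Inc e v) : ∃ w, G.Joins e v w :=
  h.elim (fun h => ⟨_, Or.inl ⟨h, rfl⟩⟩) fun h => ⟨_, Or.inr ⟨rfl, h⟩⟩

/-- The coboundary of a function on the vertices. -/
def cob {R : Type*} [Sub R] (c : G.V → R) (e : G.E) : R := c (G.tail e) - c (G.head e)

theorem Joins.sign_mul_cob {e : G.E} {v w : G.V} (h : G.Joins e v w) (c : G.V → ℤ) :
    sign e v * cob c e = c v - c w := by
  rcases h with ⟨h1, h2⟩ | ⟨h1, h2⟩ <;> rw [← h1, ← h2] <;> simp [sign_tail, sign_head, cob]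

/-! ### Pushing chips along edges, and twists as coboundaries -/

namespace Multidegree

variable {n : G.ChainStructure}

/-- A representative of the distance from `v` of the virtual chip on `e`. -/
def pos (w : Multidegree G n) (e : G.E) (v : G.V) : ℤ := sign e v * (w.edge e).val

theorem intCast_pos (w : Multidegree G n) (e : G.E) (v : G.V) :
    ((w.pos e v : ℤ) : ZMod (n e)) = sign e v * w.edge e := by
  unfold pos
  push_cast
  rw [ZMod.natCast_val, ZMod.cast_id]

theorem Joins.pos_neg {e : G.E} {v v' : G.V} (h : G.Joins e v v') (w : Multidegree G n) :
    w.pos e v' = - w.pos e v := by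
  unfold pos; rw [h.sign_neg]; ring

/-- The number of chips that leave `v` along `e` when the chips on `e` are moved away from `v` by
distance `k`. -/
def leave (w : Multidegree G n) (e : G.E) (v : G.V) (k : ℤ) : ℤ :=
  cl (n e) (w.pos e v + k) - cl (n e) (w.pos e v)

theorem leave_zero (w : Multidegree G n) (e : G.E) (v : G.V) : w.leave e v 0 = 0 := by
  simp [leave]

theorem leave_mono (w : Multidegree G n) (e : G.E) (v : G.V) : Monotone (w.leave e v) := by
  intro a b h
  have : (a : ℝ) ≤ b := by exact_mod_cast h
  exact sub_le_sub_right (cl_mono _ (by linarith)) _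

open Classical in
-- The congruence is the one that defines the increments of the twisting divisors, so these divisors
-- record the chips leaving `v`.
theorem leave_add_one (w : Multidegree G n) (e : G.E) (v : G.V) (k : ℤ) :
    w.leave e v (k + 1) = w.leave e v k +
      if (sign e v : ZMod (n e)) * w.edge e = -(k : ZMod (n e)) then 1 else 0 := by
  have h := cl_add_one (n e) (w.pos e v + k)
  have h2 : ((w.pos e v + k : ℤ) : ZMod (n e)) = 0 ↔
      (sign e v : ZMod (n e)) * w.edge e = -(k : ZMod (n e)) := by
    push_cast
    rw [intCast_pos, eq_neg_iff_add_eq_zero]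
  rw [if_congr h2 rfl rfl] at h
  unfold leave
  push_cast at h ⊢
  rw [← add_assoc, h]
  ring

theorem sign_mul_eq_zero_iff {e : G.E} {v : G.V} {m : ℕ} (x : ZMod m) :
    (sign e v : ZMod m) * x = 0 ↔ x = 0 := by
  rcases sign_eq e v with h | h <;> simp [h]

open Classical in
theorem leave_one (w : Multidegree G n) (e : G.E) (v : G.V) :
    w.leave e v 1 = if w.edge e = 0 then 1 else 0 := by
  have h := w.leave_add_one e v 0
  rw [zero_add, leave_zero, zero_add] at h
  rw [h]
  refine if_congr ?_ rfl rfl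
  rw [Int.cast_zero, neg_zero, sign_mul_eq_zero_iff]

open Classical in
-- A push by one away from `v` is a push by `-1` as seen from `v'`, and a chip enters `v'` when it
-- lands on a multiple of the length.
theorem leave_neg_one (w : Multidegree G n) {e : G.E} {v v' : G.V} (he : G.Joins e v v') :
    w.leave e v' (-1) = - if w.edge e + (sign e v : ZMod (n e)) = 0 then 1 else 0 := by
  have h := w.leave_add_one e v' (-1)
  rw [neg_add_cancel, leave_zero] at h
  have h2 : (sign e v' : ZMod (n e)) * w.edge e = -((-1 : ℤ) : ZMod (n e)) ↔
      w.edge e + (sign e v : ZMod (n e)) = 0 := by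
    rw [he.sign_neg]
    rcases sign_eq e v with h | h <;> simp only [h] <;> push_cast
    · rw [neg_neg, ← sub_eq_zero, ← neg_eq_zero]; ring_nf
    · rw [neg_neg, ← sub_eq_zero]; ring_nf
  rw [if_congr h2 rfl rfl] at h
  omega

open Classical in
/-- The multidegree obtained by moving the chips on `e` by distance `δ e` towards the head. -/
def act (δ : G.E → ℤ) (w : Multidegree G n) : Multidegree G n where
  vert u := w.vert u - ∑ e, if G.Inc e u then w.leave e u (sign e u * δ e) else 0
  edge e := w.edge e + (δ e : ZMod (n e))

theorem intCast_pos_act (δ : G.E → ℤ) (w : Multidegree G n) (e : G.E) (v : G.V) :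
    (((act δ w).pos e v : ℤ) : ZMod (n e)) = ((w.pos e v + sign e v * δ e : ℤ) : ZMod (n e)) := by
  push_cast
  rw [intCast_pos, intCast_pos]
  simp only [act]
  ring

/-- The cocycle identity that makes `act` an additive action. -/
theorem leave_act (δ : G.E → ℤ) (w : Multidegree G n) (e : G.E) (v : G.V) (k : ℤ) :
    (act δ w).leave e v k = w.leave e v (sign e v * δ e + k) - w.leave e v (sign e v * δ e) := by
  have h := cl_congr (n e) (intCast_pos_act δ w e v) k 0
  unfold leave
  push_cast at h ⊢
  rw [add_zero, add_zero] at h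
  rw [h, ← add_assoc]
  ring

theorem act_act (δ δ' : G.E → ℤ) (w : Multidegree G n) :
    act δ' (act δ w) = act (δ + δ') w := by
  ext e
  · simp only [act]
    rw [sub_sub, ← Finset.sum_add_distrib]
    congr 1
    refine Finset.sum_congr rfl fun e' _ => ?_
    split_ifs
    · have := leave_act δ w e' e (sign e' e * δ' e')
      simp only [act] at this
      rw [this, Pi.add_apply, mul_add]
      ring
    · rfl
  · simp [act, add_assoc]

theorem act_zero (w : Multidegree G n) : act 0 w = w := by
  ext e
  · simp [act, leave_zero]
  · simp [act]

open Classical in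
-- The two cardinalities in `twistAlong` are the sums of `leave` for a push by `1` at `v` and by
-- `-1` at the other endpoints.
theorem twistAlong_eq (w : Multidegree G n) (F : Set G.E) (v : G.V) :
    w.twistAlong F v = act (fun e => if e ∈ F ∧ G.Inc e v then sign e v else 0) w := by
  ext u
  · simp only [twistAlong, act]
    rw [natCast_ncard_eq_sum, natCast_ncard_eq_sum]
    by_cases hu : u = v
    · subst hu
      rw [if_pos rfl, sub_add, ← Finset.sum_sub_distrib]
      congr 1
      refine Finset.sum_congr rfl fun e _ => ?_
      simp only [Set.mem_ofPred_eq]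
      have h1 : ¬ G.Joins e u u := fun h => h.ne rfl
      simp only [h1, false_and, and_false, if_false, sub_zero]
      by_cases he : G.Inc e u
      · by_cases hF : e ∈ F
        · simp [he, hF, sign_mul_self, leave_one]
        · simp [he, hF, leave_zero]
      · simp [he]
    · rw [if_neg hu, sub_eq_add_neg, ← Finset.sum_neg_distrib]
      congr 1
      refine Finset.sum_congr rfl fun e _ => ?_
      simp only [Set.mem_ofPred_eq]
      by_cases he : G.Inc e u
      · by_cases hF : e ∈ F
        · by_cases hv : G.Inc e v
          · have hj : G.Joins e v u := by
              obtain ⟨y, hy⟩ := hv.exists_joins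
              rcases he with he | he <;> rcases hy with hy | hy
              · exact absurd (he.symm.trans hy.1) hu
              · exact Or.inr ⟨he, hy.2⟩
              · exact Or.inl ⟨hy.1, he⟩
              · exact absurd (he.symm.trans hy.2) hu
            have h1 : sign e u * sign e v = -1 := by
              rw [hj.sign_neg, neg_mul, sign_mul_self]
            simp only [he, hF, hv, hj, true_and, and_self, if_true, h1, w.leave_neg_one hj, neg_neg]
          · have hj : ¬ G.Joins e v u := fun h => hv h.inc
            simp [hv, hj, leave_zero]
        · simp [hF, leave_zero]
      · have hj : ¬ G.Joins e v u := fun h => he h.symm.inc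
        simp [he, hj]
  · simp only [twistAlong, act]
    split_ifs <;> simp

open Classical in
theorem twist_eq (w : Multidegree G n) (v : G.V) : w.twist v = act (cob (Pi.single v 1)) w := by
  rw [twist, twistAlong_eq]
  congr 1
  ext e
  have := G.tail_ne_head e
  simp only [Set.mem_univ, true_and, cob, Inc, sign, Pi.single_apply]
  by_cases h1 : G.tail e = v <;> by_cases h2 : G.head e = v <;> simp_all

theorem act_iterate (δ : G.E → ℤ) (w : Multidegree G n) (b : ℕ) :
    (act δ)^[b] w = act (b • δ) w := by
  induction b with
  | zero => rw [Function.iterate_zero, id, zero_smul, act_zero]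
  | succ b ih => rw [Function.iterate_succ_apply', ih, act_act, succ_nsmul]

theorem cob_add (c c' : G.V → ℤ) : cob (G := G) (c + c') = cob c + cob c' := by
  ext e; simp only [cob, Pi.add_apply]; ring

theorem cob_const (k : ℤ) : cob (G := G) (fun _ => k) = 0 := by
  ext e; simp [cob]

theorem reaches_act_nonneg (w : Multidegree G n) (c : G.V → ℕ) :
    Reaches w (act (cob fun v => (c v : ℤ)) w) := by
  classical
  have h1 : ∀ (v : G.V) (k : ℕ) (w : Multidegree G n),
      Reaches w (act (cob (Pi.single v (k : ℤ))) w) := by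
    intro v k w
    induction k with
    | zero =>
      have : cob (G := G) (Pi.single v ((0 : ℕ) : ℤ)) = 0 := by
        ext e; simp [cob]
      rw [this, act_zero]
      exact Relation.ReflTransGen.refl
    | succ k ih =>
      refine Relation.ReflTransGen.tail ih ⟨v, ?_⟩
      rw [twist_eq, act_act, ← cob_add, ← Pi.single_add]
      push_cast
      rfl
  have h2 : ∀ s : Finset G.V, Reaches w (act (cob (∑ v ∈ s, Pi.single v (c v : ℤ))) w) := by
    intro s
    induction s using Finset.induction_on with
    | empty =>
      have : cob (G := G) (∑ v ∈ (∅ : Finset G.V), Pi.single v (c v : ℤ)) = 0 := by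
        ext e; simp [cob]
      rw [this, act_zero]
      exact Relation.ReflTransGen.refl
    | insert v s hv ih =>
      rw [Finset.sum_insert hv, add_comm, cob_add, ← act_act]
      exact ih.trans (h1 v (c v) _)
  have h3 := h2 Finset.univ
  rwa [Finset.univ_sum_single] at h3

/-- Twisting realizes only nonnegative functions directly, but constants have zero coboundary, so
any `c` can first be shifted to be nonnegative. -/
theorem reaches_iff (w w' : Multidegree G n) : Reaches w w' ↔ ∃ c : G.V → ℤ, w' = act (cob c) w := by
  classical
  constructor
  · intro h
    induction h with
    | refl => exact ⟨0, by rw [show cob (G := G) (0 : G.V → ℤ) = 0 from cob_const 0, act_zero]⟩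
    | tail _ h ih =>
      obtain ⟨c, rfl⟩ := ih
      obtain ⟨v, rfl⟩ := h
      exact ⟨_, by rw [twist_eq, act_act, ← cob_add]⟩
  · rintro ⟨c, rfl⟩
    have h := reaches_act_nonneg w fun v => (c v + ∑ u, |c u|).toNat
    have h2 : (fun v => (((c v + ∑ u, |c u|).toNat : ℕ) : ℤ)) = c + fun _ => ∑ u, |c u| := by
      ext v
      have : |c v| ≤ ∑ u, |c u| :=
        Finset.single_le_sum (f := fun u => |c u|) (fun _ _ => abs_nonneg _) (Finset.mem_univ v)
      have := neg_abs_le (c v)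
      rw [Int.toNat_of_nonneg (by omega)]
      rfl
    rwa [h2, cob_add, cob_const, add_zero] at h

end Multidegree

end MGraph

end

/-! ## Reduced divisors on multitrees -/

noncomputable section

namespace Tree

variable {V : Type*} {T : SimpleGraph V}

/-- Recursion from the leaves: `Φ u` only uses the values at the vertices whose next vertex is `u`,
so simultaneous updating of all values becomes stationary away from `x`. -/
theorem exists_fixed [Finite V] (hT : T.IsTree) (x : V) {R : Type*} [Inhabited R]
    (Φ : V → (V → R) → R)
    (hΦ : ∀ u k k', (∀ y, y ≠ x → nxt T y x = u → k y = k' y) → Φ u k = Φ u k') :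
    ∃ k : V → R, ∀ u, u ≠ x → k u = Φ u k := by
  classical
  have := Fintype.ofFinite V
  let s : ℕ → V → R := fun m => (fun k u => Φ u k)^[m] fun _ => default
  have hs : ∀ m u, s (m + 1) u = Φ u (s m) := fun m u => by
    simp only [s, Function.iterate_succ_apply']
  have h1 : ∀ u, u ≠ x → ∃ M, ∀ m ≥ M, s m u = s M u := by
    refine leaf_induction hT x fun u hu ih => ?_
    choose! M hM using ih
    refine ⟨Finset.univ.sup M + 1, fun m hm => ?_⟩
    obtain ⟨m, rfl⟩ : ∃ m', m = m' + 1 := ⟨m - 1, by omega⟩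
    rw [hs, hs]
    refine hΦ u _ _ fun y hy hyu => ?_
    have h2 : M y ≤ Finset.univ.sup M := Finset.le_sup (Finset.mem_univ y)
    rw [hM y hy hyu m (by omega), hM y hy hyu _ h2]
  choose! M hM using h1
  refine ⟨s (Finset.univ.sup M), fun u hu => ?_⟩
  have h2 : M u ≤ Finset.univ.sup M := Finset.le_sup (Finset.mem_univ u)
  rw [← hs, hM u hu _ h2, hM u hu (Finset.univ.sup M + 1) (by omega)]

end Tree

namespace MGraph

variable {G : MGraph.{u}} {n : G.ChainStructure}

theorem joins_tail_head (e : G.E) : G.Joins e (G.tail e) (G.head e) := Or.inl ⟨rfl, rfl⟩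

theorem chainVertex_zero (e : G.E) : chainVertex n e 0 = .inl (G.tail e) := if_pos rfl

theorem chainVertex_len (e : G.E) : chainVertex n e (n e) = .inl (G.head e) := by
  have := (n e).pos
  unfold chainVertex
  rw [if_neg (by omega), dif_neg (by omega)]

theorem chainVertex_succ (e : G.E) (i : Fin (n e - 1)) :
    chainVertex n e (i + 1) = .inr ⟨e, i⟩ := by
  unfold chainVertex
  rw [if_neg (by omega), dif_pos (by have := i.2; omega)]
  rfl

theorem chainVertex_cases (e : G.E) {k : ℕ} (hk : k ≤ n e) :
    (k = 0) ∨ (k = n e) ∨ ∃ i : Fin (n e - 1), k = i + 1 := by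
  by_cases h0 : k = 0
  · exact Or.inl h0
  · by_cases h1 : k = n e
    · exact Or.inr (Or.inl h1)
    · exact Or.inr (Or.inr ⟨⟨k - 1, by omega⟩, by simp; omega⟩)

theorem exists_crossing {P : ℕ → Prop} {a b : ℕ} (hab : a ≤ b) (ha : P a) (hb : ¬ P b) :
    ∃ k, a ≤ k ∧ k < b ∧ P k ∧ ¬ P (k + 1) := by
  by_contra! h
  have : ∀ k, a ≤ k → k ≤ b → P k := by
    intro k hk
    induction k, hk using Nat.le_induction with
    | base => exact fun _ => ha
    | succ k hk ih => exact fun hkb => h k hk (by omega) (ih (by omega))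
  exact hb (this b hab le_rfl)

namespace Multidegree

open LimitLinear.Tree

variable (w : Multidegree G n)

theorem divisor_inr (e : G.E) (i : Fin (n e - 1)) :
    w.divisor (.inr ⟨e, i⟩) = if (w.edge e).val = (i : ℕ) + 1 then 1 else 0 := rfl

theorem val_lt (e : G.E) : (w.edge e).val < n e := by
  have : NeZero (n e : ℕ) := ⟨(n e).pos.ne'⟩
  exact ZMod.val_lt _

theorem val_eq_zero (e : G.E) : (w.edge e).val = 0 ↔ w.edge e = 0 := ZMod.val_eq_zero _

theorem joins_subdivision (e : G.E) (i : Fin (n e)) :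
    (G.subdivision n).Joins ⟨e, i⟩ (chainVertex n e i) (chainVertex n e (i + 1)) :=
  Or.inl ⟨rfl, rfl⟩

/-- The number of chips that leave `u` along the edges joining `u` and `p` when all the chips on
these edges move away from `u` by distance `k`. -/
def outflow (u p : G.V) (k : ℤ) : ℤ :=
  open Classical in ∑ e, if G.Joins e u p then w.leave e u k else 0

theorem outflow_mono (u p : G.V) : Monotone (w.outflow u p) := by
  intro a b h
  refine Finset.sum_le_sum fun e _ => ?_
  split_ifs
  · exact w.leave_mono e u h
  · rfl

theorem outflow_zero (u p : G.V) : w.outflow u p 0 = 0 :=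
  Finset.sum_eq_zero fun e _ => by simp [leave_zero]

theorem outflow_one (u p : G.V) :
    w.outflow u p 1 = ({e | G.Joins e u p ∧ w.edge e = 0}.ncard : ℤ) := by
  classical
  rw [natCast_ncard_eq_sum]
  refine Finset.sum_congr rfl fun e _ => ?_
  simp only [leave_one, Set.mem_ofPred_eq]
  split_ifs <;> simp_all

theorem leave_mul (e : G.E) (v : G.V) (k : ℤ) : w.leave e v (n e * k) = k := by
  have := cl_add_mul (n e) (w.pos e v) k
  unfold leave
  push_cast
  rw [this]
  ring

theorem leave_add_mul (e : G.E) (v : G.V) (j k : ℤ) :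
    w.leave e v (j + n e * k) = w.leave e v j + k := by
  have := cl_add_mul (n e) (w.pos e v + j) k
  unfold leave
  push_cast
  rw [← add_assoc, this]
  ring

/-- The outflow is monotone, and one edge suffices to make it unbounded in both directions, because
a push by `n e₀ * k` sends exactly `k` chips along `e₀`. -/
theorem exists_outflow {u p : G.V} (h : G.bar.Adj u p) (A : ℤ) :
    ∃ k, w.outflow u p k ≤ A ∧ A < w.outflow u p (k + 1) := by
  classical
  obtain ⟨e₀, he₀⟩ := h
  have h1 : w.outflow u p (n e₀ * (-|A|)) ≤ A := by
    calc w.outflow u p (n e₀ * (-|A|)) ≤ -|A| := by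
          rw [outflow, ← Finset.add_sum_erase _ _ (Finset.mem_univ e₀), if_pos he₀, leave_mul]
          refine add_le_of_nonpos_right (Finset.sum_nonpos fun e _ => ?_)
          split_ifs
          · rw [← w.leave_zero e u]
            refine w.leave_mono e u (mul_nonpos_of_nonneg_of_nonpos (by positivity) (by simp))
          · rfl
      _ ≤ A := neg_abs_le A
  have h2 : A < w.outflow u p (n e₀ * (|A| + 1)) := by
    calc A < |A| + 1 := by have := le_abs_self A; omega
      _ ≤ w.outflow u p (n e₀ * (|A| + 1)) := by
          rw [outflow, ← Finset.add_sum_erase _ _ (Finset.mem_univ e₀), if_pos he₀, leave_mul]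
          refine le_add_of_nonneg_right (Finset.sum_nonneg fun e _ => ?_)
          split_ifs
          · rw [← w.leave_zero e u]
            exact w.leave_mono e u (by positivity)
          · rfl
  obtain ⟨k, hk, hk'⟩ := Int.exists_greatest_of_bdd (P := fun k => w.outflow u p k ≤ A)
    ⟨n e₀ * (|A| + 1), fun k hk => by
      by_contra! hlt
      have := w.outflow_mono u p hlt.le
      omega⟩ ⟨_, h1⟩
  refine ⟨k, hk, ?_⟩
  by_contra! hlt
  have := hk' _ hlt
  omega

theorem outflow_act (c : G.V → ℤ) (u p : G.V) (k : ℤ) :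
    (act (cob c) w).outflow u p k =
      w.outflow u p (c u - c p + k) - w.outflow u p (c u - c p) := by
  unfold outflow
  rw [← Finset.sum_sub_distrib]
  refine Finset.sum_congr rfl fun e _ => ?_
  split_ifs with h
  · rw [leave_act, h.sign_mul_cob]
  · rfl

open Classical in
theorem vert_act_cob (c : G.V → ℤ) (u p : G.V) :
    (act (cob c) w).vert u = w.vert u - w.outflow u p (c u - c p) -
      ∑ e, if G.Inc e u ∧ ¬ G.Joins e u p then w.leave e u (sign e u * cob c e) else 0 := by
  simp only [act, outflow]
  rw [sub_sub, ← Finset.sum_add_distrib]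
  congr 1
  refine Finset.sum_congr rfl fun e _ => ?_
  by_cases h : G.Joins e u p
  · simp [h, h.inc, h.sign_mul_cob]
  · simp [h]

/-- The condition at the vertex `u` for `w` to be `v`-reduced. -/
def RedAt (v u : G.V) : Prop :=
  0 ≤ w.vert u ∧ w.vert u < w.outflow u (Tree.nxt G.bar u v) 1

variable {w}

/-- In a set `S` that contains vertices of `G`, take the one, `u`, closest to `v`; the next vertex
`p` is outside `S`. On an edge from `u` to `p` with `μ = 0` the interior vertices carry no chip. So
either one of the vertices of `S` has too few chips, or `S` is left on each of these edges already
at `u`, and then `u` itself has too few. -/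
theorem isReduced_of_redAt (hT : G.IsMultitree) {v : G.V} (h : ∀ u, u ≠ v → w.RedAt v u) :
    MGraph.IsReduced (G := G.subdivision n) (.inl v) w.divisor := by
  classical
  have hpos : ∀ (S : Set (G.subdivision n).V) (e : G.E) (i : Fin (n e)) (x y : (G.subdivision n).V),
      (G.subdivision n).Joins ⟨e, i⟩ x y → y ∉ S →
      (1 : ℤ) ≤ ({e : (G.subdivision n).E | ∃ u, u ∉ S ∧ (G.subdivision n).Joins e x u}.ncard : ℤ) := by
    intro S e i x y hj hy
    have : 0 < {e : (G.subdivision n).E | ∃ u, u ∉ S ∧ (G.subdivision n).Joins e x u}.ncard :=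
      (Set.ncard_pos (Set.toFinite _)).mpr ⟨⟨e, i⟩, y, hy, hj⟩
    omega
  refine ⟨?_, fun S hS hv => ?_⟩
  · rintro (u | ⟨e, i⟩) hu
    · exact (h u (fun h => hu (by rw [h]))).1
    · rw [divisor_inr]; split_ifs <;> omega
  by_cases hex : ∃ u, Sum.inl u ∈ S
  · obtain ⟨u, hu, hmin⟩ : ∃ u, Sum.inl u ∈ S ∧ ∀ u', Sum.inl u' ∈ S → G.bar.dist u v ≤ G.bar.dist u' v := by
      obtain ⟨u, hu, hmin⟩ := Set.exists_min_image {u | Sum.inl u ∈ S} (fun u => G.bar.dist u v)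
        (Set.toFinite _) hex
      exact ⟨u, hu, hmin⟩
    have huv : u ≠ v := by rintro rfl; exact hv hu
    set p := nxt G.bar u v with hp
    have hpS : Sum.inl p ∉ S := fun hpS => by
      have h1 := hmin p hpS
      have h2 := (nxt_spec hT huv).2
      rw [← hp] at h2
      omega
    have h1 := (h u huv).2
    rw [outflow_one] at h1
    by_contra! hcon
    have h2 : ∀ e, G.Joins e u p ∧ w.edge e = 0 → ∃ i : Fin (n e), ∃ y, y ∉ S ∧
        (G.subdivision n).Joins ⟨e, i⟩ (.inl u) y := by
      rintro e ⟨hj, he⟩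
      have hval : (w.edge e).val = 0 := (w.val_eq_zero e).mpr he
      have hint : ∀ i : Fin (n e - 1), Sum.inr ⟨e, i⟩ ∈ S → ∀ (j : Fin (n e)) y,
          (G.subdivision n).Joins ⟨e, j⟩ (.inr ⟨e, i⟩) y → y ∈ S := by
        intro i hi j y hy
        by_contra hyS
        have h3 := hcon _ hi
        have h4 := hpos S e j _ _ hy hyS
        rw [divisor_inr, if_neg (by omega)] at h3
        omega
      rcases hj with ⟨ht, hh⟩ | ⟨ht, hh⟩
      · obtain ⟨k, -, hk, hkS, hkS'⟩ := exists_crossing (P := fun k => chainVertex n e k ∈ S)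
          (Nat.zero_le (n e)) (by rw [chainVertex_zero, ht]; exact hu)
          (by rw [chainVertex_len, hh]; exact hpS)
        rcases chainVertex_cases e hk.le with rfl | rfl | ⟨i, rfl⟩
        · refine ⟨⟨0, hk⟩, _, hkS', ?_⟩
          have := joins_subdivision e ⟨0, hk⟩
          rwa [chainVertex_zero, ht] at this
        · omega
        · exfalso
          rw [chainVertex_succ] at hkS
          have := joins_subdivision e ⟨_, hk⟩
          rw [chainVertex_succ] at this
          exact hkS' (hint i hkS _ _ this)
      · obtain ⟨k, -, hk, hkS, hkS'⟩ := exists_crossing (P := fun k => chainVertex n e k ∉ S)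
          (Nat.zero_le (n e)) (by rw [chainVertex_zero, ht]; exact hpS)
          (by rw [chainVertex_len, hh]; exact not_not.mpr hu)
        rw [not_not] at hkS'
        have hj := joins_subdivision e ⟨k, hk⟩
        rcases chainVertex_cases e (show k + 1 ≤ n e from hk) with h0 | h0 | ⟨i, h0⟩
        · omega
        · refine ⟨⟨k, hk⟩, _, hkS, ?_⟩
          simp only [h0] at hj
          rw [chainVertex_len, hh] at hj
          exact hj.symm
        · exfalso
          have hk0 : k = i := by omega
          subst hk0
          rw [chainVertex_succ] at hkS' hj
          exact hkS (hint i hkS' _ _ hj.symm)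
    choose! i y hy hj using h2
    have h3 := hcon _ hu
    refine absurd h1 (not_lt.mpr (le_trans ?_ h3))
    refine Nat.cast_le.mpr ?_
    refine Set.ncard_le_ncard_of_injOn
      (fun e => (⟨e, i e⟩ : Σ e, Fin (n e))) ?_ ?_ (Set.toFinite _)
    · exact fun e he => ⟨_, hy e he, hj e he⟩
    · exact fun e _ e' _ hee => congrArg Sigma.fst hee
  -- Now `S` lies in the interiors of edges. A run of vertices of `S` on one edge has two ends, and
  -- the edge has at most one chip: either an end without chip has an edge leaving `S`, or the run
  -- is a single vertex with one chip and two edges leaving `S`.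
  · push Not at hex
    obtain ⟨x | ⟨e, i⟩, hx⟩ := hS
    · exact absurd hx (hex x)
    have hi := i.2
    obtain ⟨k, -, hk, hkS, hkS'⟩ := exists_crossing (P := fun k => chainVertex n e k ∉ S)
      (Nat.zero_le (i + 1)) (by rw [chainVertex_zero]; exact hex _)
      (by rw [chainVertex_succ]; exact not_not.mpr hx)
    obtain ⟨l, hl1, hl, hlS, hlS'⟩ := exists_crossing (P := fun k => chainVertex n e k ∈ S)
      (show (i : ℕ) + 1 ≤ n e by omega) (by rw [chainVertex_succ]; exact hx)
      (by rw [chainVertex_len]; exact hex _)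
    rw [not_not] at hkS'
    have hk1 := joins_subdivision (n := n) e ⟨k, by omega⟩
    have hl1 := joins_subdivision (n := n) e ⟨l, hl⟩
    obtain ⟨a, rfl⟩ : ∃ a : Fin ((n e : ℕ) - 1), k = a := ⟨⟨k, by omega⟩, rfl⟩
    obtain ⟨b, rfl⟩ : ∃ b : Fin (n e - 1), l = b + 1 := ⟨⟨l - 1, by omega⟩, show l = l - 1 + 1 by omega⟩
    rw [chainVertex_succ] at hkS' hlS hk1 hl1
    by_cases ha : (w.edge e).val = (a : ℕ) + 1
    · by_cases hb : (w.edge e).val = (b : ℕ) + 1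
      · have hab : a = b := Fin.ext (by omega)
        subst hab
        refine ⟨_, hkS', ?_⟩
        rw [divisor_inr, if_pos ha]
        have h5 : 1 < {e' : (G.subdivision n).E |
            ∃ u, u ∉ S ∧ (G.subdivision n).Joins e' (Sum.inr ⟨e, a⟩) u}.ncard := by
          rw [Set.one_lt_ncard (Set.toFinite _)]
          exact ⟨_, ⟨_, hkS, hk1.symm⟩, _, ⟨_, hlS', hl1⟩, fun h => by
            have := congrArg (fun x : Σ e, Fin (n e) => (x.2 : ℕ)) h
            dsimp only at this
            omega⟩
        exact_mod_cast h5
      · refine ⟨_, hlS, ?_⟩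
        rw [divisor_inr, if_neg hb]
        exact hpos S e _ _ _ hl1 hlS'
    · refine ⟨_, hkS', ?_⟩
      rw [divisor_inr, if_neg ha]
      exact hpos S e _ _ _ hk1.symm hkS

/-- If `u` has at least as many chips as would leave it towards `p`, a set violating reducedness
consists of everything behind `u` as seen from `p`, together with the points of the edges between
`u` and `p` up to the chip. Each of these edges is left exactly once, at its chip or, if `μ = 0`, at
`u`. -/
theorem redAt_of_isReduced (hT : G.IsMultitree) {v : G.V}
    (h : MGraph.IsReduced (G := G.subdivision n) (.inl v) w.divisor) {u : G.V} (huv : u ≠ v) :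
    w.RedAt v u := by
  classical
  have hnn : ∀ x, x ≠ v → 0 ≤ w.vert x := fun x hx => h.1 (.inl x) (fun h => hx (Sum.inl.inj h))
  refine ⟨hnn u huv, ?_⟩
  by_contra! hlt
  set p := nxt G.bar u v with hp
  have hup : G.bar.Adj u p := nxt_adj hT huv
  rw [outflow_one] at hlt
  -- The vertices behind `u` as seen from `p`, including `u` itself, because `nxt` takes the default
  -- value `u` at `u`.
  let B : Set G.V := {x | nxt G.bar u x ≠ p}
  have huB : u ∈ B := by
    have h1 : nxt G.bar u u = u := by
      unfold nxt
      rw [dif_neg]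
      rintro ⟨y, -, hy⟩
      rw [SimpleGraph.dist_self] at hy
      omega
    change nxt G.bar u u ≠ p
    rw [h1]
    exact hup.ne
  have hpB : p ∉ B := fun h => h (nxt_eq_of_adj hT hup)
  have hvB : v ∉ B := fun h => h rfl
  have hcross : ∀ {x y}, G.bar.Adj x y → x ∈ B → y ∉ B → x = u ∧ y = p := by
    intro x y hxy hx hy
    have hyu : y ≠ u := fun h => hy (h ▸ huB)
    have hxu : x = u := by
      by_contra hxu
      apply hy
      change nxt G.bar u y ≠ p
      rw [← nxt_congr hT (Ne.symm hxu) (Ne.symm hyu) hxy]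
      exact hx
    subst hxu
    refine ⟨rfl, ?_⟩
    have : nxt G.bar x y = p := not_not.mp hy
    rw [← this, nxt_eq_of_adj hT hxy]
  -- The coordinate, counted from the tail, of the last point of `S` on an edge between `u` and `p`.
  -- If `μ = 0` this point is `u`, whose coordinate is `n e` rather than `0` when `u` is the head.
  let q : G.E → ℕ := fun e => if G.tail e = u then (w.edge e).val else
    if (w.edge e).val = 0 then n e else (w.edge e).val
  let I : G.E → ℕ → Prop := fun e k => if G.Joins e u p then
    (if G.tail e = u then k ≤ q e else q e ≤ k) else G.tail e ∈ B
  let S : Set (G.V ⊕ (Σ e : G.E, Fin (n e - 1))) :=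
    {x | Sum.elim (fun x => x ∈ B) (fun x => I x.1 (x.2 + 1)) x}
  have hIS : ∀ (e : G.E) (k : ℕ), k ≤ n e → (chainVertex n e k ∈ S ↔ I e k) := by
    intro e k hk
    have hlt := w.val_lt e
    rcases chainVertex_cases e hk with rfl | rfl | ⟨i, rfl⟩
    · rw [chainVertex_zero]
      change G.tail e ∈ B ↔ _
      simp only [I, q]
      split_ifs with h1 h2 h3
      · simp [h2, huB]
      · rcases h1 with h1 | h1
        · exact absurd h1.1 h2
        · rw [h1.1]
          simp [hpB]
      · rcases h1 with h1 | h1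
        · exact absurd h1.1 h2
        · rw [h1.1]
          simp [hpB, h3]
      · rfl
    · rw [chainVertex_len]
      change G.head e ∈ B ↔ _
      simp only [I, q]
      split_ifs with h1 h2 h3
      · rcases h1 with h1 | h1
        · rw [h1.2]
          simp [hpB, hlt]
        · exact absurd (h1.1.symm.trans h2) hup.ne'
      · rcases h1 with h1 | h1
        · exact absurd h1.1 h2
        · rw [h1.2]
          simp [huB]
      · rcases h1 with h1 | h1
        · exact absurd h1.1 h2
        · rw [h1.2]
          simp [huB, hlt.le]
      · have hadj : G.bar.Adj (G.tail e) (G.head e) := (joins_tail_head e).adj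
        by_cases h2 : G.tail e ∈ B <;> by_cases h3 : G.head e ∈ B <;> simp only [h2, h3]
        · have h4 := hcross hadj h2 h3
          exact absurd (Or.inl h4) h1
        · have h4 := hcross hadj.symm h3 h2
          exact absurd (Or.inr ⟨h4.2, h4.1⟩) h1
    · rw [chainVertex_succ]
      rfl
  have hq : ∀ e, q e ≤ n e := by
    intro e
    have hlt := w.val_lt e
    simp only [q]
    split_ifs <;> omega
  obtain ⟨s, hsS, hs⟩ := h.2 S ⟨.inl u, huB⟩ hvB
  -- An edge of the subdivision that leaves `S` at `s` lies over an edge between `u` and `p` whose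
  -- cut is at `s`, and its index on that edge is determined by `q`. So the edges leaving `S` at `s`
  -- inject into the edges cut at `s`.
  have hkey : ∀ (x : (G.subdivision n).E) y, y ∉ S → (G.subdivision n).Joins x s y →
      (G.Joins x.1 u p ∧ chainVertex n x.1 (q x.1) = s) ∧
      (x.2 : ℕ) + (if G.tail x.1 = u then 0 else 1) = q x.1 := by
    rintro ⟨e, i⟩ y hy hj
    have hi := i.2
    have h1 := hIS e i (by omega)
    have h2 := hIS e (i + 1) (by omega)
    have hj' : (chainVertex n e i = s ∧ chainVertex n e (i + 1) = y) ∨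
      (chainVertex n e i = y ∧ chainVertex n e (i + 1) = s) := hj
    have h3 : G.Joins e u p := by
      by_contra h3
      simp only [I, if_neg h3] at h1 h2
      rcases hj' with ⟨h4, h5⟩ | ⟨h4, h5⟩ <;> rw [h4] at h1 <;> rw [h5] at h2 <;> tauto
    simp only [I, if_pos h3] at h1 h2
    refine ⟨⟨h3, ?_⟩, ?_⟩
    · rcases hj' with ⟨h4, h5⟩ | ⟨h4, h5⟩ <;> rw [h4] at h1 <;> rw [h5] at h2 <;>
        split_ifs at h1 h2 with h6
      · have : q e = i := by
          have := h1.mp hsS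
          have := mt h2.mpr hy
          omega
        rw [this, h4]
      · have := h1.mp hsS
        have := mt h2.mpr hy
        omega
      · have := h2.mp hsS
        have := mt h1.mpr hy
        omega
      · have : q e = i + 1 := by
          have := h2.mp hsS
          have := mt h1.mpr hy
          omega
        rw [this, h5]
    · dsimp only
      rcases hj' with ⟨h4, h5⟩ | ⟨h4, h5⟩ <;> rw [h4] at h1 <;> rw [h5] at h2 <;>
        split_ifs at h1 h2 ⊢ with h6
      · have := h1.mp hsS
        have := mt h2.mpr hy
        omega
      · have := h1.mp hsS
        have := mt h2.mpr hy
        omega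
      · have := h2.mp hsS
        have := mt h1.mpr hy
        omega
      · have := h2.mp hsS
        have := mt h1.mpr hy
        omega
  have hcard : {x : (G.subdivision n).E | ∃ y, y ∉ S ∧ (G.subdivision n).Joins x s y}.ncard ≤
      {e | G.Joins e u p ∧ chainVertex n e (q e) = s}.ncard := by
    refine Set.ncard_le_ncard_of_injOn (fun x => x.1) ?_ ?_ (Set.toFinite _)
    · rintro x ⟨y, hy, hj⟩
      exact (hkey x y hy hj).1
    · rintro ⟨e, i⟩ ⟨y, hy, hj⟩ ⟨e', i'⟩ ⟨y', hy', hj'⟩ hee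
      obtain rfl : e = e' := hee
      have h1 := (hkey _ y hy hj).2
      have h2 := (hkey _ y' hy' hj').2
      dsimp only at h1 h2
      obtain rfl : i = i' := Fin.ext (by omega)
      rfl
  have hsv : ∀ e, G.Joins e u p → if w.edge e = 0 then chainVertex n e (q e) = .inl u else
      ∃ i : Fin (n e - 1), chainVertex n e (q e) = .inr ⟨e, i⟩ ∧ (w.edge e).val = i + 1 := by
    intro e hj
    have hlt := w.val_lt e
    have hz := w.val_eq_zero e
    split_ifs with h1
    · rw [← hz] at h1
      simp only [q, h1, if_true]
      rcases hj with hj | hj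
      · rw [if_pos hj.1, chainVertex_zero, hj.1]
      · rw [if_neg, chainVertex_len, hj.2]
        rw [hj.1]
        exact hup.ne'
    · rw [← hz] at h1
      simp only [q, if_neg h1, ite_self]
      refine ⟨⟨(w.edge e).val - 1, by omega⟩, ?_, by simp; omega⟩
      rw [← chainVertex_succ]
      congr 1
      simp
      omega
  refine absurd hs (not_lt.mpr (le_trans (Nat.cast_le.mpr hcard) ?_))
  rcases s with x | ⟨e, i⟩
  · by_cases hx : x = u
    · subst hx
      refine le_trans (Nat.cast_le.mpr (Set.ncard_le_ncard ?_ (Set.toFinite _))) hlt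
      rintro e ⟨h1, h2⟩
      refine ⟨h1, ?_⟩
      by_contra h3
      have h4 := hsv e h1
      rw [if_neg h3] at h4
      obtain ⟨i, h4, -⟩ := h4
      rw [h2] at h4
      exact absurd h4 (by simp)
    · have : {e | G.Joins e u p ∧ chainVertex n e (q e) = Sum.inl x} = ∅ := by
        rw [Set.eq_empty_iff_forall_notMem]
        rintro e ⟨h1, h2⟩
        have h4 := hsv e h1
        split_ifs at h4
        · rw [h2] at h4
          exact hx (Sum.inl.inj h4)
        · obtain ⟨i, h4, -⟩ := h4
          rw [h2] at h4
          exact absurd h4 (by simp)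
      rw [this, Set.ncard_empty]
      refine hnn x ?_
      rintro rfl
      exact hvB hsS
  · have hsub : ∀ e', G.Joins e' u p ∧ chainVertex n e' (q e') = Sum.inr ⟨e, i⟩ →
        e' = e ∧ (w.edge e).val = i + 1 := by
      rintro e' ⟨h1, h2⟩
      have h4 := hsv e' h1
      split_ifs at h4
      · rw [h2] at h4
        exact absurd h4 (by simp)
      · obtain ⟨i', h4, h5⟩ := h4
        rw [h2] at h4
        obtain ⟨rfl, h6⟩ := Sigma.mk.inj (Sum.inr.inj h4)
        obtain rfl := eq_of_heq h6
        exact ⟨rfl, h5⟩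
    rw [divisor_inr]
    split_ifs with h1
    · have : ({e' | G.Joins e' u p ∧ chainVertex n e' (q e') = Sum.inr ⟨e, i⟩}.ncard) ≤ 1 := by
        rw [Set.ncard_le_one (Set.toFinite _)]
        intro a ha b hb
        rw [(hsub a ha).1, (hsub b hb).1]
      exact_mod_cast this
    · have : {e' | G.Joins e' u p ∧ chainVertex n e' (q e') = Sum.inr ⟨e, i⟩} = ∅ := by
        rw [Set.eq_empty_iff_forall_notMem]
        intro e' he'
        exact h1 (hsub e' he').2
      rw [this, Set.ncard_empty]
      rfl

end Multidegree
end MGraph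

end

/-! ## Reduced tuples are tight -/

noncomputable section

namespace MGraph

variable {G : MGraph.{u}} {n : G.ChainStructure}

namespace Multidegree

open LimitLinear.Tree

theorem isReduced_iff (hT : G.IsMultitree) {v : G.V} {w : Multidegree G n} :
    MGraph.IsReduced (G := G.subdivision n) (.inl v) w.divisor ↔ ∀ u, u ≠ v → w.RedAt v u :=
  ⟨fun h _ hu => redAt_of_isReduced hT h hu, isReduced_of_redAt hT⟩

/-- Proceeding from the leaves, the pushes behind `u` are already fixed, and the push from `u`
towards `v` must remove as many chips as possible while keeping the coefficient nonnegative. The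
pushes are then integrated to a function `c`. -/
theorem exists_act_redAt (hT : G.IsMultitree) (v : G.V) (w : Multidegree G n) :
    ∃ c : G.V → ℤ, ∀ u, u ≠ v → (act (cob c) w).RedAt v u := by
  classical
  -- The coefficient at `u` after the pushes on all edges not leading towards `v`. Here `k y = c y -
  -- c u` for `y` behind `u`, whence the sign.
  let A : G.V → (G.V → ℤ) → ℤ := fun u k => w.vert u -
    ∑ e, if h : ∃ y, G.Joins e u y ∧ y ≠ v ∧ nxt G.bar y v = u then
      w.leave e u (- k h.choose) else 0
  have hA : ∀ u k k', (∀ y, y ≠ v → nxt G.bar y v = u → k y = k' y) → A u k = A u k' := by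
    intro u k k' h
    simp only [A]
    congr 1
    refine Finset.sum_congr rfl fun e _ => ?_
    split_ifs with he
    · rw [h _ he.choose_spec.2.1 he.choose_spec.2.2]
    · rfl
  let Φ : G.V → (G.V → ℤ) → ℤ := fun u k =>
    if h : u ≠ v then (w.exists_outflow (nxt_adj hT h) (A u k)).choose else 0
  obtain ⟨k, hk⟩ := exists_fixed hT v Φ fun u k k' h => by simp only [Φ, hA u k k' h]
  obtain ⟨c, hc⟩ := exists_potential hT v fun u _ => k u
  refine ⟨c, fun u hu => ?_⟩
  have h1 : c u - c (nxt G.bar u v) = k u := by rw [hc u hu]; ring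
  have h2 := (w.exists_outflow (nxt_adj hT hu) (A u k)).choose_spec
  have h3 : k u = (w.exists_outflow (nxt_adj hT hu) (A u k)).choose := by
    rw [hk u hu]; simp only [Φ]; rw [dif_pos hu]
  rw [← h3] at h2
  have h4 : (act (cob c) w).vert u = A u k - w.outflow u (nxt G.bar u v) (k u) := by
    rw [vert_act_cob w c u (nxt G.bar u v), h1]
    simp only [A]
    rw [sub_right_comm]
    congr 2
    refine Finset.sum_congr rfl fun e _ => ?_
    by_cases he : ∃ y, G.Joins e u y ∧ y ≠ v ∧ nxt G.bar y v = u
    · rw [dif_pos he]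
      obtain ⟨h5, h6, h7⟩ := he.choose_spec
      have h8 : ¬ G.Joins e u (nxt G.bar u v) := fun h8 =>
        not_nxt_and hT ⟨hu, h8.eq h5⟩ ⟨h6, h7⟩
      rw [if_pos ⟨h5.inc, h8⟩, h5.sign_mul_cob]
      congr 1
      have := hc _ h6
      rw [h7] at this
      omega
    · rw [dif_neg he, if_neg]
      rintro ⟨h5, h6⟩
      obtain ⟨y, hy⟩ := h5.exists_joins
      rcases nxt_eq_or hT hy.adj v with h7 | h7
      · exact h6 (h7.2 ▸ hy)
      · exact he ⟨y, hy, h7⟩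
  unfold RedAt
  rw [h4, outflow_act, h1]
  omega

/-- By induction nothing moves behind `u`. With `k = c u - c (nxt u)`, nonnegativity after the push
together with the upper bound before it gives `k < 1`, and exchanging the roles gives `k > -1`. The
set `U` is closed under moving away from `v`, so the induction stays inside it. -/
theorem eq_nxt_of_redAt (hT : G.IsMultitree) {v : G.V} {w : Multidegree G n} {c : G.V → ℤ}
    {U : Set G.V} (hv : v ∉ U) (hU : ∀ y, y ≠ v → nxt G.bar y v ∈ U → y ∈ U)
    (h : ∀ u ∈ U, w.RedAt v u) (h' : ∀ u ∈ U, (act (cob c) w).RedAt v u) :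
    ∀ u ∈ U, c u = c (nxt G.bar u v) := by
  have : ∀ u, u ≠ v → u ∈ U → c u = c (nxt G.bar u v) := by
    refine leaf_induction hT v fun u hu ih huU => ?_
    obtain ⟨h1, h2⟩ := h u huU
    obtain ⟨h3, h4⟩ := h' u huU
    rw [outflow_act] at h4
    rw [vert_act_cob w c u (nxt G.bar u v), Finset.sum_eq_zero, sub_zero] at h3 h4
    · set k := c u - c (nxt G.bar u v)
      have h5 : k < 1 := (w.outflow_mono u (nxt G.bar u v)).reflect_lt (by omega)
      have h6 : 0 < k + 1 := (w.outflow_mono u (nxt G.bar u v)).reflect_lt (by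
        rw [outflow_zero]; omega)
      omega
    all_goals
      intro e _
      split_ifs with he
      · obtain ⟨y, hy⟩ := he.1.exists_joins
        rcases nxt_eq_or hT hy.adj v with h7 | h7
        · exact absurd (h7.2 ▸ hy) he.2
        · have h8 := ih y h7.1 h7.2 (hU y h7.1 (h7.2 ▸ huU))
          rw [h7.2] at h8
          rw [hy.sign_mul_cob, h8, sub_self, leave_zero]
      · rfl
  exact fun u hu => this u (fun h => hv (h ▸ hu)) hu

theorem redAt_unique (hT : G.IsMultitree) {v : G.V} {w : Multidegree G n} {c : G.V → ℤ}
    (h : ∀ u, u ≠ v → w.RedAt v u) (h' : ∀ u, u ≠ v → (act (cob c) w).RedAt v u) :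
    cob c = 0 := by
  have h1 := eq_nxt_of_redAt hT (U := {v}ᶜ) (by simp)
    (fun y hy _ => hy) (fun u hu => h u hu) fun u hu => h' u hu
  ext e
  have h2 := joins_tail_head e
  simp only [cob, Pi.zero_apply, sub_eq_zero]
  rcases nxt_eq_or hT h2.adj v with h3 | h3
  · rw [h1 _ h3.1, h3.2]
  · rw [h1 _ h3.1, h3.2]

theorem reaches_equivalence {w₀ w w' : Multidegree G n} (h : Reaches w₀ w) (h' : Reaches w₀ w') :
    ∃ c : G.V → ℤ, w' = act (cob c) w := by
  rw [reaches_iff] at h h'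
  obtain ⟨c, rfl⟩ := h
  obtain ⟨c', rfl⟩ := h'
  refine ⟨c' - c, ?_⟩
  rw [act_act, ← cob_add, add_sub_cancel]

theorem exists_isReducedTuple (hT : G.IsMultitree) (w₀ : Multidegree G n) :
    ∃ w, IsReducedTuple w₀ w := by
  choose c hc using fun v => exists_act_redAt hT v w₀
  exact ⟨fun v => act (cob (c v)) w₀, fun v => ⟨(reaches_iff _ _).mpr ⟨_, rfl⟩,
    (isReduced_iff hT).mpr (hc v)⟩⟩

theorem isReducedTuple_unique (hT : G.IsMultitree) {w₀ : Multidegree G n}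
    {w w' : G.V → Multidegree G n} (h : IsReducedTuple w₀ w) (h' : IsReducedTuple w₀ w') :
    w' = w := by
  ext1 v
  obtain ⟨c, hc⟩ := reaches_equivalence (h v).1 (h' v).1
  have h1 := (isReduced_iff hT).mp (h v).2
  have h2 := (isReduced_iff hT).mp (h' v).2
  rw [hc] at h2
  rw [hc, redAt_unique hT h1 h2, act_zero]

theorem redAt_congr (hT : G.IsMultitree) {w : Multidegree G n} {v v' u : G.V}
    (hv : u ≠ v) (hv' : u ≠ v') (hadj : G.bar.Adj v v') : w.RedAt v u ↔ w.RedAt v' u := by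
  unfold RedAt
  rw [nxt_congr hT hv hv' hadj]

/-- A vertex other than `v` and `v'` has the same next vertex towards both, so the two multidegrees
satisfy the same conditions there; uniqueness applies on the complement of `{v, v'}`. -/
theorem cob_eq_zero_of_adj (hT : G.IsMultitree) {w : Multidegree G n} {v v' : G.V} {c : G.V → ℤ}
    (hadj : G.bar.Adj v v') (h' : ∀ u, u ≠ v' → w.RedAt v' u)
    (h : ∀ u, u ≠ v → (act (cob c) w).RedAt v u) {e : G.E} (he : ¬ G.Joins e v v') :
    cob c e = 0 := by
  have h1 := eq_nxt_of_redAt hT (v := v) (w := w) (c := c) (U := {u | u ≠ v ∧ u ≠ v'})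
    (fun h => h.1 rfl) (fun y hy hyU => ⟨hy, fun h2 => hyU.1 (by
      rw [h2, nxt_eq_of_adj hT hadj.symm])⟩)
    (fun u hu => (redAt_congr hT hu.1 hu.2 hadj).mpr (h' u hu.2)) fun u hu => h u hu.1
  have key : ∀ x y, G.Joins e x y → x ≠ v ∧ nxt G.bar x v = y → c x = c y := by
    intro x y hj hxy
    by_cases hx : x = v'
    · subst hx
      rw [nxt_eq_of_adj hT hadj.symm] at hxy
      rw [← hxy.2] at hj
      exact absurd hj.symm he
    · rw [h1 x ⟨hxy.1, hx⟩, hxy.2]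
  have h2 := joins_tail_head e
  simp only [cob, sub_eq_zero]
  rcases nxt_eq_or hT h2.adj v with h3 | h3
  · exact key _ _ h2 h3
  · exact (key _ _ h2.symm h3).symm

open Classical in
theorem edgeTwist_iterate (w : Multidegree G n) (v₁ v₂ : G.V) (b : ℕ) :
    (fun w ↦ edgeTwist w v₂ v₁)^[b] w =
      act (fun e => if G.Joins e v₂ v₁ then sign e v₂ * b else 0) w := by
  have h1 : (fun w : Multidegree G n ↦ edgeTwist w v₂ v₁) =
      act fun e => if G.Joins e v₂ v₁ then sign e v₂ else 0 := by
    ext1 w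
    rw [edgeTwist, twistAlong_eq]
    congr 1
    ext e
    simp only [Set.mem_ofPred_eq]
    by_cases h : G.Joins e v₂ v₁
    · simp [h, h.inc]
    · simp [h]
  rw [h1, act_iterate]
  congr 1
  ext e
  simp only [Pi.smul_apply, nsmul_eq_mul]
  split_ifs
  · ring
  · simp

/-- The position on one edge joining `v` and `v'` fixes the number of twists modulo the length. A
full turn sends one more chip along that edge, so the coefficient at `v'` excludes any further
turns. -/
theorem isTwistCount_iff {w w' : Multidegree G n} {v v' : G.V} {c : G.V → ℤ}
    (hadj : G.bar.Adj v v') (hw : w = act (cob c) w')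
    (hc : ∀ e, ¬ G.Joins e v v' → cob c e = 0) (b : ℕ) :
    IsTwistCount w w' v v' b ↔ (b : ℤ) = c v' - c v := by
  classical
  have h0 : act (cob c) w' =
      act (fun e => if G.Joins e v' v then sign e v' * (c v' - c v) else 0) w' := by
    congr 1
    ext e
    split_ifs with he
    · rw [← he.sign_mul_cob, ← mul_assoc, sign_mul_self, one_mul]
    · exact hc e fun h => he h.symm
  unfold IsTwistCount
  rw [edgeTwist_iterate, hw, h0]
  set x := c v' - c v
  refine ⟨fun h => ?_, fun h => by rw [h]⟩
  obtain ⟨e, he⟩ := hadj.symm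
  have h1 := congrArg (fun w => Multidegree.edge w e) h
  simp only [act, if_pos he, add_right_inj] at h1
  have h2 : ((x : ℤ) : ZMod (n e)) = ((b : ℤ) : ZMod (n e)) := by
    rcases sign_eq e v' with h3 | h3 <;> rw [h3] at h1 <;> simpa using h1
  rw [ZMod.intCast_eq_intCast_iff_dvd_sub] at h2
  obtain ⟨k, hk⟩ := h2
  have h3 := congrArg (fun w => Multidegree.vert w v') h
  simp only [act, sub_right_inj] at h3
  have h4 : w'.outflow v' v x = w'.outflow v' v b := by
    have h5 : ∀ y : ℤ, w'.outflow v' v y = ∑ e, if G.Inc e v' then w'.leave e v'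
        (sign e v' * if G.Joins e v' v then sign e v' * y else 0) else 0 := by
      intro y
      refine Finset.sum_congr rfl fun e _ => ?_
      by_cases he : G.Joins e v' v
      · simp only [he, he.inc, if_true]
        rw [← mul_assoc, sign_mul_self, one_mul]
      · simp [he, leave_zero]
    rw [h5, h5, h3]
  have hle : ∀ y z : ℤ, y ≤ z → w'.outflow v' v y = w'.outflow v' v z →
      w'.leave e v' y = w'.leave e v' z := by
    intro y z hyz h
    have h6 := (Finset.sum_eq_sum_iff_of_le (s := Finset.univ)
      (f := fun e => if G.Joins e v' v then w'.leave e v' y else 0)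
      (g := fun e => if G.Joins e v' v then w'.leave e v' z else 0) (fun e _ => by
        split_ifs
        · exact w'.leave_mono e v' hyz
        · rfl)).mp h e (Finset.mem_univ e)
    simpa [he] using h6
  have h7 : w'.leave e v' x = w'.leave e v' b := by
    rcases le_total x b with h | h
    · exact hle _ _ h h4
    · exact (hle _ _ h h4.symm).symm
  have h8 := w'.leave_add_mul e v' x k
  have h9 : x + (n e : ℤ) * k = b := by
    have : (((n e : ℕ) : ℤ)) * k = b - x := hk.symm
    have h10 : (((n e : ℕ) : ℤ)) = ((n e : ℕ+) : ℤ) := rfl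
    rw [h10] at this
    omega
  rw [h9] at h8
  have hk0 : k = 0 := by omega
  rw [hk0] at h9
  omega

/-- A negative number would push at least once from `v` towards `v'`, and `w'` being reduced at `v`
would then make the coefficient at `v` negative. -/
theorem twistCount_nonneg {w' : Multidegree G n} {v v' : G.V} {c : G.V → ℤ}
    (hT : G.IsMultitree) (hadj : G.bar.Adj v v') (h' : w'.RedAt v' v)
    (hc : ∀ e, ¬ G.Joins e v v' → cob c e = 0) (hpos : 0 ≤ (act (cob c) w').vert v) :
    0 ≤ c v' - c v := by
  rw [vert_act_cob w' c v v', Finset.sum_eq_zero, sub_zero] at hpos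
  · have h1 := h'.2
    rw [nxt_eq_of_adj hT hadj] at h1
    have h2 : c v - c v' < 1 := (w'.outflow_mono v v').reflect_lt (by omega)
    omega
  · intro e _
    split_ifs with h
    · rw [hc e h.2, mul_zero, leave_zero]
    · rfl

theorem twistCount_eq {w : G.V → Multidegree G n} {v v' : G.V} {c : G.V → ℤ}
    (hadj : G.bar.Adj v v') (hw : w v = act (cob c) (w v'))
    (hc : ∀ e, ¬ G.Joins e v v' → cob c e = 0) (hb : 0 ≤ c v' - c v) :
    (twistCount w v v' : ℤ) = c v' - c v := by
  have h : {b | IsTwistCount (w v) (w v') v v' b} = {(c v' - c v).toNat} := by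
    ext b
    change IsTwistCount (w v) (w v') v v' b ↔ b = _
    rw [isTwistCount_iff hadj hw hc]
    omega
  unfold twistCount
  rw [h, csInf_singleton]
  omega

open Classical in
theorem foldl_twist (p : List G.V) (w : Multidegree G n) :
    p.foldl (fun a y ↦ a.twist y) w = act (cob fun y => (p.count y : ℤ)) w := by
  induction p generalizing w with
  | nil =>
    simp only [List.foldl_nil, List.count_nil]
    rw [cob_const, act_zero]
  | cons a p ih =>
    rw [List.foldl_cons, ih, twist_eq, act_act, ← cob_add]
    congr 2
    ext y
    rw [List.count_cons]
    simp only [Pi.add_apply, Pi.single_apply, beq_iff_eq]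
    by_cases h : y = a
    · subst h; simp [add_comm]
    · simp [h, Ne.symm h]

/-- The ordering is by distance from `v`. Inverting the twists at the vertices before `x` pulls one
step from `x` towards `v` and affects no edge behind `x`; reducedness says that this removes more
chips than `x` has. -/
theorem isConcentrated_of_redAt (hT : G.IsMultitree) {v : G.V} {w : Multidegree G n}
    (h : ∀ u, u ≠ v → w.RedAt v u) : w.IsConcentrated v := by
  classical
  obtain ⟨l, hnd, hmem, hhead, hl⟩ := exists_bfs_list hT v
  refine ⟨l, hnd, hmem, hhead, fun p x s hps hp => ?_⟩
  refine ⟨act (cob (-fun y => (p.count y : ℤ))) w, ?_, ?_⟩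
  · rw [foldl_twist, act_act, ← cob_add, neg_add_cancel]
    rw [show cob (G := G) (0 : G.V → ℤ) = 0 from cob_const 0, act_zero]
  obtain ⟨h1, h2⟩ := hl p x s hps
  rw [hps, List.nodup_append] at hnd
  have hxp : x ∉ p := fun hx => hnd.2.2 x hx x (by simp) rfl
  have hxv : x ≠ v := by
    rintro rfl
    rw [hps] at hhead
    cases p with
    | nil => exact hp rfl
    | cons a p =>
      have : a = x := by simpa using hhead
      exact hxp (by simp [this])
  have hpx : nxt G.bar x v ∈ p := h2 _ (by have := (nxt_spec hT hxv).2; omega)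
  have h3 : (p.count x : ℤ) = 0 := by rw [List.count_eq_zero_of_not_mem hxp]; rfl
  have h4 : (p.count (nxt G.bar x v) : ℤ) = 1 := by
    rw [List.count_eq_one_of_mem hnd.1 hpx]; rfl
  rw [vert_act_cob _ _ x (nxt G.bar x v), Finset.sum_eq_zero]
  · simp only [Pi.neg_apply, h3, h4]
    have := (h x hxv).2
    norm_num
    omega
  · intro e _
    split_ifs with he
    · obtain ⟨y, hy⟩ := he.1.exists_joins
      rcases nxt_eq_or hT hy.adj v with h7 | h7
      · exact absurd (h7.2 ▸ hy) he.2
      · have hyp : y ∉ p := fun hyp => by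
          have h5 := h1 y hyp
          have h6 := (nxt_spec hT h7.1).2
          rw [h7.2] at h6
          omega
        rw [hy.sign_mul_cob, Pi.neg_apply, Pi.neg_apply, List.count_eq_zero_of_not_mem hyp,
          List.count_eq_zero_of_not_mem hxp, sub_self, leave_zero]
    · rfl

theorem isTight_of_isReducedTuple (hT : G.IsMultitree) {w₀ : Multidegree G n}
    {w : G.V → Multidegree G n} (h : IsReducedTuple w₀ w) (hpos : ∀ v, 0 ≤ (w v).vert v) :
    IsTight w := by
  have hred := fun v => (isReduced_iff hT).mp (h v).2
  refine ⟨fun v => isConcentrated_of_redAt hT (hred v), fun v v' hadj => ?_⟩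
  obtain ⟨c, hc⟩ := reaches_equivalence (h v').1 (h v).1
  have h1 : ∀ e, ¬ G.Joins e v v' → cob c e = 0 := fun e he =>
    cob_eq_zero_of_adj hT hadj (hred v') (hc ▸ hred v) he
  have h2 := twistCount_nonneg hT hadj (hred v' v hadj.ne) h1 (hc ▸ hpos v)
  refine ⟨(c v' - c v).toNat, (isTwistCount_iff hadj hc h1 _).mpr (by omega)⟩

end Multidegree
end MGraph

end

noncomputable section

/-! ### Piecewise linear functions on an interval -/

theorem eq_of_eventually_right {g : ℝ → ℝ} {t : ℝ} {m m' : ℤ}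
    (h : ∀ᶠ s in 𝓝[>] t, g s = g t + m * (s - t))
    (h' : ∀ᶠ s in 𝓝[>] t, g s = g t + m' * (s - t)) : m = m' := by
  obtain ⟨s, ⟨h1, h2⟩, h3⟩ := ((h.and h').and self_mem_nhdsWithin).exists
  have h4 : (0 : ℝ) < s - t := sub_pos.mpr h3
  have h5 : (m : ℝ) * (s - t) = m' * (s - t) := by linarith
  exact_mod_cast mul_right_cancel₀ h4.ne' h5

theorem eq_of_eventually_left {g : ℝ → ℝ} {t : ℝ} {m m' : ℤ}
    (h : ∀ᶠ s in 𝓝[<] t, g s = g t + m * (t - s))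
    (h' : ∀ᶠ s in 𝓝[<] t, g s = g t + m' * (t - s)) : m = m' := by
  obtain ⟨s, ⟨h1, h2⟩, h3⟩ := ((h.and h').and self_mem_nhdsWithin).exists
  have h4 : (0 : ℝ) < t - s := sub_pos.mpr h3
  have h5 : (m : ℝ) * (t - s) = m' * (t - s) := by linarith
  exact_mod_cast mul_right_cancel₀ h4.ne' h5

/-- The piecewise linear function of slope `-d` for large `t` whose slope drops by `a y` at `y`. -/
def plFn (d : ℤ) (a : ℝ →₀ ℤ) (t : ℝ) : ℝ := -d * t + a.sum fun y k => k * min t y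

theorem plFn_right (d : ℤ) (a : ℝ →₀ ℤ) (t : ℝ) : ∀ᶠ s in 𝓝[>] t, plFn d a s =
    plFn d a t + ((-d + a.sum fun y k => if t < y then k else 0 : ℤ) : ℝ) * (s - t) := by
  have h : ∀ᶠ s in 𝓝[>] t, ∀ y ∈ a.support,
      min s y = min t y + (if t < y then 1 else 0) * (s - t) := by
    rw [Filter.eventually_all_finset]
    intro y _
    by_cases hy : t < y
    · filter_upwards [self_mem_nhdsWithin, nhdsWithin_le_nhds (Iio_mem_nhds hy)] with s h1 h2
      rw [if_pos hy, min_eq_left (le_of_lt h2), min_eq_left hy.le]; ring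
    · filter_upwards [self_mem_nhdsWithin] with s h1
      have h1' : t < s := h1
      rw [if_neg hy, min_eq_right (by linarith), min_eq_right (by linarith)]; ring
  filter_upwards [h] with s hs
  simp only [plFn, Finsupp.sum]
  push_cast
  rw [add_mul, Finset.sum_mul, Finset.sum_congr rfl fun y hy => by rw [hs y hy]]
  simp only [mul_add, Finset.sum_add_distrib]
  have : ∀ y, (a y : ℝ) * ((if t < y then 1 else 0) * (s - t)) =
      ((if t < y then a y else 0 : ℤ) : ℝ) * (s - t) := by
    intro y; split_ifs <;> simp
  simp only [this]
  push_cast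
  ring

theorem plFn_left (d : ℤ) (a : ℝ →₀ ℤ) (t : ℝ) : ∀ᶠ s in 𝓝[<] t, plFn d a s =
    plFn d a t + ((d - a.sum fun y k => if t ≤ y then k else 0 : ℤ) : ℝ) * (t - s) := by
  have h : ∀ᶠ s in 𝓝[<] t, ∀ y ∈ a.support,
      min s y = min t y - (if t ≤ y then 1 else 0) * (t - s) := by
    rw [Filter.eventually_all_finset]
    intro y _
    by_cases hy : t ≤ y
    · filter_upwards [self_mem_nhdsWithin] with s h1
      have h1' : s < t := h1
      rw [if_pos hy, min_eq_left (by linarith), min_eq_left hy]; ring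
    · filter_upwards [self_mem_nhdsWithin, nhdsWithin_le_nhds (Ioi_mem_nhds (not_le.mp hy))]
        with s h1 h2
      rw [if_neg hy, min_eq_right (le_of_lt h2), min_eq_right (le_of_not_ge hy)]; ring
  filter_upwards [h] with s hs
  simp only [plFn, Finsupp.sum]
  push_cast
  rw [sub_mul, Finset.sum_mul, Finset.sum_congr rfl fun y hy => by rw [hs y hy]]
  simp only [mul_sub, Finset.sum_sub_distrib]
  have : ∀ y, (a y : ℝ) * ((if t ≤ y then 1 else 0) * t - (if t ≤ y then 1 else 0) * s) =
      ((if t ≤ y then a y else 0 : ℤ) : ℝ) * (t - s) := by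
    intro y; split_ifs <;> simp
  have h2 : ∑ x ∈ a.support, (a x : ℝ) * ((if t ≤ x then 1 else 0) * t) -
      ∑ x ∈ a.support, (a x : ℝ) * ((if t ≤ x then 1 else 0) * s) =
      ∑ x ∈ a.support, ((if t ≤ x then a x else 0 : ℤ) : ℝ) * (t - s) := by
    rw [← Finset.sum_sub_distrib]
    exact Finset.sum_congr rfl fun y _ => by rw [← this]; ring
  simp only [mul_sub, Finset.sum_sub_distrib] at h2
  push_cast at h2 ⊢
  linarith

theorem plFn_zero {d : ℤ} {a : ℝ →₀ ℤ} (ha : ∀ y ∈ a.support, 0 ≤ y) : plFn d a 0 = 0 := by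
  rw [plFn, mul_zero, zero_add]
  exact Finset.sum_eq_zero fun y hy => by dsimp only; rw [min_eq_left (ha y hy), mul_zero]

theorem plFn_of_le {d : ℤ} {a : ℝ →₀ ℤ} {x : ℝ} (ha : ∀ y ∈ a.support, y ≤ x) :
    plFn d a x = -d * x + a.sum fun y k => k * y := by
  rw [plFn]
  congr 1
  exact Finset.sum_congr rfl fun y hy => by dsimp only; rw [min_eq_right (ha y hy)]

/-- Nonnegative sums of outgoing slopes mean that the right slopes are nondecreasing, so `g` lies
above its tangent line at `0`. -/
theorem le_of_convex {g : ℝ → ℝ} {b : ℝ} (hb : 0 < b) {r l : ℝ → ℤ}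
    (hr : ∀ t ∈ Set.Ico 0 b, ∀ᶠ s in 𝓝[>] t, g s = g t + r t * (s - t))
    (hl : ∀ t ∈ Set.Ioc 0 b, ∀ᶠ s in 𝓝[<] t, g s = g t + l t * (t - s))
    (h : ∀ t ∈ Set.Ioo 0 b, 0 ≤ r t + l t) : g 0 + r 0 * b ≤ g b := by
  have hr' : ∀ t ∈ Set.Ico 0 b, ∀ᶠ x in 𝓝[>] t, x ∈ Set.Ico 0 b → r x = r t := by
    intro t ht
    have h1 := hr t ht
    filter_upwards [eventually_eventually_nhdsWithin.mpr h1, h1, self_mem_nhdsWithin]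
      with x hx hx2 hx3 hx4
    have hx3' : t < x := hx3
    refine eq_of_eventually_right (hr x hx4) ?_
    filter_upwards [nhdsWithin_mono x (Set.Ioi_subset_Ioi hx3'.le) hx] with s hs
    have hs' : g s = g t + r t * (s - t) := hs
    rw [hs', hx2]; ring
  have hl' : ∀ t ∈ Set.Ioc 0 b, ∀ᶠ x in 𝓝[<] t, x ∈ Set.Ico 0 b → r x = - l t := by
    intro t ht
    have h1 := hl t ht
    filter_upwards [eventually_eventually_nhdsWithin.mpr h1, h1, self_mem_nhdsWithin]
      with x hx hx2 hx3 hx4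
    refine eq_of_eventually_right (hr x hx4) ?_
    rw [IsOpen.nhdsWithin_eq isOpen_Iio hx3] at hx
    filter_upwards [nhdsWithin_le_nhds hx] with s hs
    rw [hs, hx2]; push_cast; ring
  have hmono : ∀ t ∈ Set.Ico 0 b, r 0 ≤ r t := by
    by_contra! hex
    obtain ⟨t₁, ht₁, hlt₁⟩ := hex
    let B : Set ℝ := {t | t ∈ Set.Ico 0 b ∧ r t < r 0}
    have hBn : B.Nonempty := ⟨t₁, ht₁, hlt₁⟩
    have hBb : BddBelow B := ⟨0, fun t ht => ht.1.1⟩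
    -- At `z` itself the slope is at least `r 0`: otherwise the slope just before `z` would be
    -- smaller still, producing points of `B` below `z`. But the slope is constant just after `z`,
    -- where there must be points of `B`.
    set z := sInf B with hz
    have hz0 : 0 ≤ z := le_csInf hBn fun t ht => ht.1.1
    have hzb : z < b := lt_of_le_of_lt (csInf_le hBb ⟨ht₁, hlt₁⟩) ht₁.2
    have hge : r 0 ≤ r z := by
      by_contra! hlt
      have hzpos : 0 < z := by
        rcases hz0.eq_or_lt with h0 | h0
        · rw [← h0] at hlt; exact absurd hlt (lt_irrefl _)
        · exact h0
      have h1 := h z ⟨hzpos, hzb⟩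
      obtain ⟨x, ⟨hx1, hx2⟩, hx3⟩ := (((hl' z ⟨hzpos, hzb.le⟩).and
        (nhdsWithin_le_nhds (Ioi_mem_nhds hzpos))).and self_mem_nhdsWithin).exists
      have hx3' : x < z := hx3
      have hx2' : 0 < x := hx2
      have hxI : x ∈ Set.Ico 0 b := ⟨hx2'.le, by linarith⟩
      have h2 := hx1 hxI
      have h3 : x ∈ B := ⟨hxI, by omega⟩
      have h4 := csInf_le hBb h3
      linarith
    have h1 := hr' z ⟨hz0, hzb⟩
    rw [eventually_nhdsWithin_iff, Metric.eventually_nhds_iff] at h1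
    obtain ⟨ε, hε, h1⟩ := h1
    obtain ⟨x, hxB, hx⟩ := exists_lt_of_csInf_lt hBn (show sInf B < z + ε by linarith)
    have hzx : z ≤ x := csInf_le hBb hxB
    rcases hzx.eq_or_lt with h2 | h2
    · rw [h2] at hge; exact absurd hxB.2 (not_lt.mpr hge)
    · have h3 := h1 (by rw [Real.dist_eq, abs_lt]; constructor <;> linarith) h2 hxB.1
      have := hxB.2
      omega
  have hcont : ContinuousOn g (Set.Icc 0 b) := by
    intro t ht
    have h1 : ContinuousWithinAt g (Set.Icc 0 b ∩ Set.Iio t) t := by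
      by_cases h0 : t = 0
      · subst h0
        have : Set.Icc (0 : ℝ) b ∩ Set.Iio 0 = ∅ := by
          ext x; simp; intro h1 h2; exact h1
        rw [this]
        simp [ContinuousWithinAt]
      · have h2 := hl t ⟨lt_of_le_of_ne ht.1 (Ne.symm h0), ht.2⟩
        have h3 : ContinuousWithinAt (fun s => g t + l t * (t - s)) (Set.Iio t) t := by
          fun_prop
        exact (h3.congr_of_eventuallyEq h2 (by simp)).mono Set.inter_subset_right
    have h2 : ContinuousWithinAt g (Set.Icc 0 b ∩ Set.Ioi t) t := by
      by_cases h0 : t = b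
      · subst h0
        have : Set.Icc (0 : ℝ) t ∩ Set.Ioi t = ∅ := by
          ext x; simp
        rw [this]
        simp [ContinuousWithinAt]
      · have h2 := hr t ⟨ht.1, lt_of_le_of_ne ht.2 h0⟩
        have h3 : ContinuousWithinAt (fun s => g t + r t * (s - t)) (Set.Ioi t) t := by
          fun_prop
        exact (h3.congr_of_eventuallyEq h2 (by simp)).mono Set.inter_subset_right
    have h3 := (h1.union h2).union (continuousWithinAt_singleton (f := g) (x := t))
    refine h3.mono fun x hx => ?_
    rcases lt_trichotomy x t with h | h | h
    · exact Or.inl (Or.inl ⟨hx, h⟩)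
    · exact Or.inr h
    · exact Or.inl (Or.inr ⟨hx, h⟩)
  have hder : ∀ t ∈ Set.Ico 0 b, HasDerivWithinAt g (r t) (Set.Ici t) t := by
    intro t ht
    rw [← hasDerivWithinAt_Ioi_iff_Ici]
    have h1 : HasDerivWithinAt (fun s => g t + r t * (s - t)) (r t) (Set.Ioi t) t := by
      have := (((hasDerivAt_id t).sub_const t).const_mul (r t : ℝ)).const_add (g t)
      simpa using this.hasDerivWithinAt
    exact h1.congr_of_eventuallyEq (hr t ht) (by simp)
  have hB : ∀ x, HasDerivAt (fun x => g 0 + r 0 * x) (r 0 : ℝ) x := fun x => by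
    simpa using ((hasDerivAt_id x).const_mul (r 0 : ℝ)).const_add (g 0)
  have hfin := image_le_of_deriv_right_le_deriv_boundary (f := fun x => g 0 + r 0 * x)
    (f' := fun _ => (r 0 : ℝ)) (a := 0) (b := b) (B := g) (B' := fun t => (r t : ℝ))
    (fun x _ => (hB x).continuousAt.continuousWithinAt)
    (fun x _ => (hB x).hasDerivWithinAt) (by simp) hcont hder
    (fun x hx => by exact_mod_cast hmono x hx)
  exact hfin ⟨hb.le, le_rfl⟩

theorem le_of_convex_rev {g : ℝ → ℝ} {b : ℝ} (hb : 0 < b) {r l : ℝ → ℤ}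
    (hr : ∀ t ∈ Set.Ico 0 b, ∀ᶠ s in 𝓝[>] t, g s = g t + r t * (s - t))
    (hl : ∀ t ∈ Set.Ioc 0 b, ∀ᶠ s in 𝓝[<] t, g s = g t + l t * (t - s))
    (h : ∀ t ∈ Set.Ioo 0 b, 0 ≤ r t + l t) : g b + l b * b ≤ g 0 := by
  have hf : ∀ t, Tendsto (fun s => b - s) (𝓝[>] t) (𝓝[<] (b - t)) := fun t =>
    tendsto_nhdsWithin_of_tendsto_nhds_of_eventually_within _
      ((tendsto_const_nhds.sub tendsto_id).mono_left nhdsWithin_le_nhds)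
      (by filter_upwards [self_mem_nhdsWithin] with s hs; exact sub_lt_sub_left hs b)
  have hf' : ∀ t, Tendsto (fun s => b - s) (𝓝[<] t) (𝓝[>] (b - t)) := fun t =>
    tendsto_nhdsWithin_of_tendsto_nhds_of_eventually_within _
      ((tendsto_const_nhds.sub tendsto_id).mono_left nhdsWithin_le_nhds)
      (by filter_upwards [self_mem_nhdsWithin] with s hs; exact sub_lt_sub_left hs b)
  have := le_of_convex (g := fun s => g (b - s)) hb (r := fun t => l (b - t))
    (l := fun t => r (b - t)) ?_ ?_ ?_
  · simpa using this
  · intro t ht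
    filter_upwards [(hf t).eventually (hl (b - t) ⟨by linarith [ht.2], by linarith [ht.1]⟩)] with s hs
    rw [hs]; ring
  · intro t ht
    filter_upwards [(hf' t).eventually (hr (b - t) ⟨by linarith [ht.2], by linarith [ht.1]⟩)] with s hs
    rw [hs]; ring
  · intro t ht
    rw [add_comm]
    exact h _ ⟨by linarith [ht.2], by linarith [ht.1]⟩

end

/-! ## Rational functions on the metric graph -/

noncomputable section

theorem cl_of_mem {n : ℕ+} {x : ℝ} (h0 : 0 ≤ x) (h1 : x < n) :
    cl n x = if 0 < x then 1 else 0 := by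
  split_ifs with h
  · apply le_antisymm
    · rw [cl_le_iff]; push_cast; linarith
    · rw [show (1 : ℤ) = 0 + 1 by rfl, Int.add_one_le_iff, lt_cl_iff]; simpa using h
  · have : x = 0 := by linarith
    simp [this, cl]

theorem cl_neg_of_mem {n : ℕ+} {x : ℝ} (h0 : 0 ≤ x) (h1 : x < n) : cl n (-x) = 0 := by
  apply le_antisymm
  · rw [cl_le_iff]; push_cast; linarith
  · rw [show (0 : ℤ) = -1 + 1 by rfl, Int.add_one_le_iff, lt_cl_iff]; push_cast; linarith

namespace MGraph

variable {G : MGraph.{u}} {n : G.ChainStructure}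

theorem len_pos (n : G.ChainStructure) (e : G.E) : (0 : ℝ) < n e := by
  exact_mod_cast (n e).pos

namespace RatFn

variable (f g : RatFn G n)

theorem slopeRight_spec {e : G.E} {t : ℝ} (h : t ∈ Set.Ico (0 : ℝ) (n e)) :
    ∀ᶠ s in 𝓝[>] t, f.onEdge e s = f.onEdge e t + f.slopeRight e t * (s - t) := by
  unfold slopeRight
  rw [dif_pos h]
  exact (f.exists_slope_right e t h).choose_spec

theorem slopeLeft_spec {e : G.E} {t : ℝ} (h : t ∈ Set.Ioc (0 : ℝ) (n e)) :
    ∀ᶠ s in 𝓝[<] t, f.onEdge e s = f.onEdge e t + f.slopeLeft e t * (t - s) := by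
  unfold slopeLeft
  rw [dif_pos h]
  exact (f.exists_slope_left e t h).choose_spec

variable {f}

theorem slopeRight_eq {e : G.E} {t : ℝ} (h : t ∈ Set.Ico (0 : ℝ) (n e)) {m : ℤ}
    (hm : ∀ᶠ s in 𝓝[>] t, f.onEdge e s = f.onEdge e t + m * (s - t)) : f.slopeRight e t = m :=
  eq_of_eventually_right (f.slopeRight_spec h) hm

theorem slopeLeft_eq {e : G.E} {t : ℝ} (h : t ∈ Set.Ioc (0 : ℝ) (n e)) {m : ℤ}
    (hm : ∀ᶠ s in 𝓝[<] t, f.onEdge e s = f.onEdge e t + m * (t - s)) : f.slopeLeft e t = m :=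
  eq_of_eventually_left (f.slopeLeft_spec h) hm

theorem zero_mem_Ico (e : G.E) : (0 : ℝ) ∈ Set.Ico (0 : ℝ) (n e) := ⟨le_rfl, len_pos n e⟩

theorem len_mem_Ioc (e : G.E) : (n e : ℝ) ∈ Set.Ioc (0 : ℝ) (n e) := ⟨len_pos n e, le_rfl⟩

theorem slope_tail (e : G.E) : f.slope e (G.tail e) = f.slopeRight e 0 := if_pos rfl

theorem slope_head (e : G.E) : f.slope e (G.head e) = f.slopeLeft e (n e) :=
  if_neg (G.tail_ne_head e)

variable (f)

instance : Add (RatFn G n) where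
  add f g :=
    { onVertex := f.onVertex + g.onVertex
      onEdge := fun e t => f.onEdge e t + g.onEdge e t
      onEdge_tail := fun e => by rw [f.onEdge_tail, g.onEdge_tail]; rfl
      onEdge_head := fun e => by rw [f.onEdge_head, g.onEdge_head]; rfl
      exists_slope_right := fun e t ht => ⟨f.slopeRight e t + g.slopeRight e t, by
        filter_upwards [f.slopeRight_spec ht, g.slopeRight_spec ht] with s h1 h2
        rw [h1, h2]; push_cast; ring⟩
      exists_slope_left := fun e t ht => ⟨f.slopeLeft e t + g.slopeLeft e t, by
        filter_upwards [f.slopeLeft_spec ht, g.slopeLeft_spec ht] with s h1 h2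
        rw [h1, h2]; push_cast; ring⟩ }

instance : Neg (RatFn G n) where
  neg f :=
    { onVertex := -f.onVertex
      onEdge := fun e t => -f.onEdge e t
      onEdge_tail := fun e => by rw [f.onEdge_tail]; rfl
      onEdge_head := fun e => by rw [f.onEdge_head]; rfl
      exists_slope_right := fun e t ht => ⟨-f.slopeRight e t, by
        filter_upwards [f.slopeRight_spec ht] with s h1
        rw [h1]; push_cast; ring⟩
      exists_slope_left := fun e t ht => ⟨-f.slopeLeft e t, by
        filter_upwards [f.slopeLeft_spec ht] with s h1
        rw [h1]; push_cast; ring⟩ }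

theorem onEdge_add (e : G.E) (t : ℝ) : (f + g).onEdge e t = f.onEdge e t + g.onEdge e t := rfl

theorem onEdge_neg (e : G.E) (t : ℝ) : (-f).onEdge e t = -f.onEdge e t := rfl

theorem slopeRight_add (e : G.E) (t : ℝ) :
    (f + g).slopeRight e t = f.slopeRight e t + g.slopeRight e t := by
  by_cases ht : t ∈ Set.Ico (0 : ℝ) (n e)
  · refine slopeRight_eq ht ?_
    filter_upwards [f.slopeRight_spec ht, g.slopeRight_spec ht] with s h1 h2
    rw [onEdge_add, onEdge_add, h1, h2]; push_cast; ring
  · simp [slopeRight, ht]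

theorem slopeLeft_add (e : G.E) (t : ℝ) :
    (f + g).slopeLeft e t = f.slopeLeft e t + g.slopeLeft e t := by
  by_cases ht : t ∈ Set.Ioc (0 : ℝ) (n e)
  · refine slopeLeft_eq ht ?_
    filter_upwards [f.slopeLeft_spec ht, g.slopeLeft_spec ht] with s h1 h2
    rw [onEdge_add, onEdge_add, h1, h2]; push_cast; ring
  · simp [slopeLeft, ht]

theorem slopeRight_neg (e : G.E) (t : ℝ) : (-f).slopeRight e t = -f.slopeRight e t := by
  by_cases ht : t ∈ Set.Ico (0 : ℝ) (n e)
  · refine slopeRight_eq ht ?_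
    filter_upwards [f.slopeRight_spec ht] with s h1
    rw [onEdge_neg, onEdge_neg, h1]; push_cast; ring
  · simp [slopeRight, ht]

theorem slopeLeft_neg (e : G.E) (t : ℝ) : (-f).slopeLeft e t = -f.slopeLeft e t := by
  by_cases ht : t ∈ Set.Ioc (0 : ℝ) (n e)
  · refine slopeLeft_eq ht ?_
    filter_upwards [f.slopeLeft_spec ht] with s h1
    rw [onEdge_neg, onEdge_neg, h1]; push_cast; ring
  · simp [slopeLeft, ht]

theorem slope_add (e : G.E) (v : G.V) : (f + g).slope e v = f.slope e v + g.slope e v := by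
  unfold slope; split_ifs
  · exact slopeRight_add f g e 0
  · exact slopeLeft_add f g e _

theorem slope_neg (e : G.E) (v : G.V) : (-f).slope e v = -f.slope e v := by
  unfold slope; split_ifs
  · exact slopeRight_neg f e 0
  · exact slopeLeft_neg f e _

theorem ordEdge_add (e : G.E) (t : ℝ) : (f + g).ordEdge e t = f.ordEdge e t + g.ordEdge e t := by
  unfold ordEdge; rw [slopeRight_add, slopeLeft_add]; ring

theorem ordEdge_neg (e : G.E) (t : ℝ) : (-f).ordEdge e t = -f.ordEdge e t := by
  unfold ordEdge; rw [slopeRight_neg, slopeLeft_neg]; ring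

open Classical in
theorem ordVertex_eq (v : G.V) : f.ordVertex v = ∑ e, if G.Inc e v then f.slope e v else 0 := by
  unfold ordVertex
  rw [finsum_mem_def, finsum_eq_sum_of_fintype]
  exact Finset.sum_congr rfl fun e _ => by simp [Set.indicator_apply]

theorem ordVertex_add (v : G.V) : (f + g).ordVertex v = f.ordVertex v + g.ordVertex v := by
  classical
  rw [ordVertex_eq, ordVertex_eq, ordVertex_eq, ← Finset.sum_add_distrib]
  refine Finset.sum_congr rfl fun e _ => ?_
  split_ifs
  · exact slope_add f g e v
  · rfl

theorem ordVertex_neg (v : G.V) : (-f).ordVertex v = -f.ordVertex v := by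
  classical
  rw [ordVertex_eq, ordVertex_eq, ← Finset.sum_neg_distrib]
  refine Finset.sum_congr rfl fun e _ => ?_
  split_ifs
  · exact slope_neg f e v
  · rfl

/-- The rational function with the values `F` at the vertices that is given by `plFn` on the
edges. -/
def ofPl (F : G.V → ℝ) (d : G.E → ℤ) (a : G.E → ℝ →₀ ℤ)
    (ha : ∀ e, ∀ y ∈ (a e).support, 0 ≤ y ∧ y < n e)
    (hF : ∀ e, F (G.head e) = F (G.tail e) + (-d e * n e + (a e).sum fun y k => k * y)) :
    RatFn G n where
  onVertex := F
  onEdge e t := F (G.tail e) + plFn (d e) (a e) t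
  onEdge_tail e := by rw [plFn_zero fun y hy => (ha e y hy).1, add_zero]
  onEdge_head e := by rw [plFn_of_le fun y hy => (ha e y hy).2.le, hF]
  exists_slope_right e t _ := ⟨_, by
    filter_upwards [plFn_right (d e) (a e) t] with s hs
    rw [hs, add_assoc]⟩
  exists_slope_left e t _ := ⟨_, by
    filter_upwards [plFn_left (d e) (a e) t] with s hs
    rw [hs, add_assoc]⟩

section ofPl

variable {F : G.V → ℝ} {d : G.E → ℤ} {a : G.E → ℝ →₀ ℤ}
  (ha : ∀ e, ∀ y ∈ (a e).support, 0 ≤ y ∧ y < n e)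
  (hF : ∀ e, F (G.head e) = F (G.tail e) + (-d e * n e + (a e).sum fun y k => k * y))

theorem slopeRight_ofPl {e : G.E} {t : ℝ} (ht : t ∈ Set.Ico (0 : ℝ) (n e)) :
    (ofPl F d a ha hF).slopeRight e t = -d e + (a e).sum fun y k => if t < y then k else 0 := by
  refine slopeRight_eq ht ?_
  filter_upwards [plFn_right (d e) (a e) t] with s hs
  simp only [ofPl]
  rw [hs, add_assoc]

theorem slopeLeft_ofPl {e : G.E} {t : ℝ} (ht : t ∈ Set.Ioc (0 : ℝ) (n e)) :
    (ofPl F d a ha hF).slopeLeft e t = d e - (a e).sum fun y k => if t ≤ y then k else 0 := by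
  refine slopeLeft_eq ht ?_
  filter_upwards [plFn_left (d e) (a e) t] with s hs
  simp only [ofPl]
  rw [hs, add_assoc]

theorem ordEdge_ofPl {e : G.E} {t : ℝ} (ht : t ∈ Set.Ioo (0 : ℝ) (n e)) :
    (ofPl F d a ha hF).ordEdge e t = -a e t := by
  classical
  unfold ordEdge
  rw [slopeRight_ofPl ha hF ⟨ht.1.le, ht.2⟩, slopeLeft_ofPl ha hF ⟨ht.1, ht.2.le⟩]
  have h1 : ((a e).sum fun y k => if t ≤ y then k else 0) =
      ((a e).sum fun y k => if t < y then k else 0) + (a e).sum fun y k => if y = t then k else 0 := by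
    rw [← Finsupp.sum_add]
    refine Finset.sum_congr rfl fun y _ => ?_
    dsimp only
    rcases lt_trichotomy t y with h | h | h
    · simp [h, h.le, h.ne']
    · simp [h]
    · simp [not_le.mpr h, h.ne, not_lt.mpr h.le]
  have h2 : ((a e).sum fun y k => if y = t then k else 0) = a e t := by
    simp only [Finsupp.sum_ite_eq', Finsupp.mem_support_iff, ne_eq, ite_not]
    split_ifs with h
    · exact h.symm
    · rfl
  rw [h1, h2]; ring

end ofPl

end RatFn

/-- The distance from the endpoint `v` of `e` to the point at distance `y` from the tail. -/
def distFrom (n : G.ChainStructure) (e : G.E) (v : G.V) (y : ℝ) : ℝ :=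
  open Classical in if G.tail e = v then y else n e - y

/-- On an edge, the values at the two ends fix the first moment of the divisor of the function up to
multiples of the length. Once `A` is prescribed, a single further chip at a point `R` restores the
balance. The value `R = 0` puts this chip at an endpoint, where it is absorbed in the slopes. The
formula for the slopes at both ends is the analogue of `leave` for real displacements. -/
theorem exists_ratFn (w : Multidegree G n) (F : G.V → ℝ) (A : G.E → ℝ →₀ ℤ)
    (hA : ∀ e, ∀ y ∈ (A e).support, y ∈ Set.Ioo (0 : ℝ) (n e)) :
    ∃ f : RatFn G n, f.onVertex = F ∧
      (∀ e, ∃ R : ℝ, (0 ≤ R ∧ R < n e) ∧ (∃ d : ℤ, (w.edge e).val + cob F e -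
          ((A e).sum fun y k => k * y) = R + n e * d) ∧ ∀ t ∈ Set.Ioo (0 : ℝ) (n e),
        w.coeffEdge e t + f.ordEdge e t = A e t + (open Classical in if R = t then 1 else 0)) ∧
      ∀ e v v', G.Joins e v v' → -f.slope e v =
        cl (n e) (w.pos e v + (F v - F v') - (A e).sum fun y k => k * distFrom n e v y) +
          ((A e).sum fun _ k => k) - cl (n e) (w.pos e v) := by
  classical
  let m : G.E → ℝ := fun e => (w.edge e).val
  let S : G.E → ℝ := fun e => (A e).sum fun y k => k * y
  let Q : G.E → ℝ := fun e => m e + cob F e - S e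
  let d : G.E → ℤ := fun e => ⌊Q e / n e⌋
  let R : G.E → ℝ := fun e => Q e - n e * d e
  have hm : ∀ e, 0 ≤ m e ∧ m e < n e := fun e =>
    ⟨Nat.cast_nonneg _, Nat.cast_lt.mpr (w.val_lt e)⟩
  have hR : ∀ e, 0 ≤ R e ∧ R e < n e := by
    intro e
    have h0 := len_pos n e
    have h1 := Int.floor_le (Q e / n e)
    have h2 := Int.lt_floor_add_one (Q e / n e)
    rw [le_div_iff₀ h0] at h1
    rw [div_lt_iff₀ h0] at h2
    have h3 : (d e : ℝ) = ⌊Q e / n e⌋ := rfl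
    constructor
    · change 0 ≤ Q e - n e * d e
      rw [h3]; linarith
    · change Q e - n e * d e < n e
      rw [h3]; linarith
  -- What has to be removed: the chip of `D_w` minus the prescribed chips and the balancing chip.
  -- The multiple `n e * d e` in the moment is taken up by the slope of `plFn`.
  let a : G.E → ℝ →₀ ℤ := fun e => Finsupp.single (m e) 1 - A e - Finsupp.single (R e) 1
  have ha : ∀ e, ∀ y ∈ (a e).support, 0 ≤ y ∧ y < n e := by
    intro e y hy
    by_contra hcon
    rw [Finsupp.mem_support_iff] at hy
    apply hy
    have h1 : m e ≠ y := fun h => hcon (h ▸ hm e)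
    have h2 : R e ≠ y := fun h => hcon (h ▸ hR e)
    have h3 : A e y = 0 := by
      by_contra h
      have := hA e y (Finsupp.mem_support_iff.mpr h)
      exact hcon ⟨this.1.le, this.2⟩
    simp [a, h1, h2, h3]
  have hsum : ∀ e (φ : ℝ → ℤ → ℝ), (∀ y k k', φ y (k - k') = φ y k - φ y k') →
      (a e).sum φ = φ (m e) 1 - (A e).sum φ - φ (R e) 1 := by
    intro e φ hφ
    have h0 : ∀ y, φ y 0 = 0 := fun y => by simpa using hφ y 0 0
    simp only [a]
    rw [Finsupp.sum_sub_index hφ, Finsupp.sum_sub_index hφ, Finsupp.sum_single_index (h0 _),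
      Finsupp.sum_single_index (h0 _)]
  have hsumZ : ∀ e (p : ℝ → Prop), ((a e).sum fun y k => if p y then k else 0) =
      (if p (m e) then 1 else 0) - ((A e).sum fun y k => if p y then k else 0) -
        if p (R e) then 1 else 0 := by
    intro e p
    have hφ : ∀ y (k k' : ℤ), (if p y then k - k' else 0) =
        (if p y then k else 0) - if p y then k' else 0 := by
      intro y k k'; split_ifs <;> simp
    simp only [a]
    rw [Finsupp.sum_sub_index hφ, Finsupp.sum_sub_index hφ, Finsupp.sum_single_index (by simp),
      Finsupp.sum_single_index (by simp)]
  have hF : ∀ e, F (G.head e) = F (G.tail e) + (-d e * n e + (a e).sum fun y k => k * y) := by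
    intro e
    rw [hsum e (fun y k => k * y) (fun y k k' => by push_cast; ring)]
    have h1 : R e = m e + (F (G.tail e) - F (G.head e)) - S e - n e * d e := rfl
    change _ = F (G.tail e) + (-d e * n e + ((1 : ℤ) * m e - S e - (1 : ℤ) * R e))
    rw [h1]; push_cast; ring
  refine ⟨RatFn.ofPl F d a ha hF, rfl, fun e => ⟨R e, hR e, ⟨d e, ?_⟩, fun t ht => ?_⟩, ?_⟩
  · change Q e = Q e - n e * d e + n e * d e
    ring
  · rw [RatFn.ordEdge_ofPl ha hF ht]
    simp only [a, Multidegree.coeffEdge, Finsupp.sub_apply, Finsupp.single_apply]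
    change (if m e = t then 1 else 0) + _ = _
    ring
  · have hε : ∀ e, ((A e).sum fun y k => if 0 < y then k else 0) = (A e).sum fun _ k => k :=
      fun e => Finset.sum_congr rfl fun y hy => if_pos (hA e y hy).1
    have hε' : ∀ e, ((A e).sum fun y k => if (n e : ℝ) ≤ y then k else 0) = 0 :=
      fun e => Finset.sum_eq_zero fun y hy => if_neg (not_le.mpr (hA e y hy).2)
    have hQ : ∀ e, Q e = R e + n e * d e := fun e => by
      change Q e = Q e - n e * d e + n e * d e; ring
    rintro e v v' (⟨rfl, rfl⟩ | ⟨rfl, rfl⟩)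
    · rw [RatFn.slope_tail, RatFn.slopeRight_ofPl ha hF (RatFn.zero_mem_Ico e), hsumZ, hε]
      have h1 : (w.pos e (G.tail e) : ℝ) = m e := by
        simp [Multidegree.pos, sign_tail, m]
      have h2 : ((A e).sum fun y k => (k : ℝ) * distFrom n e (G.tail e) y) = S e := by
        simp [distFrom, S]
      rw [h1, h2, show m e + (F (G.tail e) - F (G.head e)) - S e = Q e from rfl, hQ,
        cl_add_mul, cl_of_mem (hm e).1 (hm e).2, cl_of_mem (hR e).1 (hR e).2]
      ring
    · rw [RatFn.slope_head, RatFn.slopeLeft_ofPl ha hF (RatFn.len_mem_Ioc e), hsumZ, hε',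
        if_neg (not_le.mpr (hm e).2), if_neg (not_le.mpr (hR e).2)]
      have h1 : (w.pos e (G.head e) : ℝ) = -m e := by
        simp [Multidegree.pos, sign_head, m]
      have h2 : ((A e).sum fun y k => (k : ℝ) * distFrom n e (G.head e) y) =
          n e * ((A e).sum fun _ k => k : ℤ) - S e := by
        simp only [distFrom, if_neg (G.tail_ne_head e), S, Finsupp.sum]
        push_cast
        rw [Finset.mul_sum, ← Finset.sum_sub_distrib]
        exact Finset.sum_congr rfl fun y _ => by ring
      rw [h1, h2, show -m e + (F (G.head e) - F (G.tail e)) -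
        (n e * ((A e).sum fun _ k => k : ℤ) - S e) =
          -R e + n e * ((-d e - (A e).sum fun _ k => k : ℤ) : ℝ) by
        have h3 : Q e = m e + (F (G.tail e) - F (G.head e)) - S e := rfl
        have h4 := hQ e
        push_cast
        linarith, cl_add_mul, cl_neg_of_mem (hm e).1 (hm e).2, cl_neg_of_mem (hR e).1 (hR e).2]
      ring

namespace Multidegree

theorem exists_isEquivVia_act (w : Multidegree G n) (c : G.V → ℤ) :
    ∃ f : RatFn G n, w.IsEquivVia (act (cob c) w) f ∧ (∀ v, f.onVertex v = c v) ∧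
      ∀ e v v', G.Joins e v v' → f.slope e v = -w.leave e v (c v - c v') := by
  classical
  obtain ⟨f, hf1, hf2, hf3⟩ := exists_ratFn w (fun v => (c v : ℝ)) (fun _ => 0) (by simp)
  have hslope : ∀ e v v', G.Joins e v v' → f.slope e v = -w.leave e v (c v - c v') := by
    intro e v v' h
    have h1 := hf3 e v v' h
    simp only [Finsupp.sum_zero_index, sub_zero, add_zero] at h1
    unfold leave
    push_cast
    omega
  refine ⟨f, ⟨fun v => ?_, fun e t ht => ?_⟩, fun v => congrFun hf1 v, hslope⟩
  · rw [RatFn.ordVertex_eq]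
    simp only [act]
    rw [sub_eq_add_neg, ← Finset.sum_neg_distrib]
    congr 1
    refine Finset.sum_congr rfl fun e _ => ?_
    split_ifs with h
    · obtain ⟨v', hj⟩ := h.exists_joins
      rw [hslope e v v' hj, hj.sign_mul_cob]
    · rfl
  · obtain ⟨R, hR, ⟨d, hd⟩, h1⟩ := hf2 e
    rw [h1 t ht]
    simp only [Finsupp.sum_zero_index, sub_zero, Finsupp.coe_zero, Pi.zero_apply, zero_add] at hd ⊢
    unfold coeffEdge
    -- With integral values at the vertices and no prescribed chips, the balancing chip sits at an
    -- integer in `[0, n e)` congruent to the pushed position.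
    have h2 : (((act (cob c) w).edge e).val : ℝ) = R := by
      have h3 : (R : ℝ) = (((w.edge e).val + cob c e - n e * d : ℤ) : ℝ) := by
        simp only [cob] at hd ⊢
        push_cast
        linarith
      obtain ⟨k, hk⟩ : ∃ k : ℕ, (k : ℤ) = (w.edge e).val + cob c e - n e * d := by
        refine ⟨((w.edge e).val + cob c e - n e * d : ℤ).toNat, Int.toNat_of_nonneg ?_⟩
        have := hR.1
        rw [h3] at this
        exact_mod_cast this
      rw [← hk] at h3
      have h4 : R = k := by exact_mod_cast h3
      have h5 : k < n e := by
        have := hR.2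
        rw [h4] at this
        exact_mod_cast this
      have h6 : (act (cob c) w).edge e = (k : ZMod (n e)) := by
        have h7 := congrArg (Int.cast : ℤ → ZMod (n e)) hk
        push_cast at h7
        rw [h7]
        simp [act]
      rw [h6, h4, ZMod.val_natCast, Nat.mod_eq_of_lt h5]
    rw [h2]

end Multidegree

end MGraph

end

/-! ## Rational functions and reduced multidegrees -/

noncomputable section

namespace MGraph

variable {G : MGraph.{u}} {n : G.ChainStructure}

/-- Adding a function with divisor the chip of `D_w` makes `f` convex on `e`, so it lies above its
tangent at the endpoint `v`. The terms `cl` and `pos` account for the position of that chip as seen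
from `v`. -/
theorem RatFn.drop_le (w : Multidegree G n) (f : RatFn G n) {e : G.E} {v v' : G.V}
    (hj : G.Joins e v v')
    (h : ∀ t ∈ Set.Ioo (0 : ℝ) (n e), 0 ≤ w.coeffEdge e t + f.ordEdge e t) :
    f.onVertex v - f.onVertex v' ≤ n e * (cl (n e) (w.pos e v) - f.slope e v : ℤ) - w.pos e v := by
  classical
  set m : ℝ := ((w.edge e).val : ℝ) with hm
  have hm0 : 0 ≤ m := Nat.cast_nonneg _
  have hm1 : m < n e := Nat.cast_lt.mpr (w.val_lt e)
  have hlen := len_pos n e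
  let g : ℝ → ℝ := fun t => f.onEdge e t + plFn 0 (Finsupp.single m (-1)) t
  let r : ℝ → ℤ := fun t => f.slopeRight e t + if t < m then -1 else 0
  let l : ℝ → ℤ := fun t => f.slopeLeft e t - if t ≤ m then -1 else 0
  have hr : ∀ t ∈ Set.Ico (0 : ℝ) (n e), ∀ᶠ s in 𝓝[>] t, g s = g t + r t * (s - t) := by
    intro t ht
    filter_upwards [f.slopeRight_spec ht, plFn_right 0 (Finsupp.single m (-1)) t] with s h1 h2
    rw [Finsupp.sum_single_index (by simp)] at h2
    simp only [g, r]
    rw [h1, h2]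
    push_cast
    ring
  have hl : ∀ t ∈ Set.Ioc (0 : ℝ) (n e), ∀ᶠ s in 𝓝[<] t, g s = g t + l t * (t - s) := by
    intro t ht
    filter_upwards [f.slopeLeft_spec ht, plFn_left 0 (Finsupp.single m (-1)) t] with s h1 h2
    rw [Finsupp.sum_single_index (by simp)] at h2
    simp only [g, l]
    rw [h1, h2]
    push_cast
    ring
  have hrl : ∀ t ∈ Set.Ioo (0 : ℝ) (n e), 0 ≤ r t + l t := by
    intro t ht
    have h1 := h t ht
    unfold Multidegree.coeffEdge RatFn.ordEdge at h1
    rw [← hm] at h1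
    simp only [r, l]
    rcases lt_trichotomy m t with h2 | h2 | h2
    · rw [if_neg h2.ne] at h1
      rw [if_neg h2.not_gt, if_neg h2.not_ge]
      omega
    · rw [if_pos h2] at h1
      rw [if_neg h2.not_gt, if_pos h2.ge]
      omega
    · rw [if_neg h2.ne'] at h1
      rw [if_pos h2, if_pos h2.le]
      omega
  have hg0 : g 0 = f.onVertex (G.tail e) := by
    simp only [g]
    rw [plFn_zero, f.onEdge_tail, add_zero]
    intro y hy
    rw [Finset.mem_singleton.mp (Finsupp.support_single_subset hy)]
    exact hm0
  have hg1 : g (n e) = f.onVertex (G.head e) - m := by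
    simp only [g]
    rw [plFn_of_le, f.onEdge_head, Finsupp.sum_single_index (by simp)]
    · push_cast; ring
    intro y hy
    rw [Finset.mem_singleton.mp (Finsupp.support_single_subset hy)]
    exact hm1.le
  rcases hj with ⟨rfl, rfl⟩ | ⟨rfl, rfl⟩
  · have h1 := le_of_convex hlen hr hl hrl
    have h2 : (w.pos e (G.tail e) : ℝ) = m := by simp [Multidegree.pos, sign_tail, m]
    rw [hg0, hg1] at h1
    simp only [r] at h1
    rw [h2, cl_of_mem hm0 hm1, RatFn.slope_tail]
    push_cast at h1 ⊢
    split_ifs at h1 ⊢ <;> linarith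
  · have h1 := le_of_convex_rev hlen hr hl hrl
    have h2 : (w.pos e (G.head e) : ℝ) = -m := by simp [Multidegree.pos, sign_head, m]
    rw [hg0, hg1] at h1
    simp only [l, if_neg hm1.not_ge] at h1
    rw [h2, cl_neg_of_mem hm0 hm1, RatFn.slope_head]
    push_cast at h1 ⊢
    linarith

theorem RatFn.slope_le (w : Multidegree G n) (f : RatFn G n) {e : G.E} {v v' : G.V}
    (hj : G.Joins e v v')
    (h : ∀ t ∈ Set.Ioo (0 : ℝ) (n e), 0 ≤ w.coeffEdge e t + f.ordEdge e t)
    (hle : f.onVertex v' ≤ f.onVertex v) : f.slope e v ≤ 0 := by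
  have h1 := f.drop_le w hj h
  have h2 : (w.pos e v : ℝ) ≤ n e * (cl (n e) (w.pos e v) - f.slope e v : ℤ) := by linarith
  have h3 := (cl_le_iff _ _ _).mpr h2
  omega

theorem RatFn.slope_lt (w : Multidegree G n) (f : RatFn G n) {e : G.E} {v v' : G.V}
    (hj : G.Joins e v v')
    (h : ∀ t ∈ Set.Ioo (0 : ℝ) (n e), 0 ≤ w.coeffEdge e t + f.ordEdge e t)
    (hlt : f.onVertex v' < f.onVertex v) (he : w.edge e = 0) : f.slope e v < 0 := by
  have h1 := f.drop_le w hj h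
  have h0 : w.pos e v = 0 := by simp [Multidegree.pos, he]
  rw [h0] at h1
  have h2 : (0 : ℝ) < n e * ((- f.slope e v : ℤ) : ℝ) := by
    simp [cl] at h1 ⊢
    linarith
  have h3 : (0 : ℝ) < (- f.slope e v : ℤ) := (mul_pos_iff_of_pos_left (len_pos n e)).mp h2
  have h4 : 0 < - f.slope e v := by exact_mod_cast h3
  omega

open LimitLinear.Tree

/-- Maximum principle. If `f` dropped from `u` towards `v`, then by induction no edge at `u` would
have positive slope there, and the edges towards `v` with `μ = 0` would have negative slope. The
loss at `u` would exceed its coefficient. -/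
theorem RatFn.onVertex_le_of_redAt (hT : G.IsMultitree) {w : Multidegree G n} {v : G.V}
    (hw : ∀ u, u ≠ v → w.RedAt v u) (f : RatFn G n)
    (hf : ∀ e, ∀ t ∈ Set.Ioo (0 : ℝ) (n e), 0 ≤ w.coeffEdge e t + f.ordEdge e t)
    (hf' : ∀ u, u ≠ v → 0 ≤ w.vert u + f.ordVertex u) :
    ∀ u, u ≠ v → f.onVertex u ≤ f.onVertex (nxt G.bar u v) := by
  classical
  refine leaf_induction hT v fun u hu ih => ?_
  by_contra! hlt
  have h1 := hf' u hu
  have h2 := (hw u hu).2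
  rw [Multidegree.outflow_one, natCast_ncard_eq_sum] at h2
  rw [RatFn.ordVertex_eq] at h1
  have h3 : (∑ e, if G.Inc e u then f.slope e u else 0) ≤
      ∑ e, -(if e ∈ {e | G.Joins e u (nxt G.bar u v) ∧ w.edge e = 0} then 1 else 0) := by
    refine Finset.sum_le_sum fun e _ => ?_
    split_ifs with h4 h5 h5
    · have := f.slope_lt w h5.1 (hf e) hlt h5.2
      omega
    · obtain ⟨y, hy⟩ := h4.exists_joins
      have h6 : f.slope e u ≤ 0 := by
        refine f.slope_le w hy (hf e) ?_
        rcases nxt_eq_or hT hy.adj v with h7 | h7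
        · rw [← h7.2]; exact hlt.le
        · have := ih y h7.1 h7.2
          rwa [h7.2] at this
      simpa using h6
    · exact absurd h5.1.inc h4
    · simp
  rw [Finset.sum_neg_distrib] at h3
  omega

theorem RatFn.slope_le_of_redAt (hT : G.IsMultitree) {w : Multidegree G n} {v : G.V}
    (hw : ∀ u, u ≠ v → w.RedAt v u) (f : RatFn G n)
    (hf : ∀ e, ∀ t ∈ Set.Ioo (0 : ℝ) (n e), 0 ≤ w.coeffEdge e t + f.ordEdge e t)
    (hf' : ∀ u, u ≠ v → 0 ≤ w.vert u + f.ordVertex u) {e : G.E} (he : G.Inc e v) :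
    f.slope e v ≤ 0 := by
  obtain ⟨y, hy⟩ := he.exists_joins
  refine f.slope_le w hy (hf e) ?_
  have := f.onVertex_le_of_redAt hT hw hf hf' y hy.ne.symm
  rwa [nxt_eq_of_adj hT hy.symm.adj] at this

theorem Multidegree.coeffEdge_nonneg (w : Multidegree G n) (e : G.E) (t : ℝ) :
    0 ≤ w.coeffEdge e t := by
  unfold coeffEdge; split_ifs <;> simp

/-- The difference of the two functions keeps `D_w` effective away from `v`, so the maximum
principle applies to it and to its negative. This makes the divisor in the forgetful map independent
of the choice of `f_v`. -/
theorem RatFn.slope_eq_of_isEquivVia (hT : G.IsMultitree) {u w : Multidegree G n} {v : G.V}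
    (hw : ∀ x, x ≠ v → w.RedAt v x) {f f' : RatFn G n} (h : u.IsEquivVia w f)
    (h' : u.IsEquivVia w f') {e : G.E} (he : G.Inc e v) : f.slope e v = f'.slope e v := by
  have key : ∀ {f f' : RatFn G n}, u.IsEquivVia w f → u.IsEquivVia w f' →
      f.slope e v ≤ f'.slope e v := by
    intro f f' h h'
    have h1 := RatFn.slope_le_of_redAt hT hw (f + -f') (fun e t ht => ?_) (fun x hx => ?_) he
    · rw [slope_add, slope_neg] at h1
      omega
    · rw [ordEdge_add, ordEdge_neg]
      have h2 := h.2 e t ht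
      have h3 := h'.2 e t ht
      have h4 := Multidegree.coeffEdge_nonneg w e t
      omega
    · rw [ordVertex_add, ordVertex_neg]
      have h2 := h.1 x
      have h3 := h'.1 x
      have h4 := (hw x hx).1
      omega
  exact le_antisymm (key h h') (key h' h)

end MGraph

end

/-! ## Divisors supported at the marked points -/

noncomputable section

open MGraph

namespace SmoothCurve

variable {κ : Type u} [Field κ] [IsAlgClosed κ] {C : SmoothCurve κ}

theorem degree_nonneg_of_mem_sections {D : C.Divisor} {f : C.RatFn} (hf : f ≠ 0)
    (h : f ∈ C.sections D) : 0 ≤ D.degree := by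
  have h1 : 0 ≤ C.divOf f + D := fun P => by
    simpa using h.resolve_left hf P
  have h2 := Divisor.degree_nonneg h1
  rwa [Divisor.degree_add, C.degree_divOf hf, zero_add] at h2

theorem vanishing_eq_bot {W : Submodule κ C.RatFn} {A B : C.Divisor} (h : A.degree < B.degree) :
    vanishing W A B = ⊥ := by
  rw [eq_bot_iff]
  intro f hf
  by_contra h0
  have := degree_nonneg_of_mem_sections (D := A - B) h0 hf.2
  rw [Divisor.degree_sub] at this
  omega

end SmoothCurve

namespace MetrizedComplex

open SmoothCurve

variable {κ : Type u} [Field κ] {𝔠 : MetrizedComplex κ}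

open Classical in
/-- The divisor `∑ k_e x_e^v` on `C_v`, the sum being over the edges incident on `v`. -/
def markDiv (v : 𝔠.graph.V) (k : 𝔠.graph.E → ℤ) : (𝔠.curve v).Divisor :=
  ∑ e, if h : 𝔠.graph.Inc e v then Finsupp.single (𝔠.mark e v h) (k e) else 0

section markDiv

variable (v : 𝔠.graph.V)

theorem markDiv_apply (k : 𝔠.graph.E → ℤ) {e : 𝔠.graph.E} (h : 𝔠.graph.Inc e v) :
    markDiv v k (𝔠.mark e v h) = k e := by
  classical
  unfold markDiv
  rw [Finsupp.finsetSum_apply, Finset.sum_eq_single e]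
  · rw [dif_pos h, Finsupp.single_eq_same]
  · intro e' _ hne
    split_ifs with h'
    · rw [Finsupp.single_apply, if_neg]
      exact fun hm => hne (𝔠.mark_injective _ _ v h' h hm)
    · rfl
  · simp

theorem markDiv_apply_of_ne (k : 𝔠.graph.E → ℤ) {P : (𝔠.curve v).Point}
    (hP : ∀ e h, 𝔠.mark e v h ≠ P) : markDiv v k P = 0 := by
  classical
  unfold markDiv
  rw [Finsupp.finsetSum_apply]
  refine Finset.sum_eq_zero fun e _ => ?_
  split_ifs with h
  · rw [Finsupp.single_apply, if_neg (hP e h)]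
  · rfl

theorem markDiv_mono {k k' : 𝔠.graph.E → ℤ} (h : ∀ e, 𝔠.graph.Inc e v → k e ≤ k' e) :
    markDiv v k ≤ markDiv v k' := by
  classical
  refine Finset.sum_le_sum fun e _ => ?_
  split_ifs with he
  · exact Finsupp.single_le_single.mpr (h e he)
  · rfl

theorem markDiv_congr {k k' : 𝔠.graph.E → ℤ} (h : ∀ e, 𝔠.graph.Inc e v → k e = k' e) :
    markDiv v k = markDiv v k' :=
  le_antisymm (markDiv_mono v fun e he => (h e he).le) (markDiv_mono v fun e he => (h e he).ge)

theorem markDiv_add (k k' : 𝔠.graph.E → ℤ) :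
    markDiv v (k + k') = markDiv v k + markDiv v k' := by
  classical
  unfold markDiv
  rw [← Finset.sum_add_distrib]
  refine Finset.sum_congr rfl fun e _ => ?_
  split_ifs
  · rw [Pi.add_apply, Finsupp.single_add]
  · rw [add_zero]

theorem markDiv_zero : markDiv (𝔠 := 𝔠) v 0 = 0 := by
  unfold markDiv
  exact Finset.sum_eq_zero fun e _ => by split_ifs <;> simp

theorem markDiv_neg (k : 𝔠.graph.E → ℤ) : markDiv v (-k) = - markDiv v k := by
  rw [eq_neg_iff_add_eq_zero, ← markDiv_add, neg_add_cancel, markDiv_zero]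

theorem slopeAt_eq (f : MGraph.RatFn 𝔠.graph 𝔠.len) (P : (𝔠.curve v).Point) :
    slopeAt f v P = markDiv v (fun e => f.slope e v) P := by
  classical
  unfold slopeAt
  by_cases hP : ∃ e, ∃ h, 𝔠.mark e v h = P
  · obtain ⟨e, h, rfl⟩ := hP
    rw [markDiv_apply]
    have : {e' | ∃ h', 𝔠.mark e' v h' = 𝔠.mark e v h} = {e} := by
      ext e'
      constructor
      · rintro ⟨h', hm⟩
        exact 𝔠.mark_injective _ _ v h' h hm
      · rintro rfl
        exact ⟨h, rfl⟩
    rw [this, finsum_mem_singleton]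
  · push Not at hP
    rw [markDiv_apply_of_ne v _ hP]
    have : {e' | ∃ h', 𝔠.mark e' v h' = P} = ∅ := by
      rw [Set.eq_empty_iff_forall_notMem]
      rintro e' ⟨h', hm⟩
      exact hP e' h' hm
    rw [this, finsum_mem_empty]

variable [IsAlgClosed κ]

open Classical in
theorem degree_markDiv (k : 𝔠.graph.E → ℤ) :
    (markDiv v k).degree = ∑ e, if 𝔠.graph.Inc e v then k e else 0 := by
  have hsum : ∀ s : Finset 𝔠.graph.E, ∀ D : 𝔠.graph.E → (𝔠.curve v).Divisor,
      SmoothCurve.Divisor.degree (∑ e ∈ s, D e) = ∑ e ∈ s, (D e).degree := by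
    intro s D
    induction s using Finset.induction_on with
    | empty => simp [SmoothCurve.Divisor.degree]
    | insert e s he ih =>
      rw [Finset.sum_insert he, Finset.sum_insert he, SmoothCurve.Divisor.degree_add, ih]
  unfold markDiv
  rw [hsum]
  refine Finset.sum_congr rfl fun e _ => ?_
  split_ifs
  · exact SmoothCurve.Divisor.degree_single _ _ _
  · simp [SmoothCurve.Divisor.degree]

theorem degree_markDiv_slope (f : MGraph.RatFn 𝔠.graph 𝔠.len) :
    (markDiv v fun e => f.slope e v).degree = f.ordVertex v := by
  classical
  rw [degree_markDiv, RatFn.ordVertex_eq]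

end markDiv

open Classical in
/-- The divisor `∑ k_e x_e^v`, the sum being over the edges joining `v` and `v'`. -/
def joinDiv (v v' : 𝔠.graph.V) (k : 𝔠.graph.E → ℤ) : (𝔠.curve v).Divisor :=
  markDiv v fun e => if 𝔠.graph.Joins e v v' then k e else 0

theorem joinDiv_mono {v v' : 𝔠.graph.V} {k k' : 𝔠.graph.E → ℤ}
    (h : ∀ e, 𝔠.graph.Joins e v v' → k e ≤ k' e) : joinDiv v v' k ≤ joinDiv v v' k' := by
  refine markDiv_mono v fun e _ => ?_
  split_ifs with h1
  · exact h e h1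
  · rfl

theorem joinDiv_congr {v v' : 𝔠.graph.V} {k k' : 𝔠.graph.E → ℤ}
    (h : ∀ e, 𝔠.graph.Joins e v v' → k e = k' e) : joinDiv v v' k = joinDiv v v' k' :=
  le_antisymm (joinDiv_mono fun e he => (h e he).le) (joinDiv_mono fun e he => (h e he).ge)

theorem joinDiv_zero {v v' : 𝔠.graph.V} : joinDiv v v' 0 = (0 : (𝔠.curve v).Divisor) := by
  rw [← markDiv_zero v]
  exact markDiv_congr v fun e _ => by simp

theorem joinDiv_add {v v' : 𝔠.graph.V} {k k' : 𝔠.graph.E → ℤ} :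
    joinDiv v v' (k + k') = joinDiv v v' k + joinDiv v v' k' := by
  unfold joinDiv
  rw [← markDiv_add]
  exact markDiv_congr v fun e _ => by by_cases h : 𝔠.graph.Joins e v v' <;> simp [h]

/-- By `leave_add_one` the increment from `D_i` to `D_{i+1}` consists of the marked points on the
edges along which a chip leaves `v` in that step. -/
theorem twistingDivisor_eq (w : Multidegree 𝔠.graph 𝔠.len) (v v' : 𝔠.graph.V) (i : ℕ) :
    twistingDivisor w v v' i = joinDiv v v' fun e => w.leave e v i := by
  classical
  induction i with
  | zero =>
    unfold twistingDivisor
    rw [Finset.range_zero, Finset.sum_empty, ← joinDiv_zero]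
    exact joinDiv_congr fun e _ => by simp [Multidegree.leave_zero]
  | succ i ih =>
    have h1 : twistingDivisor w v v' (i + 1) = twistingDivisor w v v' i +
        ∑ᶠ e : {e : 𝔠.graph.E // 𝔠.graph.Joins e v v' ∧
          (sign e v : ZMod (𝔠.len e)) * w.edge e = -((i : ℕ) : ZMod (𝔠.len e))},
        Finsupp.single (𝔠.mark e.1 v (e.2.1.elim (fun h ↦ .inl h.1) (fun h ↦ .inr h.2))) 1 :=
      Finset.sum_range_succ _ _
    have h2 : (∑ᶠ e : {e : 𝔠.graph.E // 𝔠.graph.Joins e v v' ∧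
          (sign e v : ZMod (𝔠.len e)) * w.edge e = -((i : ℕ) : ZMod (𝔠.len e))},
        Finsupp.single (𝔠.mark e.1 v (e.2.1.elim (fun h ↦ .inl h.1) (fun h ↦ .inr h.2))) 1) =
        joinDiv v v' fun e => if (sign e v : ZMod (𝔠.len e)) * w.edge e =
          -((i : ℕ) : ZMod (𝔠.len e)) then 1 else 0 := by
      rw [finsum_eq_sum_of_fintype]
      unfold joinDiv markDiv
      rw [← Finset.sum_filter_add_sum_filter_not Finset.univ (fun e => 𝔠.graph.Joins e v v' ∧
        (sign e v : ZMod (𝔠.len e)) * w.edge e = -((i : ℕ) : ZMod (𝔠.len e)))]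
      rw [Finset.sum_eq_zero (s := Finset.filter (fun e => ¬ _) _), add_zero]
      · rw [← Finset.sum_subtype_eq_sum_filter, Finset.subtype_univ]
        refine Finset.sum_congr rfl fun e _ => ?_
        simp only [dif_pos e.2.1.inc, if_pos e.2.1, if_pos e.2.2]
      · intro e he
        have he' := (Finset.mem_filter.mp he).2
        rw [not_and] at he'
        by_cases hj : 𝔠.graph.Joins e v v'
        · simp only [dif_pos hj.inc, if_pos hj, if_neg (he' hj), Finsupp.single_zero]
        · simp [hj]
    rw [h1, h2, ih, ← joinDiv_add]
    refine joinDiv_congr fun e _ => ?_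
    have := w.leave_add_one e v i
    push_cast at this ⊢
    rw [this]
    rfl

/-! ### The pre-limit condition in terms of codimensions -/

section Characterization

variable [IsAlgClosed κ]

/-- Letting `j` run over all integers avoids truncated subtraction. The additional cases are
vacuous: for `j < 0` or `j` beyond the twist count one of the divisors is nonpositive and imposes no
condition. -/
theorem exists_isMultivanishing_iff {w : 𝔠.graph.V → Multidegree 𝔠.graph 𝔠.len} {r : ℕ}
    {A : ∀ v, (𝔠.curve v).Divisor} {W : ∀ v, Submodule κ (𝔠.curve v).RatFn}
    (hW : ∀ v, W v ≤ (𝔠.curve v).sections (A v)) (hr : ∀ v, Module.finrank κ (W v) = r + 1) :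
    (∃ a : 𝔠.graph.V → 𝔠.graph.V → Fin (r + 1) → ℤ,
      ∀ v v', 𝔠.graph.bar.Adj v v' →
        IsMultivanishing (W v) (A v) (twistingDivisor (w v) v v') (a v v') ∧
        ∀ l j, IsCritical (twistingDivisor (w v) v v') j →
          a v v' l = (twistingDivisor (w v) v v' j).degree →
            (twistingDivisor (w v') v' v (Multidegree.twistCount w v v' - j)).degree ≤
              a v' v l.rev) ↔
    ∀ v v', 𝔠.graph.bar.Adj v v' → ∀ j : ℤ,
      codimVanishing (W v) (A v) (joinDiv v v' fun e => (w v).leave e v (j + 1)) +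
      codimVanishing (W v') (A v') (joinDiv v' v fun e =>
        (w v').leave e v' (Multidegree.twistCount w v v' - j)) ≤ r + 1 := by
  have hfin : ∀ v, Module.Finite κ (W v) := fun v =>
    Module.finite_of_finrank_pos (by rw [hr]; omega)
  have hmono : ∀ v v', Monotone (twistingDivisor (w v) v v') := by
    intro v v' i j hij
    rw [twistingDivisor_eq, twistingDivisor_eq]
    exact joinDiv_mono fun e _ => (w v).leave_mono e v (by exact_mod_cast hij)
  have h0 : ∀ v v', twistingDivisor (w v) v v' 0 = 0 := fun v v' => rfl
  have hle : ∀ v v' j, j ≤ 0 → codimVanishing (W v) (A v)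
      (joinDiv v v' fun e => (w v).leave e v j) = 0 := by
    intro v v' j hj
    refine codimVanishing_of_nonpos (hW v) ?_
    rw [← joinDiv_zero]
    exact joinDiv_mono fun e _ => by
      rw [Pi.zero_apply, ← (w v).leave_zero e v]
      exact (w v).leave_mono e v hj
  have hcod : ∀ v B, codimVanishing (W v) (A v) B ≤ r + 1 := fun v B => by
    rw [← hr v]; exact Nat.sub_le _ _
  have hiff : (∀ v v', 𝔠.graph.bar.Adj v v' → ∀ j : ℤ,
      codimVanishing (W v) (A v) (joinDiv v v' fun e => (w v).leave e v (j + 1)) +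
      codimVanishing (W v') (A v') (joinDiv v' v fun e =>
        (w v').leave e v' (Multidegree.twistCount w v v' - j)) ≤ r + 1) ↔
      ∀ v v', 𝔠.graph.bar.Adj v v' → ∀ j : ℕ,
        codimVanishing (W v) (A v) (twistingDivisor (w v) v v' (j + 1)) +
        codimVanishing (W v') (A v') (twistingDivisor (w v') v' v
          (Multidegree.twistCount w v v' - j)) ≤ r + 1 := by
    refine forall₃_congr fun v v' hadj => ?_
    constructor
    · intro h j
      rw [twistingDivisor_eq, twistingDivisor_eq]
      by_cases hj : j ≤ Multidegree.twistCount w v v'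
      · have := h j
        push_cast [hj]
        exact this
      · rw [Nat.sub_eq_zero_of_le (by omega), hle v' v _ (by simp), add_zero]
        exact hcod _ _
    · intro h j
      by_cases hj0 : j < 0
      · rw [hle v v' _ (by omega), zero_add]
        exact hcod _ _
      · lift j to ℕ using by omega
        by_cases hj : j ≤ Multidegree.twistCount w v v'
        · have := h j
          rw [twistingDivisor_eq, twistingDivisor_eq] at this
          push_cast [hj] at this
          exact this
        · rw [hle v' v _ (by omega), add_zero]
          exact hcod _ _
  rw [hiff]
  constructor
  · rintro ⟨a, ha⟩ v v' hadj
    exact (forall_degree_le_rev_iff (hmono v v') (h0 v v') (hmono v' v) (h0 v' v) (hW v) (hW v')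
      (hr v) (hr v') (ha v v' hadj).1 (ha v' v hadj.symm).1 _).mp (ha v v' hadj).2
  · intro h
    have hex : ∀ v v', 𝔠.graph.bar.Adj v v' → ∃ a : Fin (r + 1) → ℤ,
        IsMultivanishing (W v) (A v) (twistingDivisor (w v) v v') a := by
      intro v v' hadj
      refine exists_isMultivanishing (hmono v v') (h0 v v') (hW v) (hr v) ?_
      classical
      obtain ⟨e, he⟩ := hadj
      -- After this many full turns, more than `deg A` chips have left `v` along `e` alone, so no
      -- nonzero section survives.
      refine ⟨𝔠.len e * ((A v).degree + 1).toNat, vanishing_eq_bot ?_⟩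
      rw [twistingDivisor_eq, joinDiv, degree_markDiv]
      have h1 : (w v).leave e v ((𝔠.len e * ((A v).degree + 1).toNat : ℕ) : ℤ) =
          ((A v).degree + 1).toNat := by
        have := (w v).leave_mul e v ((A v).degree + 1).toNat
        push_cast
        exact this
      have h2 : (w v).leave e v ((𝔠.len e * ((A v).degree + 1).toNat : ℕ) : ℤ) ≤
          ∑ e', if 𝔠.graph.Inc e' v then (if 𝔠.graph.Joins e' v v' then
            (w v).leave e' v ((𝔠.len e * ((A v).degree + 1).toNat : ℕ) : ℤ) else 0) else 0 := by
        rw [← Finset.add_sum_erase _ _ (Finset.mem_univ e), if_pos he.inc, if_pos he]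
        refine le_add_of_nonneg_right (Finset.sum_nonneg fun e' _ => ?_)
        split_ifs
        · rw [← (w v).leave_zero e' v]
          exact (w v).leave_mono e' v (by positivity)
        · rfl
        · rfl
      rw [h1] at h2
      have h3 := Int.self_le_toNat ((A v).degree + 1)
      refine lt_of_lt_of_le ?_ h2
      omega
    choose! a ha using hex
    refine ⟨a, fun v v' hadj => ⟨ha v v' hadj, ?_⟩⟩
    exact (forall_degree_le_rev_iff (hmono v v') (h0 v v') (hmono v' v) (h0 v' v) (hW v) (hW v')
      (hr v) (hr v') (ha v v' hadj) (ha v' v hadj.symm) _).mpr (h v v' hadj)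

end Characterization

end MetrizedComplex

end

/-! ## Codimensions along marked points -/

noncomputable section

open MGraph

theorem cl_left_continuous (n : ℕ+) (x : ℝ) : ∀ᶠ y in 𝓝[<] x, cl n y = cl n x := by
  have h : n * ((cl n x - 1 : ℤ) : ℝ) < x := (lt_cl_iff n x _).mp (by omega)
  filter_upwards [self_mem_nhdsWithin, nhdsWithin_le_nhds (Ioi_mem_nhds h)] with y h1 h2
  have h3 := cl_mono n (le_of_lt h1)
  have h4 := (lt_cl_iff n y _).mpr h2
  omega

/-- The right-hand side is `⌊x / n⌋ + 1`, which bounds the ceiling just after `x`. -/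
theorem cl_right_le (n : ℕ+) (x : ℝ) : ∀ᶠ y in 𝓝[>] x, cl n y ≤ 1 - cl n (-x) := by
  have h : n * ((cl n (-x) - 1 : ℤ) : ℝ) < -x := (lt_cl_iff n _ _).mp (by omega)
  have h' : x < n * ((1 - cl n (-x) : ℤ) : ℝ) := by
    push_cast at h ⊢
    linarith
  filter_upwards [nhdsWithin_le_nhds (Iio_mem_nhds h')] with y h2
  exact (cl_le_iff _ _ _).mpr (le_of_lt h2)

theorem MGraph.Joins.distFrom {G : MGraph.{u}} {n : G.ChainStructure} {e : G.E} {v v' : G.V}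
    (h : G.Joins e v v') (y : ℝ) : distFrom n e v' y = n e - distFrom n e v y := by
  have := G.tail_ne_head e
  unfold MGraph.distFrom
  rcases h with ⟨rfl, rfl⟩ | ⟨rfl, rfl⟩
  · rw [if_neg this, if_pos rfl]
  · rw [if_neg this, if_pos rfl]; ring

namespace MetrizedComplex

open SmoothCurve

variable {κ : Type u} [Field κ] [IsAlgClosed κ] {𝔠 : MetrizedComplex κ}

open Classical in
theorem codim_joinDiv_le_add {v v' : 𝔠.graph.V} {W : Submodule κ (𝔠.curve v).RatFn}
    [Module.Finite κ W] {A : (𝔠.curve v).Divisor} {k k' m : 𝔠.graph.E → ℤ}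
    (hm : ∀ e, 𝔠.graph.Joins e v v' → 0 ≤ m e)
    (h : ∀ e, 𝔠.graph.Joins e v v' → k e ≤ k' e + m e) :
    (codimVanishing W A (joinDiv v v' k) : ℤ) ≤ codimVanishing W A (joinDiv v v' k') +
      ∑ e, if 𝔠.graph.Joins e v v' then m e else 0 := by
  have h1 : codimVanishing W A (joinDiv v v' k) ≤ codimVanishing W A (joinDiv v v' (k' + m)) :=
    codimVanishing_mono (joinDiv_mono h)
  have h2 : joinDiv v v' k' ≤ joinDiv v v' (k' + m) :=
    joinDiv_mono fun e he => le_add_of_nonneg_right (hm e he)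
  have h3 := codimVanishing_le_add_degree (W := W) (A := A) h2
  rw [joinDiv_add, add_sub_cancel_left, ← joinDiv_add, show joinDiv v v' m = markDiv v _ from rfl,
    degree_markDiv] at h3
  have h4 : (∑ e, if 𝔠.graph.Inc e v then (if 𝔠.graph.Joins e v v' then m e else 0) else 0) =
      ∑ e, if 𝔠.graph.Joins e v v' then m e else 0 := by
    refine Finset.sum_congr rfl fun e _ => ?_
    by_cases he : 𝔠.graph.Joins e v v'
    · rw [if_pos he.inc]
    · simp [he]
  rw [h4] at h3
  omega

theorem joinDiv_nonpos {v v' : 𝔠.graph.V} {k : 𝔠.graph.E → ℤ}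
    (h : ∀ e, 𝔠.graph.Joins e v v' → k e ≤ 0) : joinDiv v v' k ≤ 0 := by
  rw [← joinDiv_zero (v := v) (v' := v')]
  exact joinDiv_mono h

open Classical in
-- The drop `X` from `v` to `v'` is taken as large as the bound `T` at `v` permits. Any larger drop
-- costs more than `T` at `v`, and the vanishing condition at a suitable integer `j` turns this into
-- the bound `T'` at `v'`. The mass `ε` of prescribed chips on the edges is what passing from real
-- to integral positions costs, shared between the two sides.
theorem exists_drop {v v' : 𝔠.graph.V} {r : ℕ}
    {W : Submodule κ (𝔠.curve v).RatFn} {W' : Submodule κ (𝔠.curve v').RatFn}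
    [Module.Finite κ W] [Module.Finite κ W'] {A : (𝔠.curve v).Divisor} {A' : (𝔠.curve v').Divisor}
    (hW : W ≤ (𝔠.curve v).sections A) (hW' : W' ≤ (𝔠.curve v').sections A')
    (p α α' : 𝔠.graph.E → ℤ) (δ : ℤ)
    (hcond : ∀ j : ℤ, codimVanishing W A (joinDiv v v' fun e =>
        cl (𝔠.len e) ((p e + δ + (j + 1) : ℤ) : ℝ) - α e) +
      codimVanishing W' A' (joinDiv v' v fun e =>
        cl (𝔠.len e) ((-p e - δ - j : ℤ) : ℝ) - α' e) ≤ r + 1)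
    (S : 𝔠.graph.E → ℝ) (ε : 𝔠.graph.E → ℤ) (hS : ∀ e, 0 ≤ S e) (hSε : ∀ e, S e ≤ 𝔠.len e * ε e)
    {T T' : ℕ} (hT : r + ∑ e, (if 𝔠.graph.Joins e v v' then ε e else 0) ≤ T + T') :
    ∃ X : ℝ, codimVanishing W A (joinDiv v v' fun e =>
        cl (𝔠.len e) (p e + X - S e) + ε e - α e) ≤ T ∧
      codimVanishing W' A' (joinDiv v' v fun e =>
        cl (𝔠.len e) (-(p e + X - S e)) - α' e) ≤ T' := by
  set q : ℝ → 𝔠.graph.E → ℤ := fun X e => cl (𝔠.len e) (p e + X - S e) + ε e - α e with hq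
  set q' : ℝ → 𝔠.graph.E → ℤ := fun X e => cl (𝔠.len e) (-(p e + X - S e)) - α' e with hq'
  have hsmall : ∃ X, ∀ e, q X e ≤ 0 := by
    have h1 : ∀ e, ∀ᶠ X in atBot, q X e ≤ 0 := by
      intro e
      filter_upwards [eventually_le_atBot ((𝔠.len e : ℝ) * ((α e - ε e : ℤ) : ℝ) - p e + S e)]
        with X hX
      have : cl (𝔠.len e) (p e + X - S e) ≤ α e - ε e := (cl_le_iff _ _ _).mpr (by linarith)
      simp only [hq]
      omega
    exact (eventually_all.mpr h1).exists
  have hlarge : ∃ X, ∀ Y ≥ X, ∀ e, q' Y e ≤ 0 := by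
    have h1 : ∀ e, ∀ᶠ X in atTop, q' X e ≤ 0 := by
      intro e
      filter_upwards [eventually_ge_atTop (-((𝔠.len e : ℝ) * (α' e : ℝ)) - p e + S e)]
        with X hX
      have : cl (𝔠.len e) (-(p e + X - S e)) ≤ α' e := (cl_le_iff _ _ _).mpr (by linarith)
      simp only [hq']
      omega
    exact eventually_atTop.mp (eventually_all.mpr h1)
  let Γ : Set ℝ := {X | codimVanishing W A (joinDiv v v' (q X)) ≤ T}
  by_cases hb : BddAbove Γ
  swap
  -- If `X` is not bounded, it can be chosen so large that nothing is required at `v'`.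
  · obtain ⟨X, hX⟩ := hlarge
    rw [not_bddAbove_iff] at hb
    obtain ⟨Y, hY, hXY⟩ := hb X
    refine ⟨Y, hY, ?_⟩
    rw [codimVanishing_of_nonpos hW' (joinDiv_nonpos fun e _ => hX Y hXY.le e)]
    exact Nat.zero_le _
  have hne : Γ.Nonempty := by
    obtain ⟨X, hX⟩ := hsmall
    refine ⟨X, ?_⟩
    change codimVanishing _ _ _ ≤ _
    rw [codimVanishing_of_nonpos hW (joinDiv_nonpos fun e _ => hX e)]
    exact Nat.zero_le _
  set X₀ := sSup Γ with hX₀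
  have hmem : X₀ ∈ Γ := by
    -- The required orders are left continuous in `X`, so the supremum is attained.
    have h1 : ∀ᶠ X in 𝓝[<] X₀, ∀ e, q X e = q X₀ e := by
      rw [eventually_all]
      intro e
      have ht : Tendsto (fun X => p e + X - S e) (𝓝[<] X₀) (𝓝[<] (p e + X₀ - S e)) := by
        refine tendsto_nhdsWithin_of_tendsto_nhds_of_eventually_within _ ?_ ?_
        · have : Continuous fun X : ℝ => p e + X - S e := by fun_prop
          exact (this.tendsto X₀).mono_left nhdsWithin_le_nhds
        · filter_upwards [self_mem_nhdsWithin] with X hX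
          have hX' : X < X₀ := hX
          change p e + X - S e < p e + X₀ - S e
          linarith
      filter_upwards [ht.eventually (cl_left_continuous (𝔠.len e) (p e + X₀ - S e))] with X hX
      simp only [hq, hX]
    rw [eventually_nhdsWithin_iff, Metric.eventually_nhds_iff] at h1
    obtain ⟨η, hη, h1⟩ := h1
    obtain ⟨Y, hY, hYX⟩ := exists_lt_of_lt_csSup hne (show X₀ - η < sSup Γ by linarith)
    have hYX' : Y ≤ X₀ := le_csSup hb hY
    rcases hYX'.eq_or_lt with h2 | h2
    · rwa [← h2]
    · have h3 : q Y = q X₀ := funext (h1 (by rw [Real.dist_eq, abs_lt]; constructor <;> linarith) h2)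
      change codimVanishing _ _ _ ≤ _
      rw [← h3]
      exact hY
  obtain ⟨X₁, hX₁, hX₁q⟩ : ∃ X₁, X₀ < X₁ ∧ ∀ e, cl (𝔠.len e) (p e + X₁ - S e) ≤
      1 - cl (𝔠.len e) (-(p e + X₀ - S e)) := by
    have h1 : ∀ᶠ X in 𝓝[>] X₀, ∀ e, cl (𝔠.len e) (p e + X - S e) ≤
        1 - cl (𝔠.len e) (-(p e + X₀ - S e)) := by
      rw [eventually_all]
      intro e
      have ht : Tendsto (fun X => p e + X - S e) (𝓝[>] X₀) (𝓝[>] (p e + X₀ - S e)) := by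
        refine tendsto_nhdsWithin_of_tendsto_nhds_of_eventually_within _ ?_ ?_
        · have : Continuous fun X : ℝ => p e + X - S e := by fun_prop
          exact (this.tendsto X₀).mono_left nhdsWithin_le_nhds
        · filter_upwards [self_mem_nhdsWithin] with X hX
          have hX' : X₀ < X := hX
          change p e + X₀ - S e < p e + X - S e
          linarith
      exact ht.eventually (cl_right_le (𝔠.len e) (p e + X₀ - S e))
    obtain ⟨X₁, h2, h3⟩ := (h1.and self_mem_nhdsWithin).exists
    exact ⟨X₁, h3, h2⟩
  have hnot : T < codimVanishing W A (joinDiv v v' (q X₁)) := by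
    by_contra! hcon
    exact absurd (le_csSup hb (show X₁ ∈ Γ from hcon)) (not_le.mpr hX₁)
  -- The integral push lying just below the real displacement `X₀`.
  set j : ℤ := ⌊X₀ - δ⌋ with hj
  have hj1 : (j : ℝ) ≤ X₀ - δ := Int.floor_le _
  have hj2 : X₀ - δ < j + 1 := Int.lt_floor_add_one _
  -- The share of `ε e` charged to `v'`; the remaining share `ε e - k e` is charged to `v`. The
  -- orders at `X₁` are those for `j + 1` increased by at most `ε - k`, and the opposite orders at
  -- `X₀` those for `-j` increased by at most `k`.
  let k : 𝔠.graph.E → ℤ := fun e => cl (𝔠.len e) (-(p e + X₀ - S e)) - cl (𝔠.len e) (-(p e + X₀))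
  have hk0 : ∀ e, 0 ≤ k e := fun e =>
    sub_nonneg.mpr (cl_mono _ (by have := hS e; linarith))
  have hk1 : ∀ e, 0 ≤ ε e - k e := by
    intro e
    have h1 := cl_mono (𝔠.len e) (show -(p e + X₀ - S e) ≤ -(p e + X₀) + 𝔠.len e * ε e by
      have := hSε e; linarith)
    rw [cl_add_mul] at h1
    simp only [k]
    omega
  have h1 := codim_joinDiv_le_add (W := W) (A := A) (v' := v') (k := q X₁)
    (k' := fun e => cl (𝔠.len e) ((p e + δ + (j + 1) : ℤ) : ℝ) - α e)
    (m := fun e => ε e - k e) (fun e _ => hk1 e) (fun e _ => by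
      have h2 := hX₁q e
      have h3 : - cl (𝔠.len e) (-(p e + X₀)) < cl (𝔠.len e) ((p e + δ + (j + 1) : ℤ) : ℝ) := by
        rw [lt_cl_iff]
        have h4 := (cl_le_iff (𝔠.len e) (-(p e + X₀)) _).mp le_rfl
        push_cast
        linarith
      simp only [hq, k]
      omega)
  have h2 := codim_joinDiv_le_add (W := W') (A := A') (v' := v) (k := q' X₀)
    (k' := fun e => cl (𝔠.len e) ((-p e - δ - j : ℤ) : ℝ) - α' e)
    (m := k) (fun e _ => hk0 e) (fun e _ => by
      have h3 := cl_mono (𝔠.len e) (show -(p e + X₀) ≤ ((-p e - δ - j : ℤ) : ℝ) by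
        push_cast; linarith)
      simp only [hq', k]
      omega)
  refine ⟨X₀, hmem, ?_⟩
  change codimVanishing W' A' (joinDiv v' v (q' X₀)) ≤ T'
  have h3 := hcond j
  have h4 : (∑ e, if 𝔠.graph.Joins e v v' then ε e - k e else 0) +
      (∑ e, if 𝔠.graph.Joins e v' v then k e else 0) =
      ∑ e, if 𝔠.graph.Joins e v v' then ε e else 0 := by
    rw [← Finset.sum_add_distrib]
    refine Finset.sum_congr rfl fun e _ => ?_
    by_cases h : 𝔠.graph.Joins e v v'
    · rw [if_pos h, if_pos h.symm, if_pos h]; ring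
    · rw [if_neg h, if_neg fun h' => h h'.symm, if_neg h]; rfl
  omega

end MetrizedComplex

end

/-! ## Divisors on a metrized complex -/

noncomputable section

open MGraph

namespace Tree

variable {V : Type*} {T : SimpleGraph V} [Fintype V]

theorem sum_ite_le {ι : Type*} {s : Finset ι} {p : ι → Prop} [DecidablePred p]
    (h : ∀ i j, p i → p j → i = j) (a : ℕ) : ∑ i ∈ s, (if p i then a else 0) ≤ a := by
  by_cases hex : ∃ i ∈ s, p i
  · obtain ⟨i, hi, hpi⟩ := hex
    rw [Finset.sum_eq_single_of_mem i hi, if_pos hpi]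
    intro j _ hj
    rw [if_neg fun hpj => hj (h j i hpj hpi)]
  · push Not at hex
    rw [Finset.sum_eq_zero fun i hi => if_neg (hex i hi)]
    exact Nat.zero_le _

end Tree

/-! ### The mass of a divisor beyond an edge of the tree -/

namespace MGraph

open LimitLinear.Tree

variable {G : MGraph.{u}}

open Classical in
/-- The part of a distribution of masses on the vertices and edges of a multitree that lies beyond
`v'`, as seen from the adjacent vertex `v`, including the edges joining `v` and `v'`. -/
def massBeyond (m : G.V → ℕ) (ε : G.E → ℕ) (v v' : G.V) : ℕ :=
  (∑ x, if x ≠ v ∧ nxt G.bar v x = v' then m x else 0) +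
    ∑ e, if ∃ a, G.Inc e a ∧ a ≠ v ∧ nxt G.bar v a = v' then ε e else 0

open Classical in
-- The branches at `v` are disjoint, so each vertex and each edge is counted for at most one
-- neighbour, and `v` itself for none.
theorem sum_massBeyond_le (hT : G.IsMultitree) (m : G.V → ℕ) (ε : G.E → ℕ) (v : G.V)
    (s : Finset G.V) : ∑ v' ∈ s, massBeyond m ε v v' + m v ≤ ∑ x, m x + ∑ e, ε e := by
  have h1 : ∑ v' ∈ s, ∑ x, (if x ≠ v ∧ nxt G.bar v x = v' then m x else 0) + m v ≤ ∑ x, m x := by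
    rw [Finset.sum_comm, ← Finset.sum_erase_add _ _ (Finset.mem_univ v),
      ← Finset.sum_erase_add _ m (Finset.mem_univ v)]
    rw [Finset.sum_eq_zero (s := s) (f := fun v' => if v ≠ v ∧ _ then _ else _)
      (fun v' _ => if_neg fun h => h.1 rfl), add_zero]
    gcongr with x _
    exact sum_ite_le (fun i j hi hj => hi.2.symm.trans hj.2) _
  have h2 : ∑ v' ∈ s, ∑ e, (if ∃ a, G.Inc e a ∧ a ≠ v ∧ nxt G.bar v a = v' then ε e else 0) ≤
      ∑ e, ε e := by
    rw [Finset.sum_comm]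
    gcongr with e _
    refine sum_ite_le ?_ _
    rintro i j ⟨a, ha, hav, rfl⟩ ⟨b, hb, hbv, rfl⟩
    obtain ⟨y, hy⟩ := ha.exists_joins
    by_cases hab : a = b
    · rw [hab]
    · have hyb : y = b := by
        rcases hy with ⟨h1, h2⟩ | ⟨h1, h2⟩ <;> rcases hb with h3 | h3
        · exact absurd (h1.symm.trans h3) hab
        · exact h2.symm.trans h3
        · exact h1.symm.trans h3
        · exact absurd (h2.symm.trans h3) hab
      subst hyb
      exact nxt_congr hT hav.symm hbv.symm hy.adj
  unfold massBeyond
  rw [Finset.sum_add_distrib]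
  omega

open Classical in
-- Every vertex and edge lies in one of the two halves, and the edges joining `v` and `v'` lie in
-- both. This surplus provides the mass demanded by `exists_drop`.
theorem le_massBeyond_add (hT : G.IsMultitree) (m : G.V → ℕ) (ε : G.E → ℕ) {v v' : G.V}
    (hadj : G.bar.Adj v v') : ∑ x, m x + ∑ e, ε e + ∑ e, (if G.Joins e v v' then ε e else 0) ≤
      massBeyond m ε v v' + massBeyond m ε v' v := by
  have h1 : ∑ x, m x ≤ (∑ x, if x ≠ v ∧ nxt G.bar v x = v' then m x else 0) +
      ∑ x, if x ≠ v' ∧ nxt G.bar v' x = v then m x else 0 := by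
    rw [← Finset.sum_add_distrib]
    gcongr with x _
    rcases nxt_eq_or hT hadj x with h | h
    · rw [if_pos ⟨h.1.symm, h.2⟩]; exact Nat.le_add_right _ _
    · rw [if_pos (⟨h.1.symm, h.2⟩ : x ≠ v' ∧ nxt G.bar v' x = v)]; exact Nat.le_add_left _ _
  have h2 : ∑ e, ε e + ∑ e, (if G.Joins e v v' then ε e else 0) ≤
      (∑ e, if ∃ a, G.Inc e a ∧ a ≠ v ∧ nxt G.bar v a = v' then ε e else 0) +
      ∑ e, if ∃ a, G.Inc e a ∧ a ≠ v' ∧ nxt G.bar v' a = v then ε e else 0 := by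
    rw [← Finset.sum_add_distrib, ← Finset.sum_add_distrib]
    refine Finset.sum_le_sum fun e _ => ?_
    by_cases he : G.Joins e v v'
    · rw [if_pos he, if_pos ⟨v', he.symm.inc, hadj.ne', nxt_eq_of_adj hT hadj⟩,
        if_pos ⟨v, he.inc, hadj.ne, nxt_eq_of_adj hT hadj.symm⟩]
    · rw [if_neg he, add_zero]
      rcases nxt_eq_or hT hadj (G.tail e) with h | h
      · rw [if_pos ⟨_, Or.inl rfl, h.1.symm, h.2⟩]; exact Nat.le_add_right _ _
      · rw [if_pos (⟨_, Or.inl rfl, h.1.symm, h.2⟩ :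
          ∃ a, G.Inc e a ∧ a ≠ v' ∧ nxt G.bar v' a = v)]
        exact Nat.le_add_left _ _
  unfold massBeyond
  omega

end MGraph

namespace MetrizedComplex

open SmoothCurve

variable {κ : Type u} [Field κ] {𝔠 : MetrizedComplex κ}

namespace Divisor

/-- The `C_v`-part of a divisor. -/
def onCurve (D : 𝔠.Divisor) (v : 𝔠.graph.V) : (𝔠.curve v).Divisor :=
  Finsupp.comapDomain (fun P => .inl ⟨v, P⟩) D (fun P _ Q _ h => by simpa using h)

/-- The part of a divisor in the interior of the edge `e`. -/
def onEdge (D : 𝔠.Divisor) (e : 𝔠.graph.E) : ℝ →₀ ℤ :=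
  Finsupp.embDomain (Function.Embedding.subtype _)
    (Finsupp.comapDomain (fun t : Set.Ioo (0 : ℝ) (𝔠.len e) => (.inr ⟨e, t⟩ : 𝔠.Realization)) D
      (fun P _ Q _ h => by simpa using h))

theorem onCurve_apply (D : 𝔠.Divisor) (v : 𝔠.graph.V) (P : (𝔠.curve v).Point) :
    D.onCurve v P = D (.inl ⟨v, P⟩) := rfl

theorem onEdge_apply (D : 𝔠.Divisor) (e : 𝔠.graph.E) (t : Set.Ioo (0 : ℝ) (𝔠.len e)) :
    D.onEdge e t = D (.inr ⟨e, t⟩) :=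
  Finsupp.embDomain_apply_self (Function.Embedding.subtype _) _ t

theorem onEdge_apply_of_notMem (D : 𝔠.Divisor) (e : 𝔠.graph.E) {t : ℝ}
    (ht : t ∉ Set.Ioo (0 : ℝ) (𝔠.len e)) : D.onEdge e t = 0 :=
  Finsupp.embDomain_of_notMem_range _ _ _ (by simpa using ht)

theorem mem_of_mem_support_onEdge {D : 𝔠.Divisor} {e : 𝔠.graph.E} {t : ℝ}
    (ht : t ∈ (D.onEdge e).support) : t ∈ Set.Ioo (0 : ℝ) (𝔠.len e) := by
  by_contra h
  exact (Finsupp.mem_support_iff.mp ht) (D.onEdge_apply_of_notMem e h)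

theorem onEdge_nonneg {D : 𝔠.Divisor} (hD : 0 ≤ D) (e : 𝔠.graph.E) : 0 ≤ D.onEdge e := by
  intro t
  by_cases ht : t ∈ Set.Ioo (0 : ℝ) (𝔠.len e)
  · exact (hD (.inr ⟨e, ⟨t, ht⟩⟩)).trans (D.onEdge_apply e ⟨t, ht⟩).ge
  · exact (D.onEdge_apply_of_notMem e ht).ge

theorem onCurve_nonneg {D : 𝔠.Divisor} (hD : 0 ≤ D) (v : 𝔠.graph.V) : 0 ≤ D.onCurve v :=
  fun P => hD (.inl ⟨v, P⟩)

theorem onEdge_add (D D' : 𝔠.Divisor) (e : 𝔠.graph.E) :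
    (D + D').onEdge e = D.onEdge e + D'.onEdge e := by
  ext t
  by_cases ht : t ∈ Set.Ioo (0 : ℝ) (𝔠.len e)
  · rw [Finsupp.add_apply, onEdge_apply (t := ⟨t, ht⟩), onEdge_apply (t := ⟨t, ht⟩),
      onEdge_apply (t := ⟨t, ht⟩), Finsupp.add_apply]
  · rw [Finsupp.add_apply, onEdge_apply_of_notMem _ e ht, onEdge_apply_of_notMem _ e ht,
      onEdge_apply_of_notMem _ e ht, add_zero]

theorem degree_add (D D' : 𝔠.Divisor) : (D + D').degree = D.degree + D'.degree :=
  Finsupp.sum_add_index' (by simp) (by simp)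

theorem degree_eq (D : 𝔠.Divisor) : D.degree =
    ∑ v, SmoothCurve.Divisor.degree (D.onCurve v) + ∑ e, (D.onEdge e).sum fun _ k => k := by
  classical
  induction D using Finsupp.induction_linear with
  | zero =>
    have h1 : ∀ v, onCurve (0 : 𝔠.Divisor) v = 0 := fun v => by ext; rfl
    have h2 : ∀ e, onEdge (0 : 𝔠.Divisor) e = 0 := fun e => by
      ext t
      by_cases ht : t ∈ Set.Ioo (0 : ℝ) (𝔠.len e)
      · rw [onEdge_apply (t := ⟨t, ht⟩)]; rfl
      · exact onEdge_apply_of_notMem _ e ht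
    simp only [h1, h2]
    simp [degree, SmoothCurve.Divisor.degree]
  | add D D' h h' =>
    have h1 : ∀ v, onCurve (D + D') v = onCurve D v + onCurve D' v := fun v => by ext; rfl
    have h2 : ∀ v, SmoothCurve.Divisor.degree (onCurve (D + D') v) =
        SmoothCurve.Divisor.degree (onCurve D v) + SmoothCurve.Divisor.degree (onCurve D' v) := by
      intro v
      rw [h1]
      exact Finsupp.sum_add_index' (by simp) (by simp)
    have h3 : ∀ e, (onEdge (D + D') e).sum (fun _ k => k) =
        ((onEdge D e).sum fun _ k => k) + (onEdge D' e).sum fun _ k => k := by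
      intro e
      rw [onEdge_add]
      exact Finsupp.sum_add_index' (by simp) (by simp)
    rw [degree_add, h, h']
    simp only [h2, h3, Finset.sum_add_distrib]
    ring
  | single x k =>
    have h0 : degree (Finsupp.single x k : 𝔠.Divisor) = k := Finsupp.sum_single_index rfl
    rw [h0]
    rcases x with ⟨v, P⟩ | ⟨e, t⟩
    · have h1 : onCurve (Finsupp.single (.inl ⟨v, P⟩) k : 𝔠.Divisor) v = Finsupp.single P k := by
        ext Q
        rw [onCurve_apply, Finsupp.single_apply, Finsupp.single_apply]
        simp
      have h2 : ∀ v', v' ≠ v → onCurve (Finsupp.single (.inl ⟨v, P⟩) k : 𝔠.Divisor) v' = 0 := by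
        intro v' hv'
        ext Q
        rw [onCurve_apply, Finsupp.single_apply, if_neg]
        · rfl
        · intro h
          exact hv' (congrArg Sigma.fst (Sum.inl.inj h)).symm
      have h3 : ∀ e, onEdge (Finsupp.single (.inl ⟨v, P⟩) k : 𝔠.Divisor) e = 0 := by
        intro e
        ext t
        by_cases ht : t ∈ Set.Ioo (0 : ℝ) (𝔠.len e)
        · rw [onEdge_apply (t := ⟨t, ht⟩), Finsupp.single_apply, if_neg (by simp)]; rfl
        · exact onEdge_apply_of_notMem _ e ht
      rw [Finset.sum_eq_single v (fun v' _ hv' => by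
        rw [h2 v' hv']; exact Finsupp.sum_zero_index) (by simp), h1]
      simp only [h3]
      simp [SmoothCurve.Divisor.degree]
    · have h1 : onEdge (Finsupp.single (.inr ⟨e, t⟩) k : 𝔠.Divisor) e = Finsupp.single t.1 k := by
        ext s
        by_cases hs : s ∈ Set.Ioo (0 : ℝ) (𝔠.len e)
        · rw [onEdge_apply (t := ⟨s, hs⟩), Finsupp.single_apply, Finsupp.single_apply]
          simp [Subtype.ext_iff]
        · rw [onEdge_apply_of_notMem _ e hs, Finsupp.single_apply, if_neg]
          rintro rfl
          exact hs t.2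
      have h2 : ∀ e', e' ≠ e → onEdge (Finsupp.single (.inr ⟨e, t⟩) k : 𝔠.Divisor) e' = 0 := by
        intro e' he'
        ext s
        by_cases hs : s ∈ Set.Ioo (0 : ℝ) (𝔠.len e')
        · rw [onEdge_apply (t := ⟨s, hs⟩), Finsupp.single_apply, if_neg]
          · rfl
          · intro h
            exact he' (congrArg Sigma.fst (Sum.inr.inj h)).symm
        · exact onEdge_apply_of_notMem _ e' hs
      have h3 : ∀ v, onCurve (Finsupp.single (.inr ⟨e, t⟩) k : 𝔠.Divisor) v = 0 := by
        intro v
        ext Q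
        rw [onCurve_apply, Finsupp.single_apply, if_neg (by simp)]
        rfl
      rw [Finset.sum_eq_single (f := fun e' => Finsupp.sum _ _) e (fun e' _ he' => by
        rw [h2 e' he']; exact Finsupp.sum_zero_index) (by simp), h1]
      simp only [h3]
      simp [SmoothCurve.Divisor.degree]

/-- The divisor with given parts on the curves and on the edges. -/
def ofParts (A : ∀ v, (𝔠.curve v).Divisor) (b : 𝔠.graph.E → ℝ →₀ ℤ) : 𝔠.Divisor :=
  Finsupp.ofSupportFinite
    (fun x => Sum.elim (fun x => A x.1 x.2) (fun x => b x.1 x.2) x) (by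
      refine Set.Finite.subset (((Set.finite_iUnion fun v =>
        ((A v).support.finite_toSet.image fun P => (Sum.inl ⟨v, P⟩ : 𝔠.Realization))).union
        (Set.finite_iUnion fun e => (((b e).support.finite_toSet.preimage
          Subtype.val_injective.injOn).image fun t => (Sum.inr ⟨e, t⟩ : 𝔠.Realization))))) ?_
      rintro (⟨v, P⟩ | ⟨e, t⟩) hx
      · exact Or.inl (Set.mem_iUnion.mpr ⟨v, P, by simpa using hx, rfl⟩)
      · exact Or.inr (Set.mem_iUnion.mpr ⟨e, t, by simpa using hx, rfl⟩))

theorem onCurve_ofParts (A : ∀ v, (𝔠.curve v).Divisor) (b : 𝔠.graph.E → ℝ →₀ ℤ) (v : 𝔠.graph.V) :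
    (ofParts A b).onCurve v = A v := by
  ext P; rfl

theorem onEdge_ofParts (A : ∀ v, (𝔠.curve v).Divisor) (b : 𝔠.graph.E → ℝ →₀ ℤ) (e : 𝔠.graph.E)
    (hb : ∀ t ∈ (b e).support, t ∈ Set.Ioo (0 : ℝ) (𝔠.len e)) : (ofParts A b).onEdge e = b e := by
  ext t
  by_cases ht : t ∈ Set.Ioo (0 : ℝ) (𝔠.len e)
  · rw [onEdge_apply (t := ⟨t, ht⟩)]; rfl
  · rw [onEdge_apply_of_notMem _ e ht]
    by_contra h
    exact ht (hb t (Finsupp.mem_support_iff.mpr (Ne.symm h)))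

end Divisor

end MetrizedComplex

end

/-! ## From the vanishing conditions to the restricted rank -/

noncomputable section

open MGraph

namespace MetrizedComplex

open SmoothCurve LimitLinear.Tree

variable {κ : Type u} [Field κ] {𝔠 : MetrizedComplex κ}

/-- The divisor on `𝔠` of multidegree `u` whose `C_v`-part is `A_v - ∑ slp_{e,v}(f_v) x_e^v`, where
`f_v` is the rational function with the values `c v` at the vertices that turns `D_u` into the
divisor of `act (cob (c v)) u`. -/
def IsAdapted (u : Multidegree 𝔠.graph 𝔠.len) (c : 𝔠.graph.V → 𝔠.graph.V → ℤ)
    (A : ∀ v, (𝔠.curve v).Divisor) (D : 𝔠.Divisor) : Prop :=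
  (∀ v, D.onCurve v = A v + markDiv v fun e => u.leave e v (sign e v * cob (c v) e)) ∧
    ∀ e t, D (.inr ⟨e, t⟩) = u.coeffEdge e t

variable [IsAlgClosed κ]

/-- The vanishing conditions of a pre-limit linear series with respect to the multidegrees
`act (cob (c v)) u`. -/
def VanishingCondition (u : Multidegree 𝔠.graph 𝔠.len) (c : 𝔠.graph.V → 𝔠.graph.V → ℤ)
    (A : ∀ v, (𝔠.curve v).Divisor) (W : ∀ v, Submodule κ (𝔠.curve v).RatFn) (r : ℕ) : Prop :=
  ∀ v v', 𝔠.graph.bar.Adj v v' → ∀ j : ℤ,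
    codimVanishing (W v) (A v) (joinDiv v v' fun e =>
      (Multidegree.act (cob (c v)) u).leave e v (j + 1)) +
    codimVanishing (W v') (A v') (joinDiv v' v fun e =>
      (Multidegree.act (cob (c v')) u).leave e v'
        ((c v v' - c v' v') - (c v v - c v' v) - j)) ≤ r + 1

theorem leave_act_of_joins (u : Multidegree 𝔠.graph 𝔠.len) (c : 𝔠.graph.V → ℤ) {e : 𝔠.graph.E}
    {v v' : 𝔠.graph.V} (h : 𝔠.graph.Joins e v v') (k : ℤ) :
    (Multidegree.act (cob c) u).leave e v k = cl (𝔠.len e) ((u.pos e v + (c v - c v') + k : ℤ) : ℝ) -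
      cl (𝔠.len e) ((u.pos e v + (c v - c v') : ℤ) : ℝ) := by
  rw [Multidegree.leave_act, h.sign_mul_cob]
  unfold Multidegree.leave
  push_cast
  rw [add_assoc]
  ring

theorem leave_of_joins (u : Multidegree 𝔠.graph 𝔠.len) (c : 𝔠.graph.V → ℤ) {e : 𝔠.graph.E}
    {v v' : 𝔠.graph.V} (h : 𝔠.graph.Joins e v v') : u.leave e v (sign e v * cob c e) =
      cl (𝔠.len e) ((u.pos e v + (c v - c v') : ℤ) : ℝ) - cl (𝔠.len e) (u.pos e v) := by
  rw [h.sign_mul_cob]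
  unfold Multidegree.leave
  push_cast
  rfl

open Classical in
-- The divisor is distributed over the neighbours of `v`. At unmarked points nothing is required
-- beyond `W` consisting of sections of `A`.
theorem codim_markDiv_le {v : 𝔠.graph.V} {W : Submodule κ (𝔠.curve v).RatFn} [Module.Finite κ W]
    {A : (𝔠.curve v).Divisor} (hW : W ≤ (𝔠.curve v).sections A) (k : 𝔠.graph.E → ℤ) :
    codimVanishing W A (markDiv v k) ≤
      ∑ v' ∈ Finset.univ.filter (𝔠.graph.bar.Adj v), codimVanishing W A (joinDiv v v' k) := by
  have h1 := finrank_le_finrank_inf_iInf W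
    (fun v' => (𝔠.curve v).sections (A - joinDiv v v' k))
    (fun v' => codimVanishing W A (joinDiv v v' k))
    (Finset.univ.filter (𝔠.graph.bar.Adj v)) (fun v' _ =>
      (finrank_vanishing_add_codim (W := W) (A := A) (joinDiv v v' k)).ge)
  have h2 : W ⊓ ⨅ v' ∈ Finset.univ.filter (𝔠.graph.bar.Adj v),
      (𝔠.curve v).sections (A - joinDiv v v' k) ≤ vanishing W A (markDiv v k) := by
    intro f hf
    by_cases hf0 : f = 0
    · rw [hf0]; exact zero_mem _
    obtain ⟨hfW, hf2⟩ := hf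
    rw [mem_vanishing hf0]
    refine ⟨hfW, fun P => ?_⟩
    have h3 := (hW hfW).resolve_left hf0 P
    by_cases hP : ∃ e h, 𝔠.mark e v h = P
    · obtain ⟨e, he, rfl⟩ := hP
      obtain ⟨v', hj⟩ := he.exists_joins
      simp only [Submodule.mem_iInf, SetLike.mem_coe] at hf2
      have h4 := (hf2 v' (by simpa using hj.adj)).resolve_left hf0 (𝔠.mark e v he)
      rw [Finsupp.sub_apply, joinDiv, markDiv_apply, if_pos hj] at h4
      rw [markDiv_apply]
      omega
    · push Not at hP
      rw [markDiv_apply_of_ne v k hP]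
      omega
  have := finite_vanishing W A (markDiv v k)
  have h3 := Submodule.finrank_mono h2
  have h4 := finrank_vanishing_add_codim (W := W) (A := A) (markDiv v k)
  omega

open Classical in
-- For each edge of the tree, `exists_drop` supplies a difference of values within the budget given
-- by the masses of `E`. These differences integrate to vertex values, `exists_ratFn` extends them
-- over the edges, and at each vertex the total cost stays below the dimension `r + 1`.
theorem exists_ratFn_of_vanishingCondition (hT : 𝔠.graph.IsMultitree)
    {u : Multidegree 𝔠.graph 𝔠.len} {c : 𝔠.graph.V → 𝔠.graph.V → ℤ}
    {A : ∀ v, (𝔠.curve v).Divisor} {W : ∀ v, Submodule κ (𝔠.curve v).RatFn} {r : ℕ}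
    (hW : ∀ v, W v ≤ (𝔠.curve v).sections (A v)) (hr : ∀ v, Module.finrank κ (W v) = r + 1)
    (hcond : VanishingCondition u c A W r) {D : 𝔠.Divisor} (hD : IsAdapted u c A D)
    {E : 𝔠.Divisor} (hE : 0 ≤ E) (hEr : E.degree = r) :
    ∃ f : 𝔠.RatFn, (∀ v, f.onCurve v ∈ W v) ∧ ∀ x, 0 ≤ D x + f.ord x - E x := by
  have hfin : ∀ v, Module.Finite κ (W v) := fun v =>
    Module.finite_of_finrank_pos (by rw [hr]; omega)
  let ε : 𝔠.graph.E → ℤ := fun e => (E.onEdge e).sum fun _ k => k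
  have hE0 : ∀ e y, 0 ≤ E.onEdge e y := fun e => Divisor.onEdge_nonneg hE e
  have hε : ∀ e, 0 ≤ ε e := fun e => Finset.sum_nonneg fun y _ => hE0 e y
  let S : 𝔠.graph.V → 𝔠.graph.E → ℝ := fun v e =>
    (E.onEdge e).sum fun y k => k * distFrom 𝔠.len e v y
  have hdist : ∀ v e y, y ∈ (E.onEdge e).support → 0 ≤ distFrom 𝔠.len e v y ∧
      distFrom 𝔠.len e v y ≤ 𝔠.len e := by
    intro v e y hy
    obtain ⟨h1, h2⟩ := Divisor.mem_of_mem_support_onEdge hy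
    unfold distFrom
    split_ifs <;> constructor <;> linarith
  have hS : ∀ v e, 0 ≤ S v e := fun v e => Finset.sum_nonneg fun y hy =>
    mul_nonneg (by exact_mod_cast hE0 e y) (hdist v e y hy).1
  have hSε : ∀ v e, S v e ≤ 𝔠.len e * ε e := by
    intro v e
    simp only [S, ε, Finsupp.sum]
    push_cast
    rw [Finset.mul_sum]
    refine Finset.sum_le_sum fun y hy => ?_
    rw [mul_comm (𝔠.len e : ℝ)]
    exact mul_le_mul_of_nonneg_left (hdist v e y hy).2 (by exact_mod_cast hE0 e y)
  have hSS : ∀ {v v' e}, 𝔠.graph.Joins e v v' → S v' e = 𝔠.len e * ε e - S v e := by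
    intro v v' e hj
    simp only [S, ε, Finsupp.sum]
    push_cast
    rw [Finset.mul_sum, ← Finset.sum_sub_distrib]
    exact Finset.sum_congr rfl fun y _ => by rw [hj.distFrom]; ring
  let m : 𝔠.graph.V → ℕ := fun v => (SmoothCurve.Divisor.degree (E.onCurve v)).toNat
  have hm : ∀ v, (m v : ℤ) = SmoothCurve.Divisor.degree (E.onCurve v) := fun v =>
    Int.toNat_of_nonneg (Divisor.degree_nonneg (Divisor.onCurve_nonneg hE v))
  let εN : 𝔠.graph.E → ℕ := fun e => (ε e).toNat
  have hεN : ∀ e, (εN e : ℤ) = ε e := fun e => Int.toNat_of_nonneg (hε e)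
  have htot : ∑ v, m v + ∑ e, εN e = r := by
    have h1 := E.degree_eq
    rw [hEr] at h1
    have h2 : ((∑ v, m v + ∑ e, εN e : ℕ) : ℤ) = r := by
      push_cast
      simp only [hm, hεN]
      exact h1.symm
    exact_mod_cast h2
  let T := massBeyond (G := 𝔠.graph) m εN
  -- The vanishing order required of sections of `A v` at the marked point of `e` when the drop from
  -- `v` to `v'` is `X`: the chips carried away by the slope, minus those that the divisor `D` has
  -- there in addition to `A v`.
  let q : 𝔠.graph.V → 𝔠.graph.V → ℝ → 𝔠.graph.E → ℤ := fun v v' X e =>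
    cl (𝔠.len e) (u.pos e v + X - S v e) + ε e -
      cl (𝔠.len e) ((u.pos e v + (c v v - c v v') : ℤ) : ℝ)
  have hdrop : ∀ v v', 𝔠.graph.bar.Adj v v' → ∃ X : ℝ,
      codimVanishing (W v) (A v) (joinDiv v v' (q v v' X)) ≤ T v v' ∧
      codimVanishing (W v') (A v') (joinDiv v' v (q v' v (-X))) ≤ T v' v := by
    intro v v' hadj
    obtain ⟨X, hX1, hX2⟩ := exists_drop (hW v) (hW v') (fun e => u.pos e v)
      (fun e => cl (𝔠.len e) ((u.pos e v + (c v v - c v v') : ℤ) : ℝ))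
      (fun e => cl (𝔠.len e) ((u.pos e v' + (c v' v' - c v' v) : ℤ) : ℝ)) (c v v - c v v')
      (r := r) (fun j => by
        refine le_trans (le_of_eq ?_) (hcond v v' hadj j)
        congr 2
        · exact joinDiv_congr fun e he => (leave_act_of_joins u (c v) he _).symm
        · refine joinDiv_congr fun e he => ?_
          rw [leave_act_of_joins u (c v') he, Multidegree.Joins.pos_neg he.symm u]
          congr 3
          ring) (S v) ε (hS v) (hSε v) (T := T v v') (T' := T v' v) (by
        have h1 := le_massBeyond_add hT m εN hadj
        rw [htot] at h1
        have h2 : (∑ e, if 𝔠.graph.Joins e v v' then ε e else 0) =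
            ((∑ e, if 𝔠.graph.Joins e v v' then εN e else 0 : ℕ) : ℤ) := by
          push_cast
          exact Finset.sum_congr rfl fun e _ => by rw [hεN]
        rw [h2]
        exact_mod_cast h1)
    refine ⟨X, hX1, le_trans (le_of_eq ?_) hX2⟩
    congr 1
    refine joinDiv_congr fun e he => ?_
    simp only [q]
    rw [hSS he.symm, Multidegree.Joins.pos_neg he.symm u]
    rw [show ((-u.pos e v : ℤ) : ℝ) + -X - (𝔠.len e * ε e - S v e) =
      -(u.pos e v + X - S v e) + 𝔠.len e * ((-ε e : ℤ) : ℝ) by push_cast; ring, cl_add_mul]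
    ring
  choose! X hX using hdrop
  obtain ⟨v₀⟩ : Nonempty 𝔠.graph.V := hT.connected.nonempty
  obtain ⟨F, hF⟩ := exists_potential hT v₀ X
  have hcod : ∀ v v', 𝔠.graph.bar.Adj v v' →
      codimVanishing (W v) (A v) (joinDiv v v' (q v v' (F v - F v'))) ≤ T v v' := by
    intro v v' hadj
    rcases nxt_eq_or hT hadj v₀ with h | h
    · have h1 := hF v h.1
      rw [h.2] at h1
      rw [show F v - F v' = X v v' by linarith]
      exact (hX v v' hadj).1
    · have h1 := hF v' h.1
      rw [h.2] at h1
      rw [show F v - F v' = -X v' v by linarith]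
      exact (hX v' v hadj.symm).2
  obtain ⟨f, -, hf1, hf2⟩ := exists_ratFn u F (fun e => E.onEdge e)
    (fun e y hy => Divisor.mem_of_mem_support_onEdge hy)
  let k : 𝔠.graph.V → 𝔠.graph.E → ℤ := fun v e =>
    -f.slope e v - u.leave e v (sign e v * cob (c v) e)
  have hk : ∀ v v' e, 𝔠.graph.Joins e v v' → k v e = q v v' (F v - F v') e := by
    intro v v' e he
    simp only [k, q]
    rw [hf2 e v v' he, leave_of_joins u (c v) he]
    ring
  -- The conditions at the marked points cost at most the masses beyond the neighbours of `v`, and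
  -- the points of `E` on the curve cost its degree there. Together this is at most `r`.
  have hg : ∀ v, ∃ g ∈ vanishing (W v) (A v) (E.onCurve v + markDiv v (k v)), g ≠ 0 := by
    intro v
    rw [← Submodule.ne_bot_iff]
    intro hbot
    have h1 := finrank_vanishing_add_codim (W := W v) (A := A v) (E.onCurve v + markDiv v (k v))
    rw [hbot, finrank_bot, zero_add, hr] at h1
    have h2 := codimVanishing_le_add_degree (W := W v) (A := A v)
      (B := markDiv v (k v)) (B' := E.onCurve v + markDiv v (k v))
      (le_add_of_nonneg_left (Divisor.onCurve_nonneg hE v))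
    rw [add_sub_cancel_right, ← hm] at h2
    have h3 := codim_markDiv_le (hW v) (k v)
    have h4 : ∑ v' ∈ Finset.univ.filter (𝔠.graph.bar.Adj v),
        codimVanishing (W v) (A v) (joinDiv v v' (k v)) ≤
        ∑ v' ∈ Finset.univ.filter (𝔠.graph.bar.Adj v), T v v' := by
      refine Finset.sum_le_sum fun v' hv' => ?_
      rw [joinDiv_congr fun e he => hk v v' e he]
      exact hcod v v' (by simpa using hv')
    have h5 := sum_massBeyond_le hT m εN v (Finset.univ.filter (𝔠.graph.bar.Adj v))
    rw [htot] at h5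
    have h6 : ∑ v' ∈ Finset.univ.filter (𝔠.graph.bar.Adj v), T v v' + m v ≤ r := h5
    omega
  choose g hg hg0 using hg
  refine ⟨⟨f, g, hg0⟩, fun v => (hg v).1, ?_⟩
  rintro (⟨v, P⟩ | ⟨e, t⟩)
  · have h1 := ((mem_vanishing (hg0 v)).mp (hg v)).2 P
    have h2 : D (.inl ⟨v, P⟩) = _ := DFunLike.congr_fun (hD.1 v) P
    have h3 : markDiv v (k v) = -(markDiv v fun e => f.slope e v) -
        markDiv v fun e => u.leave e v (sign e v * cob (c v) e) := by
      rw [sub_eq_add_neg, ← markDiv_neg, ← markDiv_neg, ← markDiv_add]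
      rfl
    rw [h3] at h1
    change 0 ≤ D (.inl ⟨v, P⟩) + ((𝔠.curve v).ord (g v) P + slopeAt f v P) - E.onCurve v P
    rw [h2, slopeAt_eq]
    simp only [Finsupp.add_apply, Finsupp.sub_apply, Finsupp.neg_apply] at h1 ⊢
    omega
  · obtain ⟨R, -, -, h1⟩ := hf1 e
    have h2 := h1 t.1 t.2
    rw [Divisor.onEdge_apply] at h2
    change 0 ≤ D (.inr ⟨e, t⟩) + f.ordEdge e t - E (.inr ⟨e, t⟩)
    rw [hD.2, h2]
    split_ifs <;> omega

open Classical in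
-- On each curve an effective divisor is chosen along which no nonzero function of `N v` vanishes,
-- off the marked points and off the support of `D`. At these points the orders of `f` and of `f_v`
-- agree, so effectiveness of `D + div f - E` forces `f_v` out of `N v`.
theorem exists_ratFn_notMem {D : 𝔠.Divisor} {H : ∀ v, Submodule κ (𝔠.curve v).RatFn} {k : ℕ}
    [Nonempty 𝔠.graph.V] (h : ∀ E : 𝔠.Divisor, 0 ≤ E → E.degree = k →
      ∃ f : 𝔠.RatFn, (∀ v, f.onCurve v ∈ H v) ∧ ∀ x, 0 ≤ D x + f.ord x - E x)
    (N : ∀ v, Submodule κ (𝔠.curve v).RatFn) [∀ v, Module.Finite κ (N v)]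
    (hN : ∑ v, Module.finrank κ (N v) ≤ k) :
    ∃ f : 𝔠.RatFn, (∀ v, f.onCurve v ∈ H v) ∧ (∀ x, 0 ≤ D x + f.ord x) ∧
      ∀ v, f.onCurve v ∉ N v := by
  let B : ∀ v, Set (𝔠.curve v).Point := fun v =>
    {P | D (.inl ⟨v, P⟩) ≠ 0 ∨ ∃ e h, 𝔠.mark e v h = P}
  have hB : ∀ v, (B v).Finite := by
    intro v
    refine Set.Finite.union ((D.onCurve v).support.finite_toSet.subset fun P hP =>
      Finsupp.mem_support_iff.mpr hP) ?_
    refine (Set.finite_range fun e : {e // 𝔠.graph.Inc e v} => 𝔠.mark e.1 v e.2).subset ?_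
    rintro P ⟨e, h, rfl⟩
    exact ⟨⟨e, h⟩, rfl⟩
  choose E hE0 hE1 hE2 using fun v => exists_divisor_forall_lt (N v) (B v) (hB v)
  obtain ⟨v₀⟩ : Nonempty 𝔠.graph.V := inferInstance
  obtain ⟨Q⟩ : Nonempty (𝔠.curve v₀).Point := inferInstance
  let E₁ : 𝔠.Divisor := Divisor.ofParts E 0
  have hE₁ : E₁.degree = ∑ v, SmoothCurve.Divisor.degree (E v) := by
    rw [Divisor.degree_eq]
    simp only [E₁, Divisor.onCurve_ofParts]
    simp only [fun e => Divisor.onEdge_ofParts (𝔠 := 𝔠) E 0 e (by simp)]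
    simp
  have hE₁k : E₁.degree ≤ k := by
    rw [hE₁]
    refine (Finset.sum_le_sum fun v _ => hE1 v).trans ?_
    exact_mod_cast hN
  have hE₁0 : 0 ≤ E₁ := by
    rintro (⟨v, P⟩ | ⟨e, t⟩)
    · exact hE0 v P
    · exact le_rfl
  -- The rank condition asks for degree exactly `k`; the missing degree is placed at an arbitrary
  -- point.
  let E' : 𝔠.Divisor := E₁ + Finsupp.single (.inl ⟨v₀, Q⟩) ((k : ℤ) - E₁.degree)
  have hEE' : E₁ ≤ E' := le_add_of_nonneg_right (Finsupp.single_nonneg.mpr (by omega))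
  obtain ⟨f, hf1, hf2⟩ := h E' (hE₁0.trans hEE') (by
    rw [Divisor.degree_add, show Divisor.degree (Finsupp.single _ _ : 𝔠.Divisor) = _ from
      Finsupp.sum_single_index rfl]
    ring)
  refine ⟨f, hf1, fun x => ?_, fun v hv => ?_⟩
  · have h1 : 0 ≤ E' x := (hE₁0.trans hEE') x
    have h2 := hf2 x
    omega
  · obtain ⟨P, hPB, hP⟩ := hE2 v _ hv (f.onCurve_ne_zero v)
    have h1 := hf2 (.inl ⟨v, P⟩)
    have h2 : f.ord (.inl ⟨v, P⟩) = (𝔠.curve v).ord (f.onCurve v) P := by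
      change _ + slopeAt f.onGraph v P = _
      rw [slopeAt_eq, markDiv_apply_of_ne, add_zero]
      exact fun e h hm => hPB (Or.inr ⟨e, h, hm⟩)
    have h3 : D (.inl ⟨v, P⟩) = 0 := by
      by_contra hne
      exact hPB (Or.inl hne)
    rw [h2, h3] at h1
    have h4 : E v P ≤ E' (.inl ⟨v, P⟩) := hEE' (.inl ⟨v, P⟩)
    omega

theorem hasRestrictedRank_of_vanishingCondition (hT : 𝔠.graph.IsMultitree)
    {u : Multidegree 𝔠.graph 𝔠.len} {c : 𝔠.graph.V → 𝔠.graph.V → ℤ}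
    {A : ∀ v, (𝔠.curve v).Divisor} {W : ∀ v, Submodule κ (𝔠.curve v).RatFn} {r : ℕ}
    (hW : ∀ v, W v ≤ (𝔠.curve v).sections (A v)) (hr : ∀ v, Module.finrank κ (W v) = r + 1)
    (hcond : VanishingCondition u c A W r) {D : 𝔠.Divisor} (hD : IsAdapted u c A D) :
    HasRestrictedRank D W r := by
  refine ⟨fun E hE hEr => exists_ratFn_of_vanishingCondition hT hW hr hcond hD hE hEr,
    fun k hk => ?_⟩
  classical
  have hne : Nonempty 𝔠.graph.V := hT.connected.nonempty
  let v₀ := hne.some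
  have hfin : ∀ v, Module.Finite κ (W v) := fun v =>
    Module.finite_of_finrank_pos (by rw [hr]; omega)
  by_contra! hlt
  -- If the rank were at least `r + 1`, the component at `v₀` could avoid all of `W v₀`, to which it
  -- belongs.
  let N : ∀ v, Submodule κ (𝔠.curve v).RatFn := fun v => if v = v₀ then W v else ⊥
  have hN₀ : N v₀ = W v₀ := if_pos rfl
  have hNx : ∀ v, v ≠ v₀ → N v = ⊥ := fun v hv => if_neg hv
  have hN : ∀ v, Module.Finite κ (N v) := fun v => by
    by_cases h : v = v₀
    · rw [h, hN₀]
      exact hfin v₀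
    · rw [hNx v h]
      infer_instance
  obtain ⟨f, hf, -, hf'⟩ := exists_ratFn_notMem hk N (by
    rw [Finset.sum_eq_single v₀ (fun v _ hv => by rw [hNx v hv, finrank_bot]) (by simp), hN₀, hr]
    omega)
  exact hf' v₀ (hN₀ ▸ hf v₀)

end MetrizedComplex

end

/-! ## From the restricted rank to the vanishing conditions -/

noncomputable section

open MGraph

namespace MetrizedComplex

open SmoothCurve LimitLinear.Tree

variable {κ : Type u} [Field κ] [IsAlgClosed κ] {𝔠 : MetrizedComplex κ}

section Backward

variable {u : Multidegree 𝔠.graph 𝔠.len} {c : 𝔠.graph.V → 𝔠.graph.V → ℤ}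
  {A : ∀ v, (𝔠.curve v).Divisor} {W : ∀ v, Submodule κ (𝔠.curve v).RatFn} {r : ℕ}
  {D : 𝔠.Divisor}

theorem ord_inl (f : 𝔠.RatFn) (v : 𝔠.graph.V) (P : (𝔠.curve v).Point) :
    f.ord (.inl ⟨v, P⟩) = (𝔠.curve v).ord (f.onCurve v) P +
      markDiv v (fun e => f.onGraph.slope e v) P := by
  rw [← slopeAt_eq]; rfl

theorem degree_onCurve_add_ordVertex_nonneg {f : 𝔠.RatFn} (hf : ∀ x, 0 ≤ D x + f.ord x)
    (v : 𝔠.graph.V) : 0 ≤ SmoothCurve.Divisor.degree (D.onCurve v) + f.onGraph.ordVertex v := by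
  have h1 : 0 ≤ D.onCurve v + ((𝔠.curve v).divOf (f.onCurve v) +
      markDiv v fun e => f.onGraph.slope e v) := fun P => by
    have := hf (.inl ⟨v, P⟩)
    rw [ord_inl] at this
    simpa [Divisor.onCurve_apply] using this
  have h2 := Divisor.degree_nonneg h1
  rwa [SmoothCurve.Divisor.degree_add, SmoothCurve.Divisor.degree_add,
    (𝔠.curve v).degree_divOf (f.onCurve_ne_zero v), zero_add, degree_markDiv_slope] at h2

/-- Subtracting the function that turns `D_u` into the `v`-reduced divisor leaves a function to
which the maximum principle applies. -/
theorem slope_le_neg_leave (hT : 𝔠.graph.IsMultitree) {v : 𝔠.graph.V}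
    (hred : ∀ x, x ≠ v → (Multidegree.act (cob (c v)) u).RedAt v x)
    (hdeg : ∀ x, SmoothCurve.Divisor.degree (D.onCurve x) = u.vert x)
    (hedge : ∀ e t, D (.inr ⟨e, t⟩) = u.coeffEdge e t)
    {f : 𝔠.RatFn} (hf : ∀ x, 0 ≤ D x + f.ord x) {e : 𝔠.graph.E} (he : 𝔠.graph.Inc e v) :
    f.onGraph.slope e v ≤ -u.leave e v (sign e v * cob (c v) e) := by
  obtain ⟨φ, hφ, -, hφs⟩ := u.exists_isEquivVia_act (c v)
  have h1 := RatFn.slope_le_of_redAt hT hred (f.onGraph + -φ) (fun e t ht => by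
    rw [RatFn.ordEdge_add, RatFn.ordEdge_neg, hφ.2 e t ht]
    have h2 := hf (.inr ⟨e, ⟨t, ht⟩⟩)
    rw [hedge] at h2
    have h3 : f.ord (.inr ⟨e, ⟨t, ht⟩⟩) = f.onGraph.ordEdge e t := rfl
    rw [h3] at h2
    dsimp only at h2
    omega) (fun x _ => by
    rw [RatFn.ordVertex_add, RatFn.ordVertex_neg, hφ.1 x]
    have h2 := degree_onCurve_add_ordVertex_nonneg hf x
    rw [hdeg] at h2
    omega) he
  obtain ⟨v', hj⟩ := he.exists_joins
  rw [RatFn.slope_add, RatFn.slope_neg, hφs e v v' hj] at h1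
  rw [hj.sign_mul_cob]
  omega

theorem mem_sections_of_effective (hT : 𝔠.graph.IsMultitree) {v : 𝔠.graph.V}
    (hred : ∀ x, x ≠ v → (Multidegree.act (cob (c v)) u).RedAt v x)
    (hdeg : ∀ x, SmoothCurve.Divisor.degree (D.onCurve x) = u.vert x)
    (hD : IsAdapted u c A D) {f : 𝔠.RatFn} (hf : ∀ x, 0 ≤ D x + f.ord x) :
    f.onCurve v ∈ (𝔠.curve v).sections (A v) := by
  refine Or.inr fun P => ?_
  have h1 := hf (.inl ⟨v, P⟩)
  rw [ord_inl, ← Divisor.onCurve_apply, hD.1 v] at h1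
  have h2 : markDiv v (fun e => f.onGraph.slope e v) ≤
      markDiv v fun e => -u.leave e v (sign e v * cob (c v) e) :=
    markDiv_mono v fun e he => slope_le_neg_leave hT hred hdeg hD.2 hf he
  have h3 := h2 P
  have h4 : (markDiv v fun e => -u.leave e v (sign e v * cob (c v) e)) =
      -(markDiv v fun e => u.leave e v (sign e v * cob (c v) e)) := markDiv_neg v _
  rw [h4] at h3
  simp only [Finsupp.add_apply, Finsupp.neg_apply] at h1 h3
  omega

/-- Otherwise the sections of `A v` in `W v` form a subspace of dimension at most `r`, which the
component at `v` of some effective `D + div f` would avoid, contrary to `mem_sections_of_effective`.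
-/
theorem le_sections_of_rank (hT : 𝔠.graph.IsMultitree)
    (hred : ∀ v x, x ≠ v → (Multidegree.act (cob (c v)) u).RedAt v x)
    (hdeg : ∀ x, SmoothCurve.Divisor.degree (D.onCurve x) = u.vert x)
    (hD : IsAdapted u c A D) (hr : ∀ v, Module.finrank κ (W v) = r + 1)
    (h : ∀ E : 𝔠.Divisor, 0 ≤ E → E.degree = r →
      ∃ f : 𝔠.RatFn, (∀ v, f.onCurve v ∈ W v) ∧ ∀ x, 0 ≤ D x + f.ord x - E x)
    (v : 𝔠.graph.V) : W v ≤ (𝔠.curve v).sections (A v) := by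
  classical
  have hne : Nonempty 𝔠.graph.V := hT.connected.nonempty
  have hfin : ∀ v, Module.Finite κ (W v) := fun v =>
    Module.finite_of_finrank_pos (by rw [hr]; omega)
  by_contra hcon
  let N : ∀ x, Submodule κ (𝔠.curve x).RatFn := fun x =>
    if x = v then W x ⊓ (𝔠.curve x).sections (A x) else ⊥
  have hfin' : Module.Finite κ ↥(W v ⊓ (𝔠.curve v).sections (A v)) :=
    Submodule.finiteDimensional_of_le inf_le_left
  have hNv : N v = W v ⊓ (𝔠.curve v).sections (A v) := if_pos rfl
  have hNx : ∀ x, x ≠ v → N x = ⊥ := fun x hx => if_neg hx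
  have hN : ∀ x, Module.Finite κ (N x) := fun x => by
    by_cases h : x = v
    · rw [h, hNv]
      exact hfin'
    · rw [hNx x h]
      infer_instance
  have hlt : Module.finrank κ ↥(W v ⊓ (𝔠.curve v).sections (A v)) < Module.finrank κ (W v) :=
    Submodule.finrank_lt_finrank_of_lt
      (lt_of_le_of_ne inf_le_left fun heq => hcon (inf_eq_left.mp heq))
  rw [hr] at hlt
  obtain ⟨f, hf1, hf2, hf3⟩ := exists_ratFn_notMem h N (by
    rw [Finset.sum_eq_single v (fun x _ hx => by rw [hNx x hx, finrank_bot]) (by simp), hNv]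
    omega)
  have h1 := hf3 v
  rw [hNv] at h1
  exact h1 ⟨hf1 v, mem_sections_of_effective hT (hred v) hdeg hD hf2⟩

/-- A function that vanishes too little at the marked point of some edge towards `v'` must be
compensated by the slope of `f_Γ` there, and `drop_le` turns this bound on the slope into a bound on
the drop. -/
theorem drop_le_of_notMem_vanishing {v v' : 𝔠.graph.V}
    (hD : IsAdapted u c A D) (hW : W v ≤ (𝔠.curve v).sections (A v)) {f : 𝔠.RatFn}
    (hf : ∀ x, 0 ≤ D x + f.ord x) (hfW : f.onCurve v ∈ W v) {k : ℤ}
    (hfv : f.onCurve v ∉ vanishing (W v) (A v) (joinDiv v v' fun e =>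
      (Multidegree.act (cob (c v)) u).leave e v k)) :
    f.onGraph.onVertex v - f.onGraph.onVertex v' ≤ ((c v v - c v v' + k - 1 : ℤ) : ℝ) := by
  rw [mem_vanishing (f.onCurve_ne_zero v)] at hfv
  push Not at hfv
  obtain ⟨P, hP⟩ := hfv hfW
  have h1 := (hW hfW).resolve_left (f.onCurve_ne_zero v) P
  have hmark : ∃ e h, 𝔠.mark e v h = P := by
    by_contra! hno
    rw [joinDiv, markDiv_apply_of_ne v _ hno] at hP
    omega
  obtain ⟨e, he, rfl⟩ := hmark
  rw [joinDiv, markDiv_apply] at hP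
  have hj : 𝔠.graph.Joins e v v' := by
    by_contra hno
    rw [if_neg hno] at hP
    omega
  rw [if_pos hj, leave_act_of_joins u (c v) hj] at hP
  have h2 := hf (.inl ⟨v, 𝔠.mark e v he⟩)
  rw [ord_inl, markDiv_apply, ← Divisor.onCurve_apply, hD.1 v, Finsupp.add_apply, markDiv_apply,
    leave_of_joins u (c v) hj] at h2
  have h3 := f.onGraph.drop_le u hj (fun t ht => by
    have h4 := hf (.inr ⟨e, ⟨t, ht⟩⟩)
    rw [hD.2] at h4
    exact h4)
  have h4 : cl (𝔠.len e) (u.pos e v) - f.onGraph.slope e v <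
      cl (𝔠.len e) ((u.pos e v + (c v v - c v v') + k : ℤ) : ℝ) := by omega
  rw [lt_cl_iff] at h4
  have h5 : ((𝔠.len e : ℕ) : ℤ) * (cl (𝔠.len e) (u.pos e v) - f.onGraph.slope e v) <
      u.pos e v + (c v v - c v v') + k := by exact_mod_cast h4
  -- Both sides are integers, so the strict inequality gains one. This gain produces the
  -- contradiction in `vanishingCondition_of_rank`.
  have h6 : ((𝔠.len e : ℕ) : ℤ) * (cl (𝔠.len e) (u.pos e v) - f.onGraph.slope e v) ≤
      u.pos e v + (c v v - c v v') + k - 1 := by omega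
  have h7 : (𝔠.len e : ℝ) * ((cl (𝔠.len e) (u.pos e v) - f.onGraph.slope e v : ℤ) : ℝ) ≤
      ((u.pos e v + (c v v - c v v') + k - 1 : ℤ) : ℝ) := by exact_mod_cast h6
  push_cast at h3 h7 ⊢
  linarith

/-- If the codimensions add up to more than `r + 1`, the two vanishing subspaces have total
dimension at most `r` and can be avoided simultaneously. The resulting bounds on the drops from `v`
to `v'` and from `v'` to `v` add up to `-1`. -/
theorem vanishingCondition_of_rank (hT : 𝔠.graph.IsMultitree)
    (hD : IsAdapted u c A D) (hr : ∀ v, Module.finrank κ (W v) = r + 1)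
    (hW : ∀ v, W v ≤ (𝔠.curve v).sections (A v))
    (h : ∀ E : 𝔠.Divisor, 0 ≤ E → E.degree = r →
      ∃ f : 𝔠.RatFn, (∀ v, f.onCurve v ∈ W v) ∧ ∀ x, 0 ≤ D x + f.ord x - E x) :
    VanishingCondition u c A W r := by
  classical
  have hne : Nonempty 𝔠.graph.V := hT.connected.nonempty
  have hfin : ∀ v, Module.Finite κ (W v) := fun v =>
    Module.finite_of_finrank_pos (by rw [hr]; omega)
  intro v v' hadj j
  by_contra! hcon
  set b : ℤ := (c v v' - c v' v') - (c v v - c v' v) with hb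
  set B : (𝔠.curve v).Divisor := joinDiv v v' fun e =>
    (Multidegree.act (cob (c v)) u).leave e v (j + 1)
  set B' : (𝔠.curve v').Divisor := joinDiv v' v fun e =>
    (Multidegree.act (cob (c v')) u).leave e v' (b - j)
  let N : ∀ x, Submodule κ (𝔠.curve x).RatFn := fun x =>
    if h : x = v then h ▸ vanishing (W v) (A v) B
    else if h : x = v' then h ▸ vanishing (W v') (A v') B' else ⊥
  have hNv : N v = vanishing (W v) (A v) B := dif_pos rfl
  have hNv' : N v' = vanishing (W v') (A v') B' :=
    (dif_neg hadj.ne').trans (dif_pos rfl)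
  have hNx : ∀ x, x ≠ v → x ≠ v' → N x = ⊥ := by
    intro x h1 h2
    simp only [N]
    rw [dif_neg h1, dif_neg h2]
  have hN : ∀ x, Module.Finite κ (N x) := fun x => by
    by_cases h1 : x = v
    · subst h1
      rw [hNv]
      exact finite_vanishing _ _ _
    · by_cases h2 : x = v'
      · subst h2
        rw [hNv']
        exact finite_vanishing _ _ _
      · rw [hNx x h1 h2]
        infer_instance
  obtain ⟨f, hf1, hf2, hf3⟩ := exists_ratFn_notMem h N (by
    rw [← Finset.add_sum_erase _ _ (Finset.mem_univ v), ← Finset.add_sum_erase _ _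
      (Finset.mem_erase.mpr ⟨hadj.ne', Finset.mem_univ v'⟩), Finset.sum_eq_zero, hNv, hNv']
    · have h1 := finrank_vanishing_add_codim (W := W v) (A := A v) B
      have h2 := finrank_vanishing_add_codim (W := W v') (A := A v') B'
      rw [hr] at h1 h2
      omega
    · intro x hx
      rw [Finset.mem_erase, Finset.mem_erase] at hx
      rw [hNx x hx.2.1 hx.1, finrank_bot])
  have h1 := hf3 v
  rw [hNv] at h1
  have h2 := hf3 v'
  rw [hNv'] at h2
  have h3 := drop_le_of_notMem_vanishing hD (hW v) hf2 (hf1 v) h1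
  have h4 := drop_le_of_notMem_vanishing hD (hW v') hf2 (hf1 v') h2
  rw [hb] at h4
  push_cast at h3 h4
  linarith

end Backward

end MetrizedComplex

end

noncomputable section

/-! ## Invariance of degrees -/

namespace MGraph

open Classical in
-- Seen from both ends of an edge, the ceilings count the chip in its interior.
theorem cl_add_cl_neg (n : ℕ+) (a : ℤ) :
    cl n a + cl n (-a) = if (a : ZMod n) = 0 then 0 else 1 := by
  split_ifs with h
  · rw [ZMod.intCast_zmod_eq_zero_iff_dvd] at h
    obtain ⟨k, rfl⟩ := h
    have h1 := cl_add_mul n 0 k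
    have h2 := cl_add_mul n 0 (-k)
    push_cast at h1 h2 ⊢
    rw [zero_add] at h1 h2
    rw [h1, ← mul_neg, h2, show cl n 0 = 0 by simp [cl]]
    ring
  · have h1 := (cl_le_iff n a (cl n a)).mp le_rfl
    have h2 := (lt_cl_iff n a (cl n a - 1)).mp (by omega)
    have h3 : (a : ℝ) ≠ n * (cl n a : ℤ) := fun h4 => h (by
      rw [ZMod.intCast_zmod_eq_zero_iff_dvd]
      exact ⟨cl n a, by exact_mod_cast h4⟩)
    have h4 : cl n (-a) ≤ -(cl n a - 1) := by
      rw [cl_le_iff]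
      push_cast at h2 ⊢
      linarith
    have h5 : -(cl n a) < cl n (-a) := by
      rw [lt_cl_iff]
      push_cast
      have := lt_of_le_of_ne h1 h3
      linarith
    omega

variable {G : MGraph.{u}} {n : G.ChainStructure}

open Classical in
theorem sum_ite_inc (e : G.E) (F : G.V → ℤ) :
    ∑ v, (if G.Inc e v then F v else 0) = F (G.tail e) + F (G.head e) := by
  have h : ∀ v, (if G.Inc e v then F v else 0) =
      (if G.tail e = v then F v else 0) + if G.head e = v then F v else 0 := by
    intro v
    have := G.tail_ne_head e
    unfold Inc
    by_cases h1 : G.tail e = v <;> by_cases h2 : G.head e = v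
    · exact absurd (h1.trans h2.symm) this
    all_goals simp [h1, h2]
  simp_rw [h]
  rw [Finset.sum_add_distrib, Finset.sum_ite_eq, Finset.sum_ite_eq]
  simp

namespace Multidegree

open Classical in
theorem degree_eq_sum (w : Multidegree G n) :
    w.degree = ∑ v, w.vert v + ∑ e, if w.edge e = 0 then 0 else 1 := by
  unfold degree
  rw [finsum_eq_sum_of_fintype, Set.ncard_eq_toFinset_card']
  congr 1
  rw [Finset.sum_ite, Finset.sum_const_zero, zero_add, Finset.sum_const, nsmul_one]
  congr 2
  ext e
  simp

/-- On each edge, the chips leaving the two endpoints account for the change in the number of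
interior chips. -/
theorem degree_act (δ : G.E → ℤ) (w : Multidegree G n) : (act δ w).degree = w.degree := by
  classical
  have hedge : ∀ e, w.leave e (G.tail e) (sign e (G.tail e) * δ e) +
      w.leave e (G.head e) (sign e (G.head e) * δ e) =
      (if (act δ w).edge e = 0 then 0 else 1) - if w.edge e = 0 then 0 else 1 := by
    intro e
    have h1 := cl_add_cl_neg (n e) ((w.edge e).val + δ e)
    have h2 := cl_add_cl_neg (n e) (w.edge e).val
    have h3 : (((w.edge e).val : ℤ) : ZMod (n e)) = w.edge e := by simp
    push_cast at h1 h2 h3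
    rw [h3] at h1 h2
    rw [show (act δ w).edge e = w.edge e + (δ e : ZMod (n e)) from rfl, ← h1, ← h2]
    unfold leave pos
    rw [sign_tail, sign_head]
    push_cast
    rw [show -((w.edge e).val + (δ e) : ℝ) = -1 * ((w.edge e).val : ℝ) + -1 * (δ e : ℝ) by ring]
    simp only [one_mul, neg_mul]
    ring
  rw [degree_eq_sum, degree_eq_sum]
  have h1 : ∑ v, (act δ w).vert v = ∑ v, w.vert v -
      ∑ e, ((if (act δ w).edge e = 0 then 0 else 1) - if w.edge e = 0 then 0 else 1 : ℤ) := by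
    simp_rw [← hedge]
    change ∑ v, (w.vert v - _) = _
    rw [Finset.sum_sub_distrib, Finset.sum_comm]
    simp_rw [sum_ite_inc]
  rw [h1, Finset.sum_sub_distrib]
  ring

theorem degree_eq_of_reaches {w w' : Multidegree G n} (h : Reaches w w') : w'.degree = w.degree := by
  obtain ⟨c, rfl⟩ := (reaches_iff _ _).mp h
  exact degree_act _ _

end Multidegree

end MGraph

/-! ## Multiplication by a rational function -/

namespace SmoothCurve

variable {κ : Type u} [Field κ] {C : SmoothCurve κ}

theorem mulRight_eq_mulLeft (g : C.RatFn) : LinearMap.mulRight κ g = LinearMap.mulLeft κ g :=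
  LinearMap.ext fun f => mul_comm f g

theorem map_mulLeft_mulLeft (W : Submodule κ C.RatFn) (g h : C.RatFn) :
    (W.map (LinearMap.mulLeft κ g)).map (LinearMap.mulLeft κ h) =
      W.map (LinearMap.mulLeft κ (h * g)) := by
  rw [LinearMap.mulLeft_mul, Submodule.map_comp]

theorem mulLeft_injective {g : C.RatFn} (hg : g ≠ 0) :
    Function.Injective (LinearMap.mulLeft κ g) := fun _ _ h => mul_left_cancel₀ hg h

theorem finrank_map_mulLeft (W : Submodule κ C.RatFn) {g : C.RatFn} (hg : g ≠ 0) :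
    Module.finrank κ (W.map (LinearMap.mulLeft κ g)) = Module.finrank κ W :=
  (Submodule.equivMapOfInjective _ (mulLeft_injective hg) W).finrank_eq.symm

variable [IsAlgClosed κ]

theorem map_mulLeft_sections (A : C.Divisor) {g : C.RatFn} (hg : g ≠ 0) :
    (C.sections A).map (LinearMap.mulLeft κ g) = C.sections (A - C.divOf g) := by
  have key : ∀ (A : C.Divisor) {g : C.RatFn}, g ≠ 0 → ∀ f ∈ C.sections A,
      g * f ∈ C.sections (A - C.divOf g) := by
    intro A g hg f hf
    by_cases h0 : f = 0
    · rw [h0, mul_zero]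
      exact zero_mem _
    refine Or.inr fun P => ?_
    have h1 := hf.resolve_left h0 P
    rw [C.ord_mul hg h0, Finsupp.sub_apply, divOf_apply]
    omega
  ext f
  constructor
  · rintro ⟨f, hf, rfl⟩
    exact key A hg f hf
  · intro hf
    refine ⟨g⁻¹ * f, ?_, mul_inv_cancel_left₀ hg f⟩
    have h1 := key _ (inv_ne_zero hg) f hf
    have h2 : A - C.divOf g - C.divOf g⁻¹ = A := by
      ext P
      simp [C.ord_inv hg]
    rwa [h2] at h1

theorem map_mulLeft_vanishing (W : Submodule κ C.RatFn) (A B : C.Divisor) {g : C.RatFn}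
    (hg : g ≠ 0) : (vanishing W A B).map (LinearMap.mulLeft κ g) =
      vanishing (W.map (LinearMap.mulLeft κ g)) (A - C.divOf g) B := by
  unfold vanishing
  rw [Submodule.map_inf _ (mulLeft_injective hg), map_mulLeft_sections _ hg, sub_right_comm]

theorem codimVanishing_map_mulLeft (W : Submodule κ C.RatFn) (A B : C.Divisor) {g : C.RatFn}
    (hg : g ≠ 0) : codimVanishing (W.map (LinearMap.mulLeft κ g)) (A - C.divOf g) B =
      codimVanishing W A B := by
  unfold codimVanishing
  rw [← map_mulLeft_vanishing _ _ _ hg, finrank_map_mulLeft _ hg, finrank_map_mulLeft _ hg]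

end SmoothCurve

end

/-! ## Equivalence of limit linear series -/

noncomputable section

open MGraph

namespace MGraph

variable {G : MGraph.{u}} {n : G.ChainStructure}

namespace RatFn

instance : Zero (RatFn G n) where
  zero :=
    { onVertex := 0
      onEdge := fun _ _ => 0
      onEdge_tail := fun _ => rfl
      onEdge_head := fun _ => rfl
      exists_slope_right := fun _ _ _ => ⟨0, by simp⟩
      exists_slope_left := fun _ _ _ => ⟨0, by simp⟩ }

theorem slopeRight_zero (e : G.E) (t : ℝ) : (0 : RatFn G n).slopeRight e t = 0 := by
  by_cases ht : t ∈ Set.Ico (0 : ℝ) (n e)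
  · exact slopeRight_eq ht (Eventually.of_forall fun s => by change (0 : ℝ) = 0 + _; simp)
  · exact dif_neg ht

theorem slopeLeft_zero (e : G.E) (t : ℝ) : (0 : RatFn G n).slopeLeft e t = 0 := by
  by_cases ht : t ∈ Set.Ioc (0 : ℝ) (n e)
  · exact slopeLeft_eq ht (Eventually.of_forall fun s => by change (0 : ℝ) = 0 + _; simp)
  · exact dif_neg ht

theorem slope_zero (e : G.E) (v : G.V) : (0 : RatFn G n).slope e v = 0 := by
  unfold slope
  split_ifs
  · exact slopeRight_zero e 0
  · exact slopeLeft_zero e _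

theorem ordEdge_zero (e : G.E) (t : ℝ) : (0 : RatFn G n).ordEdge e t = 0 := by
  unfold ordEdge
  rw [slopeRight_zero, slopeLeft_zero, add_zero]

end RatFn

theorem Multidegree.IsEquivVia.add {u u' w : Multidegree G n} {f f' : RatFn G n}
    (h : u.IsEquivVia u' f) (h' : u'.IsEquivVia w f') : u.IsEquivVia w (f + f') :=
  ⟨fun v => by rw [h'.1, h.1, RatFn.ordVertex_add, add_assoc],
    fun e t ht => by rw [h'.2 e t ht, h.2 e t ht, RatFn.ordEdge_add, add_assoc]⟩

end MGraph

namespace MetrizedComplex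

open SmoothCurve

variable {κ : Type u} [Field κ] {𝔠 : MetrizedComplex κ}

/-- Needed for injectivity: equality in the quotient only gives the equivalence relation generated
by `Equivalent`. -/
theorem LimitPair.equivalence_equivalent [IsAlgClosed κ] {d : ℤ} {r : ℕ} :
    Equivalence (LimitPair.Equivalent (𝔠 := 𝔠) (d := d) (r := r)) where
  refl x := by
    refine ⟨⟨0, fun _ => 1, fun _ => one_ne_zero⟩, ?_, fun v => ?_⟩
    · rintro (⟨v, P⟩ | ⟨e, t⟩)
      · rw [ord_inl, (𝔠.curve v).ord_one]
        simp only [RatFn.slope_zero]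
        rw [show (markDiv v fun _ => (0 : ℤ)) = 0 from markDiv_zero v]
        simp
      · change _ = _ + MGraph.RatFn.ordEdge 0 e t
        rw [RatFn.ordEdge_zero, add_zero]
    · rw [show LinearMap.mulRight κ (1 : (𝔠.curve v).RatFn) = LinearMap.id from
        LinearMap.mulRight_one _ _, Submodule.map_id]
  symm := by
    rintro x y ⟨f, hD, hH⟩
    refine ⟨⟨-f.onGraph, fun v => (f.onCurve v)⁻¹, fun v => inv_ne_zero (f.onCurve_ne_zero v)⟩,
      ?_, fun v => ?_⟩
    · rintro (⟨v, P⟩ | ⟨e, t⟩)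
      · rw [ord_inl, (𝔠.curve v).ord_inv (f.onCurve_ne_zero v), hD, ord_inl]
        simp only [RatFn.slope_neg]
        rw [show (markDiv v fun e => -f.onGraph.slope e v) =
          -markDiv v fun e => f.onGraph.slope e v from markDiv_neg v _]
        simp only [Finsupp.neg_apply]
        ring
      · rw [hD]
        change _ = _ + f.onGraph.ordEdge e t + MGraph.RatFn.ordEdge (-f.onGraph) e t
        rw [RatFn.ordEdge_neg]
        ring
    · rw [hH, ← Submodule.map_comp, ← LinearMap.mulRight_mul,
        mul_inv_cancel₀ (f.onCurve_ne_zero v), LinearMap.mulRight_one, Submodule.map_id]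
  trans := by
    rintro x y z ⟨f, hD, hH⟩ ⟨f', hD', hH'⟩
    refine ⟨⟨f.onGraph + f'.onGraph, fun v => f.onCurve v * f'.onCurve v,
      fun v => mul_ne_zero (f.onCurve_ne_zero v) (f'.onCurve_ne_zero v)⟩, ?_, fun v => ?_⟩
    · rintro (⟨v, P⟩ | ⟨e, t⟩)
      · rw [ord_inl, (𝔠.curve v).ord_mul (f.onCurve_ne_zero v) (f'.onCurve_ne_zero v), hD', hD,
          ord_inl, ord_inl]
        simp only [RatFn.slope_add]
        rw [show (markDiv v fun e => f.onGraph.slope e v + f'.onGraph.slope e v) =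
          (markDiv v fun e => f.onGraph.slope e v) + markDiv v fun e => f'.onGraph.slope e v from
            markDiv_add v _ _]
        simp only [Finsupp.add_apply]
        ring
      · rw [hD', hD]
        change _ + f.onGraph.ordEdge e t + f'.onGraph.ordEdge e t =
          _ + MGraph.RatFn.ordEdge (f.onGraph + f'.onGraph) e t
        rw [RatFn.ordEdge_add]
        ring
    · rw [hH, hH', ← Submodule.map_comp, ← LinearMap.mulRight_mul, mul_comm]

variable [IsAlgClosed κ]

/-- Nonnegativity of the coefficients ensures that the twist counts exist and equal the differences
of potentials; otherwise `twistCount` could be the default value of an infimum over the empty set.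
-/
theorem vanishingCondition_iff (hT : 𝔠.graph.IsMultitree) {u : Multidegree 𝔠.graph 𝔠.len}
    {w : 𝔠.graph.V → Multidegree 𝔠.graph 𝔠.len} {c : 𝔠.graph.V → 𝔠.graph.V → ℤ}
    (hw : ∀ v, w v = Multidegree.act (cob (c v)) u) (hred : ∀ v x, x ≠ v → (w v).RedAt v x)
    (hpos : ∀ v, 0 ≤ (w v).vert v) {A : ∀ v, (𝔠.curve v).Divisor}
    {W : ∀ v, Submodule κ (𝔠.curve v).RatFn} {r : ℕ} :
    VanishingCondition u c A W r ↔ ∀ v v', 𝔠.graph.bar.Adj v v' → ∀ j : ℤ,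
      codimVanishing (W v) (A v) (joinDiv v v' fun e => (w v).leave e v (j + 1)) +
      codimVanishing (W v') (A v') (joinDiv v' v fun e =>
        (w v').leave e v' (Multidegree.twistCount w v v' - j)) ≤ r + 1 := by
  have htw : ∀ v v', 𝔠.graph.bar.Adj v v' → (Multidegree.twistCount w v v' : ℤ) =
      (c v v' - c v' v') - (c v v - c v' v) := by
    intro v v' hadj
    have h1 : w v = Multidegree.act (cob (c v - c v')) (w v') := by
      rw [hw v, hw v', Multidegree.act_act, ← Multidegree.cob_add, add_sub_cancel]
    have h2 : ∀ e, ¬ 𝔠.graph.Joins e v v' → cob (c v - c v') e = 0 := fun e he =>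
      Multidegree.cob_eq_zero_of_adj hT hadj (hred v') (h1 ▸ hred v) he
    exact Multidegree.twistCount_eq hadj h1 h2
      (Multidegree.twistCount_nonneg hT hadj (hred v' v hadj.ne) h2 (h1 ▸ hpos v))
  refine forall₂_congr fun v v' => forall_congr' fun hadj => ?_
  rw [htw v v' hadj, hw v, hw v']

/-- A nonzero section forces a nonnegative degree. So there are no pre-limit linear series if some
coefficient is negative, whatever `twistCount` is. -/
theorem PreLimitData.vert_nonneg {w : 𝔠.graph.V → Multidegree 𝔠.graph 𝔠.len} {r : ℕ}
    (x : 𝔠.PreLimitData w r) (v : 𝔠.graph.V) : 0 ≤ (w v).vert v := by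
  have h : Nontrivial (x.W v) :=
    Module.nontrivial_of_finrank_pos (R := κ) (by rw [x.finrank_eq]; omega)
  obtain ⟨f, hf⟩ := exists_ne (0 : x.W v)
  rw [← x.degree_eq]
  exact degree_nonneg_of_mem_sections (by simpa using hf) (x.le_sections v f.2)

theorem degree_markDiv_leave (u : Multidegree 𝔠.graph 𝔠.len) (c : 𝔠.graph.V → ℤ) (v : 𝔠.graph.V) :
    SmoothCurve.Divisor.degree (markDiv v fun e => u.leave e v (sign e v * cob c e)) =
      u.vert v - (Multidegree.act (cob c) u).vert v := by
  classical
  rw [degree_markDiv]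
  change _ = u.vert v - (u.vert v - _)
  rw [sub_sub_cancel]

theorem markDiv_slope_of_isEquivVia (hT : 𝔠.graph.IsMultitree) {u : Multidegree 𝔠.graph 𝔠.len}
    {c : 𝔠.graph.V → ℤ} {v : 𝔠.graph.V}
    (hred : ∀ x, x ≠ v → (Multidegree.act (cob c) u).RedAt v x) {f : MGraph.RatFn 𝔠.graph 𝔠.len}
    (hf : u.IsEquivVia (Multidegree.act (cob c) u) f) :
    (markDiv v fun e => f.slope e v) = -markDiv v fun e => u.leave e v (sign e v * cob c e) := by
  obtain ⟨φ, hφ, -, hφs⟩ := u.exists_isEquivVia_act c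
  rw [← markDiv_neg]
  refine markDiv_congr v fun e he => ?_
  obtain ⟨v', hj⟩ := he.exists_joins
  rw [RatFn.slope_eq_of_isEquivVia hT hred hf hφ he, hφs e v v' hj, ← hj.sign_mul_cob]
  rfl

theorem Divisor.finsum_eq_degree_onCurve (D : 𝔠.Divisor) (v : 𝔠.graph.V) :
    ∑ᶠ P, D (.inl ⟨v, P⟩) = SmoothCurve.Divisor.degree (D.onCurve v) := by
  change ∑ᶠ P, D.onCurve v P = _
  rw [finsum_eq_sum_of_support_subset _ (s := (D.onCurve v).support) (by simp)]
  rfl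

theorem IsAdapted.isOfMultidegree {u : Multidegree 𝔠.graph 𝔠.len}
    {c : 𝔠.graph.V → 𝔠.graph.V → ℤ} {A : ∀ v, (𝔠.curve v).Divisor} {D : 𝔠.Divisor}
    (hD : IsAdapted u c A D)
    (hA : ∀ v, (A v).degree = (Multidegree.act (cob (c v)) u).vert v) : D.IsOfMultidegree u := by
  refine ⟨fun v => ?_, hD.2⟩
  rw [D.finsum_eq_degree_onCurve, hD.1 v, SmoothCurve.Divisor.degree_add, degree_markDiv_leave, hA]
  ring

theorem Divisor.IsOfMultidegree.degree_onCurve {D : 𝔠.Divisor} {u : Multidegree 𝔠.graph 𝔠.len}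
    (hD : D.IsOfMultidegree u) (v : 𝔠.graph.V) :
    SmoothCurve.Divisor.degree (D.onCurve v) = u.vert v := by
  rw [← hD.1 v, D.finsum_eq_degree_onCurve]

end MetrizedComplex

end

/-! ## The forgetful map -/

noncomputable section

open MGraph

namespace MetrizedComplex

open SmoothCurve

variable {κ : Type u} [Field κ] [IsAlgClosed κ] {𝔠 : MetrizedComplex κ}
  {w₀ : Multidegree 𝔠.graph 𝔠.len} {w : 𝔠.graph.V → Multidegree 𝔠.graph 𝔠.len} {r : ℕ}

theorem Divisor.IsOfMultidegree.degree_eq {D : 𝔠.Divisor} {u : Multidegree 𝔠.graph 𝔠.len}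
    (hD : D.IsOfMultidegree u) : D.degree = u.degree := by
  classical
  rw [Divisor.degree_eq, Multidegree.degree_eq_sum]
  congr 1
  · exact Finset.sum_congr rfl fun v _ => hD.degree_onCurve v
  · refine Finset.sum_congr rfl fun e _ => ?_
    have h1 : D.onEdge e = if u.edge e = 0 then 0 else Finsupp.single ((u.edge e).val : ℝ) 1 := by
      ext t
      by_cases ht : t ∈ Set.Ioo (0 : ℝ) (𝔠.len e)
      · rw [D.onEdge_apply e ⟨t, ht⟩, hD.2]
        unfold Multidegree.coeffEdge
        by_cases h0 : u.edge e = 0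
        · rw [if_pos h0, h0, if_neg (by simpa using ht.1.ne)]
          rfl
        · rw [if_neg h0, Finsupp.single_apply]
      · rw [D.onEdge_apply_of_notMem e ht]
        split_ifs with h0
        · rfl
        · rw [Finsupp.single_apply, if_neg]
          rintro rfl
          refine ht ⟨?_, ?_⟩
          · exact_mod_cast Nat.pos_of_ne_zero (by simpa using h0)
          · exact_mod_cast ZMod.val_lt (u.edge e)
    rw [h1]
    split_ifs
    · exact Finsupp.sum_zero_index
    · exact Finsupp.sum_single_index rfl

theorem exists_eq_act (hred : Multidegree.IsReducedTuple w₀ w) {u : Multidegree 𝔠.graph 𝔠.len}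
    (hu : Multidegree.Reaches w₀ u) :
    ∃ c : 𝔠.graph.V → 𝔠.graph.V → ℤ, ∀ v, w v = Multidegree.act (cob (c v)) u := by
  choose c hc using fun v => Multidegree.reaches_equivalence hu (hred v).1
  exact ⟨c, hc⟩

theorem redAt_of_isReducedTuple (hT : 𝔠.graph.IsMultitree) (hred : Multidegree.IsReducedTuple w₀ w)
    (v x : 𝔠.graph.V) (hx : x ≠ v) : (w v).RedAt v x :=
  (Multidegree.isReduced_iff hT).mp (hred v).2 x hx

theorem PreLimitData.exists_isForgetfulPair (hT : 𝔠.graph.IsMultitree)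
    (hred : Multidegree.IsReducedTuple w₀ w) (x : 𝔠.PreLimitData w r)
    (s : ∀ v, (𝔠.curve v).RatFn) (hs : ∀ v, s v ≠ 0) {u : Multidegree 𝔠.graph 𝔠.len}
    (hu : Multidegree.Reaches w₀ u) : ∃ y : 𝔠.LimitPair w₀.degree r, IsForgetfulPair x s u y := by
  obtain ⟨c, hc⟩ := exists_eq_act hred hu
  have hr := redAt_of_isReducedTuple hT hred
  have hs' : ∀ v, (s v)⁻¹ ≠ 0 := fun v => inv_ne_zero (hs v)
  -- Dividing all sections by `s v` replaces `A_v` by the linearly equivalent divisor `A_v + div (s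
  -- v)`; the codimensions do not change.
  let A : ∀ v, (𝔠.curve v).Divisor := fun v => x.A v - (𝔠.curve v).divOf (s v)⁻¹
  let W : ∀ v, Submodule κ (𝔠.curve v).RatFn := fun v =>
    (x.W v).map (LinearMap.mulLeft κ (s v)⁻¹)
  have hW : ∀ v, W v ≤ (𝔠.curve v).sections (A v) := fun v => by
    rw [← map_mulLeft_sections _ (hs' v)]
    exact Submodule.map_mono (x.le_sections v)
  have hWr : ∀ v, Module.finrank κ (W v) = r + 1 := fun v => by
    rw [finrank_map_mulLeft _ (hs' v), x.finrank_eq]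
  have hcond : VanishingCondition u c A W r := by
    rw [vanishingCondition_iff hT hc hr x.vert_nonneg]
    intro v v' hadj j
    rw [codimVanishing_map_mulLeft _ _ _ (hs' v), codimVanishing_map_mulLeft _ _ _ (hs' v')]
    exact (exists_isMultivanishing_iff x.le_sections x.finrank_eq).mp x.vanishing_le v v' hadj j
  let D : 𝔠.Divisor := Divisor.ofParts
    (fun v => A v + markDiv v fun e => u.leave e v (sign e v * cob (c v) e))
    fun e => Finsupp.single ((u.edge e).val : ℝ) 1
  have hD : IsAdapted u c A D := by
    refine ⟨fun v => Divisor.onCurve_ofParts _ _ v, fun e t => ?_⟩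
    classical
    change Finsupp.single ((u.edge e).val : ℝ) (1 : ℤ) t.1 = _
    rw [Finsupp.single_apply]
    rfl
  have hDu : D.IsOfMultidegree u := hD.isOfMultidegree fun v => by
    rw [Divisor.degree_sub, (𝔠.curve v).degree_divOf (hs' v), sub_zero, x.degree_eq, hc]
  refine ⟨⟨D, W, hDu.degree_eq.trans (Multidegree.degree_eq_of_reaches hu), hWr,
    hasRestrictedRank_of_vanishingCondition hT hW hWr hcond hD⟩, hDu, fun v => ?_, fun v => rfl⟩
  obtain ⟨φ, hφ, -⟩ := u.exists_isEquivVia_act (c v)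
  refine ⟨φ, hc v ▸ hφ, fun P => ?_⟩
  rw [slopeAt_eq, markDiv_slope_of_isEquivVia hT (hc v ▸ hr v) hφ]
  change x.A v P - (𝔠.curve v).ord (s v)⁻¹ P + _ = _
  rw [(𝔠.curve v).ord_inv (hs v), Finsupp.neg_apply]
  ring

theorem markDiv_slope_eq (hT : 𝔠.graph.IsMultitree) (hred : Multidegree.IsReducedTuple w₀ w)
    {u : Multidegree 𝔠.graph 𝔠.len} {v : 𝔠.graph.V} {f f' : MGraph.RatFn 𝔠.graph 𝔠.len}
    (h : u.IsEquivVia (w v) f) (h' : u.IsEquivVia (w v) f') :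
    (markDiv v fun e => f.slope e v) = markDiv v fun e => f'.slope e v :=
  markDiv_congr v fun _ he =>
    RatFn.slope_eq_of_isEquivVia hT (redAt_of_isReducedTuple hT hred v) h h' he

theorem markDiv_slope_add (v : 𝔠.graph.V) (f f' : MGraph.RatFn 𝔠.graph 𝔠.len) :
    (markDiv v fun e => (f + f').slope e v) =
      (markDiv v fun e => f.slope e v) + markDiv v fun e => f'.slope e v := by
  simp only [RatFn.slope_add]
  exact markDiv_add v _ _

theorem IsForgetfulPair.equivalent (hT : 𝔠.graph.IsMultitree)
    (hred : Multidegree.IsReducedTuple w₀ w) {x x' : 𝔠.PreLimitData w r} (hx : x.Isomorphic x')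
    {s s' : ∀ v, (𝔠.curve v).RatFn} (hs : ∀ v, s v ≠ 0) (hs' : ∀ v, s' v ≠ 0)
    {u u' : Multidegree 𝔠.graph 𝔠.len} (hu : Multidegree.Reaches w₀ u)
    (hu' : Multidegree.Reaches w₀ u') {d : ℤ} {y y' : 𝔠.LimitPair d r}
    (hy : IsForgetfulPair x s u y) (hy' : IsForgetfulPair x' s' u' y') : y.Equivalent y' := by
  obtain ⟨g, hg⟩ := hx
  obtain ⟨c, rfl⟩ := Multidegree.reaches_equivalence hu hu'
  obtain ⟨ψ, hψ, -⟩ := u.exists_isEquivVia_act c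
  have h1 : ∀ v, s v * g v ≠ 0 := fun v => mul_ne_zero (hs v) (hg v).1
  -- Here `ψ` relates the two multidegrees, and the quotient on each curve compares the
  -- normalizations `W_v / s v` and `g v * W_v / s' v`.
  refine ⟨⟨ψ, fun v => s' v * (s v * g v)⁻¹,
    fun v => mul_ne_zero (hs' v) (inv_ne_zero (h1 v))⟩, ?_, fun v => ?_⟩
  · rintro (⟨v, P⟩ | ⟨e, t⟩)
    · obtain ⟨φ, hφ, hφD⟩ := hy.2.1 v
      obtain ⟨φ', hφ', hφD'⟩ := hy'.2.1 v
      have h2 := markDiv_slope_eq hT hred hφ (hψ.add hφ')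
      rw [markDiv_slope_add] at h2
      rw [hφD, hφD', ord_inl, slopeAt_eq, slopeAt_eq, h2, (hg v).2.1,
        (𝔠.curve v).ord_mul (hs' v) (inv_ne_zero (h1 v)), (𝔠.curve v).ord_inv (h1 v),
        (𝔠.curve v).ord_mul (hs v) (hg v).1, Finsupp.add_apply]
      ring
    · rw [hy.1.2, hy'.1.2]
      exact hψ.2 e t t.2
  · rw [hy.2.2, hy'.2.2, (hg v).2.2, mulRight_eq_mulLeft, map_mulLeft_mulLeft,
      map_mulLeft_mulLeft]
    congr 2
    have h2 := hs v
    have h3 := hs' v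
    have h4 := (hg v).1
    field_simp

/-- Comparing `Γ`-parts, the graph part of the equivalence relates `D_u` to itself. Hence the slopes
at `v` in the two descriptions of the divisor cancel, and only the rational functions on the curves
remain; they give the isomorphism. -/
theorem IsForgetfulPair.isomorphic (hT : 𝔠.graph.IsMultitree)
    (hred : Multidegree.IsReducedTuple w₀ w) {x x' : 𝔠.PreLimitData w r}
    {s s' : ∀ v, (𝔠.curve v).RatFn} (hs : ∀ v, s v ≠ 0) (hs' : ∀ v, s' v ≠ 0)
    {u : Multidegree 𝔠.graph 𝔠.len} {d : ℤ} {y y' : 𝔠.LimitPair d r}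
    (hy : IsForgetfulPair x s u y) (hy' : IsForgetfulPair x' s' u y') (h : y.Equivalent y') :
    x.Isomorphic x' := by
  obtain ⟨f, hD, hH⟩ := h
  have hf : ∀ v, f.onCurve v ≠ 0 := f.onCurve_ne_zero
  have h1 : ∀ v, y'.D.onCurve v = y.D.onCurve v + ((𝔠.curve v).divOf (f.onCurve v) +
      markDiv v fun e => f.onGraph.slope e v) := fun v => by
    ext P
    have := hD (.inl ⟨v, P⟩)
    rw [ord_inl] at this
    simpa [Divisor.onCurve_apply] using this
  have hψ : u.IsEquivVia u f.onGraph := by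
    refine ⟨fun v => ?_, fun e t ht => ?_⟩
    · have h2 := congrArg SmoothCurve.Divisor.degree (h1 v)
      rwa [SmoothCurve.Divisor.degree_add, SmoothCurve.Divisor.degree_add,
        (𝔠.curve v).degree_divOf (hf v), zero_add, degree_markDiv_slope,
        hy.1.degree_onCurve, hy'.1.degree_onCurve] at h2
    · have h2 := hD (.inr ⟨e, ⟨t, ht⟩⟩)
      rwa [hy.1.2, hy'.1.2] at h2
  refine ⟨fun v => s' v * (s v * f.onCurve v)⁻¹, fun v => ⟨?_, fun P => ?_, ?_⟩⟩
  · exact mul_ne_zero (hs' v) (inv_ne_zero (mul_ne_zero (hs v) (hf v)))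
  · obtain ⟨φ, hφ, hφD⟩ := hy.2.1 v
    obtain ⟨φ', hφ', hφD'⟩ := hy'.2.1 v
    have h2 := markDiv_slope_eq hT hred hφ (hψ.add hφ')
    rw [markDiv_slope_add] at h2
    have h3 := congrArg (fun B => B P) (h1 v)
    simp only [Finsupp.add_apply, Divisor.onCurve_apply, divOf_apply] at h3
    rw [hφD, hφD', slopeAt_eq, slopeAt_eq, h2, Finsupp.add_apply] at h3
    rw [(𝔠.curve v).ord_mul (hs' v) (inv_ne_zero (mul_ne_zero (hs v) (hf v))),
      (𝔠.curve v).ord_inv (mul_ne_zero (hs v) (hf v)), (𝔠.curve v).ord_mul (hs v) (hf v)]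
    linarith
  · have h2 := hH v
    rw [hy.2.2, hy'.2.2, mulRight_eq_mulLeft, map_mulLeft_mulLeft] at h2
    have h3 := congrArg (Submodule.map (LinearMap.mulLeft κ (s' v * (f.onCurve v)⁻¹))) h2
    rw [map_mulLeft_mulLeft, map_mulLeft_mulLeft] at h3
    have h4 := hs v
    have h5 := hs' v
    have h6 := hf v
    rw [show s' v * (f.onCurve v)⁻¹ * (f.onCurve v * (s' v)⁻¹) = 1 by field_simp,
      LinearMap.mulLeft_one, Submodule.map_id] at h3
    rw [← h3]
    congr 2
    field_simp

/-- Surjectivity: `A_v` is read off from the `C_v`-part of the divisor by undoing the slopes towards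
the `v`-reduced multidegree, and the rank supplies both the inclusion in the sections of `A_v` and
the vanishing conditions. The sections divided by are the constants `1`, which need not belong to
`H_v`. -/
theorem LimitPair.exists_isForgetfulPair (hT : 𝔠.graph.IsMultitree)
    (hred : Multidegree.IsReducedTuple w₀ w) {d : ℤ} (y : 𝔠.LimitPair d r)
    (hy : y.D.IsOfMultidegree w₀) :
    ∃ x : 𝔠.PreLimitData w r, IsForgetfulPair x (fun _ => 1) w₀ y := by
  obtain ⟨c, hc⟩ := exists_eq_act hred (Relation.ReflTransGen.refl)
  have hr : ∀ v x, x ≠ v → (Multidegree.act (cob (c v)) w₀).RedAt v x := fun v =>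
    hc v ▸ redAt_of_isReducedTuple hT hred v
  let A : ∀ v, (𝔠.curve v).Divisor := fun v =>
    y.D.onCurve v - markDiv v fun e => w₀.leave e v (sign e v * cob (c v) e)
  have hD : IsAdapted w₀ c A y.D := ⟨fun v => (sub_add_cancel _ _).symm, hy.2⟩
  have hW := le_sections_of_rank hT hr hy.degree_onCurve hD y.finrank_eq y.rank_eq.1
  have hcond := vanishingCondition_of_rank hT hD y.finrank_eq hW y.rank_eq.1
  have hdeg : ∀ v, (A v).degree = (w v).vert v := fun v => by
    rw [Divisor.degree_sub, hy.degree_onCurve, degree_markDiv_leave, hc v, sub_sub_cancel]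
  -- The existence of a limit linear series forces the nonnegativity, so the target is also empty
  -- when a coefficient is negative.
  have hpos : ∀ v, 0 ≤ (w v).vert v := fun v => by
    have h : Nontrivial (y.H v) :=
      Module.nontrivial_of_finrank_pos (R := κ) (by rw [y.finrank_eq]; omega)
    obtain ⟨f, hf⟩ := exists_ne (0 : y.H v)
    rw [← hdeg]
    exact degree_nonneg_of_mem_sections (by simpa using hf) (hW v f.2)
  rw [vanishingCondition_iff hT hc (redAt_of_isReducedTuple hT hred) hpos] at hcond
  refine ⟨⟨A, y.H, hdeg, hW, y.finrank_eq,
    (exists_isMultivanishing_iff hW y.finrank_eq).mpr hcond⟩, hy, fun v => ?_, fun v => ?_⟩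
  · obtain ⟨φ, hφ, -⟩ := w₀.exists_isEquivVia_act (c v)
    refine ⟨φ, hc v ▸ hφ, fun P => ?_⟩
    rw [slopeAt_eq, markDiv_slope_of_isEquivVia hT (hr v) hφ, (𝔠.curve v).ord_one]
    change y.D.onCurve v P = 0 + (y.D.onCurve v - _) P - _
    rw [Finsupp.sub_apply, Finsupp.neg_apply]
    ring
  · rw [inv_one, LinearMap.mulLeft_one, Submodule.map_id]

theorem exists_isForgetfulMap_bijective (hT : 𝔠.graph.IsMultitree)
    (hred : Multidegree.IsReducedTuple w₀ w) (r : ℕ) :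
    ∃ F : 𝔠.PreLimitSeries w r → 𝔠.LimitSeriesOf w₀ r,
      IsForgetfulMap F ∧ Function.Bijective F := by
  have h0 : ∀ v, (1 : (𝔠.curve v).RatFn) ≠ 0 := fun _ => one_ne_zero
  have hrefl : Multidegree.Reaches w₀ w₀ := Relation.ReflTransGen.refl
  have hiso : ∀ x : 𝔠.PreLimitData w r, x.Isomorphic x := fun x =>
    ⟨fun _ => 1, fun v => ⟨one_ne_zero, fun P => by rw [(𝔠.curve v).ord_one, sub_zero], by
      rw [LinearMap.mulLeft_one, Submodule.map_id]⟩⟩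
  choose y hy using fun x : 𝔠.PreLimitData w r =>
    x.exists_isForgetfulPair hT hred (fun _ => 1) h0 hrefl
  refine ⟨Quot.lift (fun x => ⟨Quot.mk _ (y x), y x, rfl, (hy x).1⟩) fun x x' h =>
    Subtype.ext (Quot.sound ((hy x).equivalent hT hred h h0 h0 hrefl hrefl (hy x'))), ?_, ?_, ?_⟩
  · intro x s u hs hu
    obtain ⟨z, hz⟩ := x.exists_isForgetfulPair hT hred s (fun v => (hs v).2) hu
    exact ⟨z, hz, Quot.sound
      ((hy x).equivalent hT hred (hiso x) h0 (fun v => (hs v).2) hrefl hu hz)⟩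
  · rintro ⟨x⟩ ⟨x'⟩ h
    have h1 := Quot.eqvGen_exact (congrArg Subtype.val h)
    rw [LimitPair.equivalence_equivalent.eqvGen_iff] at h1
    exact Quot.sound ((hy x).isomorphic hT hred h0 h0 (hy x') h1)
  · rintro ⟨q, z, rfl, hz⟩
    obtain ⟨x, hx⟩ := z.exists_isForgetfulPair hT hred hz
    exact ⟨Quot.mk _ x, Subtype.ext (Quot.sound
      ((hy x).equivalent hT hred (hiso x) h0 h0 hrefl hrefl hx))⟩

end MetrizedComplex

end

end LimitLinear

/-! ### The main theorem -/

theorem mainTheorem3 {κ : Type u} [Field κ] [IsAlgClosed κ]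
    (X₀ : LimitLinear.NodalCurve κ) (o : X₀.Orientation)
    (hX₀ : (X₀.dualGraph o).IsMultitree) (n : (X₀.dualGraph o).ChainStructure)
    (w₀ : LimitLinear.MGraph.Multidegree (X₀.dualGraph o) n) (r : ℕ) :
    ∃ wred : (X₀.dualGraph o).V → LimitLinear.MGraph.Multidegree (X₀.dualGraph o) n,
      LimitLinear.MGraph.Multidegree.IsReducedTuple w₀ wred ∧
      (∀ w, LimitLinear.MGraph.Multidegree.IsReducedTuple w₀ w → w = wred) ∧
      ((∀ v, 0 ≤ (wred v).vert v) → LimitLinear.MGraph.Multidegree.IsTight wred) ∧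
      ∃ F : (X₀.metrizedComplex o n).PreLimitSeries wred r →
          (X₀.metrizedComplex o n).LimitSeriesOf w₀ r,
        LimitLinear.MetrizedComplex.IsForgetfulMap F ∧ Function.Bijective F := by
  obtain ⟨wred, hred⟩ := LimitLinear.MGraph.Multidegree.exists_isReducedTuple hX₀ w₀
  exact ⟨wred, hred, fun w h => LimitLinear.MGraph.Multidegree.isReducedTuple_unique hX₀ hred h,
    fun hpos => LimitLinear.MGraph.Multidegree.isTight_of_isReducedTuple hX₀ hred hpos,
    LimitLinear.MetrizedComplex.exists_isForgetfulMap_bijective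
      (𝔠 := X₀.metrizedComplex o n) hX₀ hred r⟩
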